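/- **Setting.** An episodic time-inhomogeneous tabular MDP $M$ with horizon $H\ge1$, $S$ states, $A$ actions and fixed initial state $s_1$: playing $a$ in state $s$ at step $h$ yields a random reward in $[0,1]$ with mean $R_{h,s,a}$ and a next state $s'$ with probability $P_{h,s,a}(s')$. For a deterministic policy $\pi=(\pi_1,\dots,\pi_H)$ let $V^\pi_{H+1}=0$, $V^\pi_h(s)=R_{h,s,\pi_h(s)}+\sum_{s'}P_{h,s,\pi_h(s)}(s')V^\pi_{h+1}(s')$, and $V^*_h(s)=\max_\pi V^\pi_h(s)$. **Algorithm (Single Seed Randomization with Hoeffding-type noise).** Before episode $k=1,2,\dots$ let $n_k(h,s,a)$ be the number of earlier episodes in which $a$ was played in $s$ at step $h$; let $\hat R^k_{h,s,a}$ be the sum of the rewards observed on these visits, and $\hat P^k_{h,s,a}(s')$ the number of these visits followed by $s'$, both divided by $n_k(h,s,a)+1$. Put $$\sigma^k_{\mathrm{Ho}}(h,s,a)=H\sqrt{\frac{\log(2HSAk^2)}{n_k(h,s,a)+1}}+\frac{H}{n_k(h,s,a)+1}.$$ Draw one seed $\hat z_k\sim\mathcal N(0,1)$, independent of the past, set $\overline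 V_{H+1,k}=0$ and, for $h=H,\dots,1$, $$\overline Q_{h,k}(s,a)=\hat R^k_{h,s,a}+\langle\hat P^k_{h,s,a},\overline V_{h+1,k}\rangle+\sigma^k_{\mathrm{Ho}}(h,s,a)\,\hat z_k,\qquad \overline V_{h,k}(s)=\mathrm{clip}_{2(H-h+1)}\Big(\max_a\overline Q_{h,k}(s,a)\Big),$$ where $\mathrm{clip}_c(x)=\max\{-c,\min\{c,x\}\}$. Play $\pi^k_h(s)\in\arg\max_a\overline Q_{h,k}(s,a)$ (any measurable tie-breaking) throughout the episode. The regret after $K\ge1$ episodes is $\mathrm{Reg}(M,K)=\sum_{k=1}^K\big(V_1^*(s_1)-V_1^{\pi^k}(s_1)\big)$; write $T=HK$. **Theorem 1.** (i) There is an absolute constant $p\in\mathbb N$ such that for every $\varepsilon>0$ there is $C>0$, depending only on $\varepsilon$, such that for all $H,S,A,K$, every such MDP $M$ and every $\delta>0$, with probability at least $1-\delta$, $$\mathrm{Reg}(M,K)\le C\,\log^p\!\Big(\frac{2HSAT}{\delta}\Big)\Big(H^{1.5}\sqrt{SAT}+H^4S^2A\Big)+C\,H\,\delta^{-\varepsilon}.$$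 In particular, for each fixed $\delta$ the regret is $\widetilde O(H^{1.5}\sqrt{SAT}+H^4S^2A)$ with probability at least $1-\delta$. (ii) For all $c>0$ and $q\in\mathbb N$ there is $p\in\mathbb N$ such that for every $\varepsilon>0$ there is $C>0$, depending only on $c,q,\varepsilon$, such that for all $H,S,A,K,M$ and $\delta>0$ with $T\,\log^q(2HSAT/\delta)\ge c\,H^5S^3A$ (which holds for instance, with $c=1$ and $q=0$, if $T\ge H^5S^3A$), with probability at least $1-\delta$, $$\mathrm{Reg}(M,K)\le C\,\log^p\!\Big(\frac{2HSAT}{\delta}\Big)H^{1.5}\sqrt{SAT}+C\,H\,\delta^{-\varepsilon}.$$ -/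

import Mathlib

open MeasureTheory ProbabilityTheory

/-- A time-inhomogeneous episodic tabular MDP with horizon `H`, `S` states and `A` actions.
The steps `1, …, H` are indexed by `Fin H` (so index `h` is step `h + 1`). Playing `a` in state `s`
at step `h` produces a random pair (reward, next state) with law `law h s a`; rewards lie in
`[0, 1]`, and no independence between reward and next state is required. -/
structure TabularMDP (H S A : ℕ) where
  /-- the fixed initial state of every episode -/
  init : Fin S
  /-- joint law of the reward and the next state -/
  law : Fin H → Fin S → Fin A → Measure (ℝ × Fin S)
  law_prob : ∀ h s a, IsProbabilityMeasure (law h s a)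
  reward_mem : ∀ h s a, ∀ᵐ x ∂(law h s a), x.1 ∈ Set.Icc (0 : ℝ) 1

/-- A deterministic (time-dependent) policy. -/
abbrev Policy (H S A : ℕ) : Type := Fin H → Fin S → Fin A

/-- The data of one episode: states `s_1, …, s_{H+1}`, actions and rewards. -/
structure Episode (H S A : ℕ) where
  state : Fin (H + 1) → Fin S
  action : Fin H → Fin A
  reward : Fin H → ℝ

/-- One outcome (reward, next state) for every step, state and action. -/
abbrev Draws (H S A : ℕ) : Type := Fin H → Fin S → Fin A → ℝ × Fin S

namespace TabularMDP

variable {H S A : ℕ}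

instance (M : TabularMDP H S A) (h : Fin H) (s : Fin S) (a : Fin A) :
    IsProbabilityMeasure (M.law h s a) := M.law_prob h s a

/-- Transition probability `P_{h,s,a}(s')`. -/
noncomputable def P (M : TabularMDP H S A) (h : Fin H) (s : Fin S) (a : Fin A) (s' : Fin S) : ℝ :=
  (M.law h s a).real {x | x.2 = s'}

/-- Mean reward `R_{h,s,a}`. -/
noncomputable def R (M : TabularMDP H S A) (h : Fin H) (s : Fin S) (a : Fin A) : ℝ :=
  ∫ x, x.1 ∂(M.law h s a)

/-- Value function of the policy `π` from the step with index `h` on; it is `0` after step `H`. -/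
noncomputable def value (M : TabularMDP H S A) (π : Policy H S A) (h : ℕ) (s : Fin S) : ℝ :=
  if hh : h < H then
    M.R ⟨h, hh⟩ s (π ⟨h, hh⟩ s) +
      ∑ s' : Fin S, M.P ⟨h, hh⟩ s (π ⟨h, hh⟩ s) s' * M.value π (h + 1) s'
  else 0
termination_by H - h

/-- Optimal value function: the maximum over the (finitely many) deterministic policies. -/
noncomputable def optValue (M : TabularMDP H S A) (h : ℕ) (s : Fin S) : ℝ :=
  ⨆ π : Policy H S A, M.value π h s

/-- The episode obtained by following `π` from the initial state, where the environment answers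
action `a` in state `s` at step `h` with the reward and next state `d h s a`. -/
def rollout (M : TabularMDP H S A) (π : Policy H S A) (d : Draws H S A) : Episode H S A :=
  let st : Fin (H + 1) → Fin S :=
    Fin.induction (motive := fun _ => Fin S) M.init (fun h s => (d h s (π h s)).2)
  { state := st
    action := fun h => π h (st h.castSucc)
    reward := fun h => (d h (st h.castSucc) (π h (st h.castSucc))).1 }

end TabularMDP

namespace SSR

variable {H S A : ℕ}

/-- `n_k(h,s,a)`: the number of visits to `(s,a)` at step `h` in the past episodes `D`. -/
def count (D : List (Episode H S A)) (h : Fin H) (s : Fin S) (a : Fin A) : ℕ :=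
  D.countP (fun e => e.state h.castSucc = s ∧ e.action h = a)

/-- Empirical reward, with denominator `n_k(h,s,a) + 1`. -/
noncomputable def rewardHat (D : List (Episode H S A)) (h : Fin H) (s : Fin S) (a : Fin A) : ℝ :=
  (D.map (fun e => if e.state h.castSucc = s ∧ e.action h = a then e.reward h else 0)).sum /
    ((count D h s a : ℝ) + 1)

/-- Empirical transition weights, with denominator `n_k(h,s,a) + 1`. -/
noncomputable def transHat (D : List (Episode H S A)) (h : Fin H) (s : Fin S) (a : Fin A)
    (s' : Fin S) : ℝ :=
  (D.countP (fun e => e.state h.castSucc = s ∧ e.action h = a ∧ e.state h.succ = s') : ℝ) /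
    ((count D h s a : ℝ) + 1)

/-- Hoeffding-type noise magnitude; the index of the current episode is `k = D.length + 1`. -/
noncomputable def sigmaHo (D : List (Episode H S A)) (h : Fin H) (s : Fin S) (a : Fin A) : ℝ :=
  (H : ℝ) * √(Real.log (2 * H * S * A * ((D.length : ℝ) + 1) ^ 2) / ((count D h s a : ℝ) + 1)) +
    (H : ℝ) / ((count D h s a : ℝ) + 1)

/-- `clip_c(x) = max(-c, min(c, x))`. -/
noncomputable def clip (c x : ℝ) : ℝ := max (-c) (min c x)

/-- One perturbed Bellman backup of `V` with seed `z`. -/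
noncomputable def backup (D : List (Episode H S A)) (z : ℝ) (V : Fin S → ℝ)
    (h : Fin H) (s : Fin S) (a : Fin A) : ℝ :=
  rewardHat D h s a + ∑ s' : Fin S, transHat D h s a s' * V s' + sigmaHo D h s a * z

/-- The clipped value function `V̄`. At index `h`, i.e. step `h + 1`, the clipping level
`2 (H - (h + 1) + 1)` is `2 (H - h)`. -/
noncomputable def vbar (D : List (Episode H S A)) (z : ℝ) (h : ℕ) (s : Fin S) : ℝ :=
  if hh : h < H then
    clip (2 * ((H : ℝ) - h)) (⨆ a : Fin A, backup D z (vbar D z (h + 1)) ⟨h, hh⟩ s a)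
  else 0
termination_by H - h

/-- The perturbed action-value function `Q̄`. -/
noncomputable def qbar (D : List (Episode H S A)) (z : ℝ) (h : Fin H) (s : Fin S) (a : Fin A) : ℝ :=
  backup D z (vbar D z (h + 1)) h s a

/-- A rule that picks a maximizing action; ties may be broken in any measurable way, depending on
the episode, the step and the state. -/
def IsArgmaxRule (sel : ℕ → Fin H → Fin S → (Fin A → ℝ) → Fin A) : Prop :=
  ∀ k h s, Measurable (sel k h s) ∧ ∀ (q : Fin A → ℝ) (a : Fin A), q a ≤ q (sel k h s q)

/-- The policy played after the past episodes `D` when the seed is `z`. -/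
noncomputable def policy (sel : ℕ → Fin H → Fin S → (Fin A → ℝ) → Fin A)
    (D : List (Episode H S A)) (z : ℝ) : Policy H S A :=
  fun h s => sel D.length h s (qbar D z h s)

/-- Sample space: for every episode a seed and the outcomes of all step-state-action triples. -/
abbrev Sample (H S A : ℕ) : Type := ℕ → ℝ × Draws H S A

/-- The past episodes before episode `k` (episodes are numbered from `0` here). Only the outcomes
of the triples that are actually visited enter the data. -/
noncomputable def history (M : TabularMDP H S A)
    (sel : ℕ → Fin H → Fin S → (Fin A → ℝ) → Fin A) (ω : Sample H S A) :
    ℕ → List (Episode H S A)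
  | 0 => []
  | k + 1 => history M sel ω k ++
      [M.rollout (policy sel (history M sel ω k) (ω k).1) (ω k).2]

/-- Law of the samples: all seeds are standard Gaussian, the outcome of `(h,s,a)` in any episode has
law `M.law h s a`, and everything is independent. Hence the seed is independent of the past, and
given the past, the seed and the current state and action, the observed reward and next state have
the law prescribed by the MDP. -/
noncomputable def sampleLaw (M : TabularMDP H S A) : Measure (Sample H S A) :=
  Measure.infinitePi (fun _ : ℕ =>
    (gaussianReal 0 1).prod
      (Measure.pi fun h : Fin H => Measure.pi fun s : Fin S => Measure.pi fun a : Fin A =>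
        M.law h s a))

/-- Regret over `K` episodes. -/
noncomputable def regret (M : TabularMDP H S A)
    (sel : ℕ → Fin H → Fin S → (Fin A → ℝ) → Fin A) (K : ℕ) (ω : Sample H S A) : ℝ :=
  ∑ k ∈ Finset.range K,
    (M.optValue 0 M.init - M.value (policy sel (history M sel ω k) (ω k).1) 0 M.init)

end SSR

/-! One seed multiplies every noise magnitude. Hence a single event, that the seed lies in `[B,
B+1]`, makes all perturbed backups optimistic at once, and its probability depends on `B` alone, not
on `H`, `S` or `A`.

The deterministic core assumes two accuracy properties of the data: backups of the fixed function
`V*` are accurate up to `B` noise magnitudes, and each transition weight is accurate up to a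
relative error `1/(8H)` plus a term of order one over the visit count. Relative errors compound over
`H` steps to a factor at most 2. For an optimistic seed `z'` and the seed `z` actually drawn, the
gap `V* - V^π` is at most `V̄(z') - V̄(z)` plus `V̄(z) - V^π`. The first is paid by bonuses along
the policy of `z'` (`optValue_le_vbar`, `vbar_sub_vbar_le`), the second by bonuses along the policy
of `z` plus a quarter of the gap itself (`abs_value_sub_vbar_le`), which is absorbed in `gap_le`.

The optimistic policy need not have been played. But the drawn seed has the same law as `z'`, so
averaging over `z'` in `[B, B+1]` bounds the conditional expected gap by the conditional expected
bonus of the policy that is played, divided by the Gaussian mass of `[B, B+1]` (`integral_gap_le`).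

Accuracy comes from exponential supermartingales over the visits to a triple
(`measure_visitSum_gt_le`). Conditional means and realised values of nonnegative bounded quantities
agree up to a factor 2 and a logarithm (`measure_resampleMean_gt_le`,
`measure_sum_gt_resampleMean_le`), so gaps and bonuses can pass between the two. The realised
bonuses are summed by pigeonhole (`sum_visited_eq`): the inverse square roots give `H^2 √(SAK) =
H^1.5 √(SAT)`, the inverse counts only lower-order terms.

The noise contains `log(2HSAk²)`, not the confidence logarithm `L` with its `δ`. The two are
comparable, with ratio `2 + 1/ε`, once the episode number exceeds both `√K` and `δ^(-ε)`
(`log_confidence_le`). Earlier episodes are charged the trivial gap `H`; this is the source of the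
`δ^(-ε)` term. -/

/-! ### Resampling one coordinate of a product measure -/

section Resample

variable {ι : Type*} [DecidableEq ι] {X : ι → Type*} [∀ i, MeasurableSpace (X i)]
  (μ : ∀ i, Measure (X i)) [∀ i, IsProbabilityMeasure (μ i)]

/-- Resampling one coordinate of a product measure does not change its law. -/
theorem measurePreserving_update_infinitePi (k : ι) :
    MeasurePreserving (fun p : (∀ i, X i) × X k => Function.update p.1 k p.2)
      ((Measure.infinitePi μ).prod (μ k)) (Measure.infinitePi μ) := by
  refine ⟨measurable_update', ?_⟩
  refine Measure.eq_infinitePi μ fun s t ht => ?_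
  classical
  rw [Measure.map_apply measurable_update' (.pi (Finset.countable_toSet s) fun i _ => ht i)]
  by_cases hk : k ∈ s
  · have : (fun p : (∀ i, X i) × X k => Function.update p.1 k p.2) ⁻¹' (s : Set ι).pi t =
        (((s.erase k : Finset ι) : Set ι).pi t) ×ˢ t k := by
      ext ⟨x, y⟩
      simp only [Set.mem_preimage, Set.mem_pi, Finset.mem_coe, Set.mem_prod, Finset.mem_erase]
      constructor
      · intro h
        exact ⟨fun i hi => by simpa [Function.update_of_ne hi.1] using h i hi.2,
          by simpa using h k hk⟩
      · rintro ⟨h1, h2⟩ i hi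
        by_cases hik : i = k
        · subst hik; simpa using h2
        · simpa [Function.update_of_ne hik] using h1 i ⟨hik, hi⟩
    rw [this, Measure.prod_prod, Measure.infinitePi_pi _ fun i _ => ht i,
      Finset.prod_erase_mul _ _ hk]
  · have : (fun p : (∀ i, X i) × X k => Function.update p.1 k p.2) ⁻¹' (s : Set ι).pi t =
        ((s : Set ι).pi t) ×ˢ Set.univ := by
      ext ⟨x, y⟩
      simp only [Set.mem_preimage, Set.mem_pi, Finset.mem_coe, Set.mem_prod, Set.mem_univ, and_true]
      refine forall₂_congr fun i hi => ?_
      rw [Function.update_of_ne (ne_of_mem_of_not_mem hi hk)]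
    rw [this, Measure.prod_prod, Measure.infinitePi_pi _ fun i _ => ht i]
    simp

/-- The tower property in concrete form: conditioning on the other coordinates means freezing them.
The martingale arguments below therefore work without filtrations. -/
theorem lintegral_infinitePi_update (k : ι) {f : (∀ i, X i) → ENNReal} (hf : Measurable f) :
    ∫⁻ x, f x ∂(Measure.infinitePi μ) =
      ∫⁻ x, ∫⁻ y, f (Function.update x k y) ∂(μ k) ∂(Measure.infinitePi μ) := by
  rw [← (measurePreserving_update_infinitePi μ k).lintegral_comp hf,
    lintegral_prod (fun p : (∀ i, X i) × X k => f (Function.update p.1 k p.2))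
      (hf.comp measurable_update').aemeasurable]

theorem lintegral_infinitePi_le_of_update (k : ι) {f : (∀ i, X i) → ENNReal} (hf : Measurable f)
    {c : ENNReal} (h : ∀ x, ∫⁻ y, f (Function.update x k y) ∂(μ k) ≤ c) :
    ∫⁻ x, f x ∂(Measure.infinitePi μ) ≤ c := by
  rw [lintegral_infinitePi_update μ k hf]
  exact (lintegral_mono h).trans (by simp)

theorem lintegral_pi_le_of_update [Fintype ι] (k : ι) {f : (∀ i, X i) → ENNReal} (hf : Measurable f)
    {c : ENNReal} (h : ∀ x, ∫⁻ y, f (Function.update x k y) ∂(μ k) ≤ c) :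
    ∫⁻ x, f x ∂(Measure.pi μ) ≤ c := by
  rw [← Measure.infinitePi_eq_pi]
  exact lintegral_infinitePi_le_of_update μ k hf h

theorem integral_infinitePi_update (k : ι) {f : (∀ i, X i) → ℝ}
    (hf : Integrable f (Measure.infinitePi μ)) :
    ∫ x, f x ∂(Measure.infinitePi μ) =
      ∫ x, ∫ y, f (Function.update x k y) ∂(μ k) ∂(Measure.infinitePi μ) := by
  have hp := measurePreserving_update_infinitePi μ k
  rw [← hp.map_eq] at hf
  have h2 : Integrable (fun p : (∀ i, X i) × X k => f (Function.update p.1 k p.2))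
      ((Measure.infinitePi μ).prod (μ k)) := hf.comp_measurable measurable_update'
  rw [← integral_prod (f := fun p : (∀ i, X i) × X k => f (Function.update p.1 k p.2)) h2]
  conv_lhs => rw [← hp.map_eq]
  exact integral_map measurable_update'.aemeasurable hf.aestronglyMeasurable

theorem integral_pi_update [Fintype ι] (k : ι) {f : (∀ i, X i) → ℝ}
    (hf : Integrable f (Measure.pi μ)) :
    ∫ x, f x ∂(Measure.pi μ) =
      ∫ x, ∫ y, f (Function.update x k y) ∂(μ k) ∂(Measure.pi μ) := by
  rw [← Measure.infinitePi_eq_pi] at hf ⊢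
  exact integral_infinitePi_update μ k hf

end Resample

/-! ### Exponential supermartingales -/

section Supermartingale

variable {X : Type*} [MeasurableSpace X] (μ : Measure X) [IsProbabilityMeasure μ]

/-- Integrate out the last coordinate first: by adaptedness it enters only the last factor, whose
inner integral is at most 1. -/
theorem lintegral_prod_adapted_le_one {Φ : ℕ → (ℕ → X) → ENNReal} (hΦ : ∀ i, Measurable (Φ i))
    (hadapt : ∀ i (ω : ℕ → X) k (x : X), i < k → Φ i (Function.update ω k x) = Φ i ω)
    (h1 : ∀ i ω, ∫⁻ x, Φ i (Function.update ω i x) ∂μ ≤ 1) (k : ℕ) :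
    ∫⁻ ω, ∏ i ∈ Finset.range k, Φ i ω ∂(Measure.infinitePi fun _ : ℕ => μ) ≤ 1 := by
  induction k with
  | zero => simp
  | succ k ih =>
    rw [lintegral_infinitePi_update (fun _ => μ) k (Finset.measurable_prod _ fun i _ => hΦ i)]
    refine le_trans (lintegral_mono fun ω => ?_) ih
    simp only [Finset.prod_range_succ]
    have : ∀ x, ∏ i ∈ Finset.range k, Φ i (Function.update ω k x) =
        ∏ i ∈ Finset.range k, Φ i ω := fun x =>
      Finset.prod_congr rfl fun i hi => hadapt i ω k x (Finset.mem_range.1 hi)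
    simp_rw [this]
    rw [lintegral_const_mul (f := fun y => Φ k (Function.update ω k y)) _
      ((hΦ k).comp (measurable_update _))]
    exact mul_le_of_le_one_right' (h1 k ω)

/-- Chernoff bound for adapted increments whose conditional exponential moments are at most `1`. -/
theorem measure_sum_adapted_ge_le {ξ : ℕ → (ℕ → X) → ℝ} (hξ : ∀ i, Measurable (ξ i))
    (hadapt : ∀ i (ω : ℕ → X) k (x : X), i < k → ξ i (Function.update ω k x) = ξ i ω)
    (h1 : ∀ i ω, ∫⁻ x, ENNReal.ofReal (Real.exp (ξ i (Function.update ω i x))) ∂μ ≤ 1)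
    (k : ℕ) (L : ℝ) :
    (Measure.infinitePi fun _ : ℕ => μ) {ω | L < ∑ i ∈ Finset.range k, ξ i ω} ≤
      ENNReal.ofReal (Real.exp (-L)) := by
  set P := Measure.infinitePi fun _ : ℕ => μ
  have hΦ : ∀ i, Measurable fun ω => ENNReal.ofReal (Real.exp (ξ i ω)) := fun i =>
    (Real.measurable_exp.comp (hξ i)).ennreal_ofReal
  have hle := lintegral_prod_adapted_le_one μ hΦ
    (fun i ω k x hik => by rw [hadapt i ω k x hik]) h1 k
  have hm : Measurable fun ω => ∏ i ∈ Finset.range k, ENNReal.ofReal (Real.exp (ξ i ω)) :=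
    Finset.measurable_prod _ fun i _ => hΦ i
  have hmk := mul_meas_ge_le_lintegral (μ := P) hm (ENNReal.ofReal (Real.exp L))
  have hsub : {ω | L < ∑ i ∈ Finset.range k, ξ i ω} ⊆
      {ω | ENNReal.ofReal (Real.exp L) ≤ ∏ i ∈ Finset.range k, ENNReal.ofReal (Real.exp (ξ i ω))} := by
    intro ω hω
    simp only [Set.mem_ofPred_eq] at hω ⊢
    rw [← ENNReal.ofReal_prod_of_nonneg fun i _ => (Real.exp_pos _).le, ← Real.exp_sum]
    exact ENNReal.ofReal_le_ofReal (Real.exp_le_exp.2 hω.le)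
  have h3 : ENNReal.ofReal (Real.exp L) * P {ω | L < ∑ i ∈ Finset.range k, ξ i ω} ≤ 1 :=
    (mul_le_mul_right (measure_mono hsub) _).trans (hmk.trans hle)
  rw [Real.exp_neg, ENNReal.ofReal_inv_of_pos (Real.exp_pos _)]
  rw [ENNReal.le_inv_iff_mul_le, mul_comm]
  exact h3

end Supermartingale

/-! ### Value functions and the Bellman optimality equation -/

namespace TabularMDP

variable {H S A : ℕ} (M : TabularMDP H S A)

theorem P_nonneg (h : Fin H) (s : Fin S) (a : Fin A) (s' : Fin S) : 0 ≤ M.P h s a s' :=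
  measureReal_nonneg

theorem measurableSet_snd_eq (s' : Fin S) : MeasurableSet {x : ℝ × Fin S | x.2 = s'} :=
  measurable_snd (measurableSet_singleton s')

theorem integral_comp_snd (h : Fin H) (s : Fin S) (a : Fin A) (g : Fin S → ℝ) :
    ∫ x, g x.2 ∂(M.law h s a) = ∑ s', M.P h s a s' * g s' := by
  have h1 : (fun x : ℝ × Fin S => g x.2) =
      fun x => ∑ s', Set.indicator {x : ℝ × Fin S | x.2 = s'} (fun _ => g s') x := by
    funext x
    simp [Set.indicator_apply]
  rw [h1, integral_finsetSum _ fun s' _ =>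
    (integrable_const (g s')).indicator (measurableSet_snd_eq s')]
  refine Finset.sum_congr rfl fun s' _ => ?_
  rw [integral_indicator_const _ (measurableSet_snd_eq s')]
  rfl

theorem sum_P (h : Fin H) (s : Fin S) (a : Fin A) : ∑ s', M.P h s a s' = 1 := by
  have := M.integral_comp_snd h s a (fun _ => 1)
  simpa using this.symm

theorem integrable_reward (h : Fin H) (s : Fin S) (a : Fin A) :
    Integrable (fun x : ℝ × Fin S => x.1) (M.law h s a) :=
  Integrable.of_mem_Icc 0 1 measurable_fst.aemeasurable (M.reward_mem h s a)

theorem R_mem (h : Fin H) (s : Fin S) (a : Fin A) : M.R h s a ∈ Set.Icc (0 : ℝ) 1 := by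
  constructor
  · exact integral_nonneg_of_ae ((M.reward_mem h s a).mono fun x hx => hx.1)
  · have := integral_mono_ae (M.integrable_reward h s a) (integrable_const (1 : ℝ))
      ((M.reward_mem h s a).mono fun x hx => hx.2)
    simpa [R] using this

theorem value_of_lt (π : Policy H S A) {h : ℕ} (hh : h < H) (s : Fin S) :
    M.value π h s = M.R ⟨h, hh⟩ s (π ⟨h, hh⟩ s) +
      ∑ s' : Fin S, M.P ⟨h, hh⟩ s (π ⟨h, hh⟩ s) s' * M.value π (h + 1) s' := by
  rw [value, dif_pos hh]

theorem value_of_le (π : Policy H S A) {h : ℕ} (hh : H ≤ h) (s : Fin S) : M.value π h s = 0 := by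
  rw [value, dif_neg (by omega)]

theorem sum_P_mul_le {h : Fin H} {s : Fin S} {a : Fin A} {g : Fin S → ℝ} {c : ℝ}
    (hg : ∀ s', g s' ≤ c) : ∑ s', M.P h s a s' * g s' ≤ c :=
  calc ∑ s', M.P h s a s' * g s' ≤ ∑ s', M.P h s a s' * c :=
        Finset.sum_le_sum fun s' _ => mul_le_mul_of_nonneg_left (hg s') (M.P_nonneg ..)
    _ = c := by rw [← Finset.sum_mul, M.sum_P, one_mul]

theorem sum_P_mul_nonneg {h : Fin H} {s : Fin S} {a : Fin A} {g : Fin S → ℝ}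
    (hg : ∀ s', 0 ≤ g s') : 0 ≤ ∑ s', M.P h s a s' * g s' :=
  Finset.sum_nonneg fun s' _ => mul_nonneg (M.P_nonneg ..) (hg s')

theorem sum_P_mul_mono {h : Fin H} {s : Fin S} {a : Fin A} {g g' : Fin S → ℝ}
    (hg : ∀ s', g s' ≤ g' s') : ∑ s', M.P h s a s' * g s' ≤ ∑ s', M.P h s a s' * g' s' :=
  Finset.sum_le_sum fun s' _ => mul_le_mul_of_nonneg_left (hg s') (M.P_nonneg ..)

theorem value_nonneg (π : Policy H S A) (h : ℕ) (s : Fin S) : 0 ≤ M.value π h s := by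
  by_cases hh : h < H
  · rw [value_of_lt _ _ hh]
    exact add_nonneg (M.R_mem ..).1 (M.sum_P_mul_nonneg fun s' => value_nonneg π (h + 1) s')
  · rw [value_of_le _ _ (by omega)]
termination_by H - h

theorem value_le (π : Policy H S A) {h : ℕ} (hH : h ≤ H) (s : Fin S) :
    M.value π h s ≤ (H : ℝ) - h := by
  by_cases hh : h < H
  · rw [value_of_lt _ _ hh]
    have h1 := (M.R_mem ⟨h, hh⟩ s (π ⟨h, hh⟩ s)).2
    have h2 := M.sum_P_mul_le (h := ⟨h, hh⟩) (s := s) (a := π ⟨h, hh⟩ s)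
      fun s' => value_le π (h := h + 1) hh s'
    push_cast at h2
    linarith
  · rw [value_of_le _ _ (by omega)]
    have : (h : ℝ) ≤ H := by exact_mod_cast hH
    linarith
termination_by H - h

theorem value_congr {π π' : Policy H S A} {h : ℕ} (hπ : ∀ i : Fin H, h ≤ i → π i = π' i)
    (s : Fin S) : M.value π h s = M.value π' h s := by
  by_cases hh : h < H
  · rw [value_of_lt _ _ hh, value_of_lt _ _ hh, hπ ⟨h, hh⟩ le_rfl]
    congr 1
    refine Finset.sum_congr rfl fun s' _ => ?_
    rw [value_congr (h := h + 1) fun i hi => hπ i (by omega)]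
  · rw [value_of_le _ _ (by omega), value_of_le _ _ (by omega)]
termination_by H - h

/-- A deterministic policy that is optimal from every step and state on. -/
theorem exists_optimal [Nonempty (Fin A)] :
    ∃ π : Policy H S A, ∀ (π' : Policy H S A) (h : ℕ) (s : Fin S),
      M.value π' h s ≤ M.value π h s := by
  -- Backward induction on the number `j` of final steps from which the policy is already
  -- unbeatable. Changing the rule at one step leaves all later values untouched, so greedy rules
  -- can be inserted one at a time.
  suffices ∀ j, ∃ π : Policy H S A, ∀ (π' : Policy H S A) (h : ℕ) (s : Fin S), H ≤ h + j →
      M.value π' h s ≤ M.value π h s by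
    obtain ⟨π, hπ⟩ := this H
    exact ⟨π, fun π' h s => hπ π' h s (by omega)⟩
  intro j
  induction j with
  | zero =>
    exact ⟨fun _ _ => Classical.arbitrary _, fun π' h s hh => by
      rw [value_of_le _ _ (by omega), value_of_le _ _ (by omega)]⟩
  | succ j ih =>
    obtain ⟨π, hπ⟩ := ih
    by_cases hj : j + 1 ≤ H
    · set i : Fin H := ⟨H - (j + 1), by omega⟩ with hi
      have hmax : ∀ s, ∃ a, ∀ a', M.R i s a' + ∑ s', M.P i s a' s' * M.value π (i + 1) s' ≤
          M.R i s a + ∑ s', M.P i s a s' * M.value π (i + 1) s' := fun s =>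
        Finite.exists_max (fun a => M.R i s a + ∑ s', M.P i s a s' * M.value π (i + 1) s')
      choose f hf using hmax
      have hlater : ∀ h : ℕ, (i : ℕ) < h → ∀ s, M.value (Function.update π i f) h s = M.value π h s := by
        intro h hh s
        refine M.value_congr (fun l hl => ?_) s
        rw [Function.update_of_ne]
        intro hc
        rw [hc] at hl
        omega
      refine ⟨Function.update π i f, fun π' h s hh => ?_⟩
      rcases lt_or_eq_of_le (show (i : ℕ) ≤ h by simp only [hi]; omega) with hlt | heq
      · rw [hlater h hlt]
        exact hπ π' h s (by simp only [hi] at hlt; omega)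
      · subst heq
        rw [value_of_lt _ _ i.2, value_of_lt _ _ i.2]
        simp only [Fin.eta, Function.update_self]
        have := hf s (π' i s)
        have h2 : ∑ s', M.P i s (π' i s) s' * M.value π' (i + 1) s' ≤
            ∑ s', M.P i s (π' i s) s' * M.value π (i + 1) s' :=
          M.sum_P_mul_mono fun s' => hπ π' _ s' (by simp only [hi]; omega)
        have h3 : ∀ s', M.value (Function.update π i f) (i + 1) s' = M.value π (i + 1) s' :=
          hlater _ (Nat.lt_succ_self _)
        simp_rw [h3]
        linarith
    · exact ⟨π, fun π' h s _ => hπ π' h s (by omega)⟩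

theorem value_le_optValue (π : Policy H S A) (h : ℕ) (s : Fin S) :
    M.value π h s ≤ M.optValue h s :=
  le_ciSup (f := fun π : Policy H S A => M.value π h s) (Set.finite_range _).bddAbove π

theorem exists_value_eq_optValue [Nonempty (Fin A)] :
    ∃ π : Policy H S A, ∀ (h : ℕ) (s : Fin S), M.value π h s = M.optValue h s := by
  obtain ⟨π, hπ⟩ := M.exists_optimal
  exact ⟨π, fun h s => le_antisymm (M.value_le_optValue π h s) (ciSup_le fun π' => hπ π' h s)⟩

section Optimal

variable [Nonempty (Fin A)]

theorem optValue_nonneg (h : ℕ) (s : Fin S) : 0 ≤ M.optValue h s := by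
  obtain ⟨π, hπ⟩ := M.exists_value_eq_optValue
  rw [← hπ]
  exact M.value_nonneg π h s

theorem optValue_le {h : ℕ} (hH : h ≤ H) (s : Fin S) : M.optValue h s ≤ (H : ℝ) - h := by
  obtain ⟨π, hπ⟩ := M.exists_value_eq_optValue
  rw [← hπ]
  exact M.value_le π hH s

theorem optValue_of_le {h : ℕ} (hH : H ≤ h) (s : Fin S) : M.optValue h s = 0 := by
  obtain ⟨π, hπ⟩ := M.exists_value_eq_optValue
  rw [← hπ, value_of_le _ _ hH]

theorem bellman_le_optValue (h : Fin H) (s : Fin S) (a : Fin A) :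
    M.R h s a + ∑ s', M.P h s a s' * M.optValue (h + 1) s' ≤ M.optValue h s := by
  obtain ⟨π, hπ⟩ := M.exists_value_eq_optValue
  have hle := M.value_le_optValue (Function.update π h fun _ => a) h s
  rw [value_of_lt _ _ h.2] at hle
  simp only [Fin.eta, Function.update_self] at hle
  have h3 : ∀ s', M.value (Function.update π h fun _ => a) (h + 1) s' = M.optValue (h + 1) s' := by
    intro s'
    rw [← hπ]
    refine M.value_congr (fun l hl => ?_) s'
    rw [Function.update_of_ne]
    intro hc
    rw [hc] at hl
    omega
  simpa [h3] using hle

theorem exists_optValue_eq (h : Fin H) (s : Fin S) :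
    ∃ a, M.optValue h s = M.R h s a + ∑ s', M.P h s a s' * M.optValue (h + 1) s' := by
  obtain ⟨π, hπ⟩ := M.exists_value_eq_optValue
  refine ⟨π h s, ?_⟩
  rw [← hπ, value_of_lt _ _ h.2]
  simp [hπ]

end Optimal

/-! ### Occupancy measures and rollouts -/

/-- Probability that the policy `π` is in state `s` at the step with index `h`. -/
noncomputable def occ (π : Policy H S A) : ℕ → Fin S → ℝ
  | 0 => fun s => if s = M.init then 1 else 0
  | h + 1 => fun s' => if hh : h < H then ∑ s, occ π h s * M.P ⟨h, hh⟩ s (π ⟨h, hh⟩ s) s' else 0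

/-- Expectation of `g` under the state distribution of `π` at the step with index `h`. -/
noncomputable def occE (π : Policy H S A) (h : ℕ) (g : Fin S → ℝ) : ℝ :=
  ∑ s, M.occ π h s * g s

variable (π : Policy H S A)

theorem occ_nonneg (h : ℕ) (s : Fin S) : 0 ≤ M.occ π h s := by
  induction h generalizing s with
  | zero => simp only [occ]; split_ifs <;> norm_num
  | succ h ih =>
    simp only [occ]
    split_ifs
    · exact Finset.sum_nonneg fun s' _ => mul_nonneg (ih s') (M.P_nonneg ..)
    · exact le_rfl

theorem occE_zero (g : Fin S → ℝ) : M.occE π 0 g = g M.init := by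
  simp [occE, occ]

theorem occE_succ (h : Fin H) (g : Fin S → ℝ) :
    M.occE π (h + 1) g = M.occE π h fun s => ∑ s', M.P h s (π h s) s' * g s' := by
  simp only [occE, occ, h.2, dif_pos, Fin.eta, Finset.sum_mul, Finset.mul_sum]
  rw [Finset.sum_comm]
  exact Finset.sum_congr rfl fun _ _ => Finset.sum_congr rfl fun _ _ => by ring

theorem occE_mono {h : ℕ} {g g' : Fin S → ℝ} (hg : ∀ s, g s ≤ g' s) :
    M.occE π h g ≤ M.occE π h g' :=
  Finset.sum_le_sum fun s _ => mul_le_mul_of_nonneg_left (hg s) (M.occ_nonneg ..)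

theorem occE_nonneg {h : ℕ} {g : Fin S → ℝ} (hg : ∀ s, 0 ≤ g s) : 0 ≤ M.occE π h g :=
  Finset.sum_nonneg fun s _ => mul_nonneg (M.occ_nonneg ..) (hg s)

theorem occE_add (h : ℕ) (g g' : Fin S → ℝ) :
    M.occE π h (fun s => g s + g' s) = M.occE π h g + M.occE π h g' := by
  simp [occE, mul_add, Finset.sum_add_distrib]

theorem occE_const_mul (h : ℕ) (c : ℝ) (g : Fin S → ℝ) :
    M.occE π h (fun s => c * g s) = c * M.occE π h g := by
  simp only [occE, Finset.mul_sum]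
  exact Finset.sum_congr rfl fun _ _ => by ring

/-- Law of the outcomes of all step-state-action triples in one episode. -/
noncomputable def drawsLaw : Measure (Draws H S A) :=
  Measure.pi fun h : Fin H => Measure.pi fun s : Fin S => Measure.pi fun a : Fin A => M.law h s a

instance : IsProbabilityMeasure M.drawsLaw := by
  unfold drawsLaw; infer_instance

theorem rollout_state_zero (d : Draws H S A) : (M.rollout π d).state 0 = M.init := rfl

theorem rollout_state_succ (d : Draws H S A) (h : Fin H) :
    (M.rollout π d).state h.succ =
      (d h ((M.rollout π d).state h.castSucc) (π h ((M.rollout π d).state h.castSucc))).2 := rfl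

theorem rollout_action (d : Draws H S A) (h : Fin H) :
    (M.rollout π d).action h = π h ((M.rollout π d).state h.castSucc) := rfl

theorem rollout_reward (d : Draws H S A) (h : Fin H) :
    (M.rollout π d).reward h =
      (d h ((M.rollout π d).state h.castSucc) (π h ((M.rollout π d).state h.castSucc))).1 := rfl

theorem rollout_state_congr {d d' : Draws H S A} (j : Fin (H + 1))
    (hd : ∀ i : Fin H, i.castSucc < j → d i = d' i) :
    (M.rollout π d).state j = (M.rollout π d').state j := by
  induction j using Fin.induction with
  | zero => rfl
  | succ h ih =>
    rw [rollout_state_succ, rollout_state_succ, hd h Fin.castSucc_lt_succ,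
      ih fun i hi => hd i (hi.trans Fin.castSucc_lt_succ)]

/-- The state at a step is determined by the draws of earlier steps, so row `h` can be resampled
with that state frozen. -/
theorem rollout_state_update (d : Draws H S A) (h : Fin H) (y : Fin S → Fin A → ℝ × Fin S) :
    (M.rollout π (Function.update d h y)).state h.castSucc = (M.rollout π d).state h.castSucc :=
  M.rollout_state_congr π _ fun i hi => Function.update_of_ne (by
    rintro rfl
    exact lt_irrefl _ hi) _ _

end TabularMDP

/-! ### Measurability and law of rollouts -/

theorem Measurable.eval_finite {Ω α β : Type*} [MeasurableSpace Ω] [MeasurableSpace α]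
    [MeasurableSpace β] [Countable α] [MeasurableSingletonClass α] {F : α → Ω → β} {f : Ω → α}
    (hF : ∀ x, Measurable (F x)) (hf : Measurable f) : Measurable fun ω => F (f ω) ω :=
  (measurable_from_prod_countable_right (f := fun p : α × Ω => F p.1 p.2) hF).comp
    (hf.prodMk measurable_id)

namespace TabularMDP

variable {H S A : ℕ} (M : TabularMDP H S A)

section Measurability

variable {Ω : Type*} [MeasurableSpace Ω] {π : Ω → Policy H S A} {d : Ω → Draws H S A}

theorem measurable_step
    (hπ : ∀ h s, Measurable fun ω => π ω h s)
    {h : Fin H} {st : Ω → Fin S} (hst : Measurable st) :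
    Measurable fun ω => π ω h (st ω) :=
  Measurable.eval_finite (F := fun s ω => π ω h s) (fun s => hπ h s) hst

theorem measurable_draw
    (hπ : ∀ h s, Measurable fun ω => π ω h s)
    (hd : ∀ h s a, Measurable fun ω => d ω h s a)
    {h : Fin H} {st : Ω → Fin S} (hst : Measurable st) :
    Measurable fun ω => d ω h (st ω) (π ω h (st ω)) :=
  Measurable.eval_finite (F := fun (p : Fin S × Fin A) ω => d ω h p.1 p.2)
    (fun p => hd h p.1 p.2) (hst.prodMk (measurable_step hπ hst))

theorem measurable_rollout_state
    (hπ : ∀ h s, Measurable fun ω => π ω h s)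
    (hd : ∀ h s a, Measurable fun ω => d ω h s a)
    (j : Fin (H + 1)) :
    Measurable fun ω => (M.rollout (π ω) (d ω)).state j := by
  induction j using Fin.induction with
  | zero => exact measurable_const
  | succ h ih =>
    simp only [rollout_state_succ]
    exact measurable_snd.comp (measurable_draw hπ hd ih)

theorem measurable_rollout_action
    (hπ : ∀ h s, Measurable fun ω => π ω h s)
    (hd : ∀ h s a, Measurable fun ω => d ω h s a)
    (h : Fin H) :
    Measurable fun ω => (M.rollout (π ω) (d ω)).action h :=
  measurable_step hπ (M.measurable_rollout_state hπ hd h.castSucc)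

theorem measurable_rollout_reward
    (hπ : ∀ h s, Measurable fun ω => π ω h s)
    (hd : ∀ h s a, Measurable fun ω => d ω h s a)
    (h : Fin H) :
    Measurable fun ω => (M.rollout (π ω) (d ω)).reward h :=
  measurable_fst.comp (measurable_draw hπ hd (M.measurable_rollout_state hπ hd h.castSucc))

end Measurability

theorem measurable_draws_apply (h : Fin H) (s : Fin S) (a : Fin A) :
    Measurable fun d : Draws H S A => d h s a :=
  (measurable_pi_apply a).comp ((measurable_pi_apply s).comp (measurable_pi_apply h))

theorem integrable_of_finite_range {Ω : Type*} [MeasurableSpace Ω] {μ : Measure Ω}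
    [IsFiniteMeasure μ] {n : ℕ} {f : Ω → Fin n} (hf : Measurable f) (g : Fin n → ℝ) :
    Integrable (fun ω => g (f ω)) μ := by
  refine Integrable.of_bound (C := ∑ i, |g i|)
    ((measurable_of_countable g).comp hf).aestronglyMeasurable (ae_of_all _ fun ω => ?_)
  rw [Real.norm_eq_abs]
  exact Finset.single_le_sum (f := fun i => |g i|) (fun i _ => abs_nonneg _) (Finset.mem_univ (f ω))

/-- The state distribution of a rollout is the occupancy measure. -/
theorem integral_rollout_state (π : Policy H S A) (j : Fin (H + 1)) (g : Fin S → ℝ) :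
    ∫ d, g ((M.rollout π d).state j) ∂M.drawsLaw = M.occE π j g := by
  have hm : ∀ j, Measurable fun d => (M.rollout π d).state j := fun j =>
    M.measurable_rollout_state (π := fun _ => π) (d := id) (fun _ _ => measurable_const)
      measurable_draws_apply j
  induction j using Fin.induction generalizing g with
  | zero => simp [rollout_state_zero, occE_zero]
  | succ h ih =>
    have hint : Integrable (fun d => g ((M.rollout π d).state h.succ)) M.drawsLaw :=
      integrable_of_finite_range (hm _) g
    rw [drawsLaw] at hint ⊢
    rw [integral_pi_update _ h hint, ← drawsLaw]
    -- With the other rows frozen the state at step `h` is a constant, and only the marginal of the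
    -- single entry visited there matters.
    have : ∀ d, ∫ y, g ((M.rollout π (Function.update d h y)).state h.succ)
        ∂(Measure.pi fun s : Fin S => Measure.pi fun a : Fin A => M.law h s a) =
        ∑ s', M.P h ((M.rollout π d).state h.castSucc) (π h ((M.rollout π d).state h.castSucc)) s'
          * g s' := by
      intro d
      simp only [rollout_state_succ, rollout_state_update, Function.update_self]
      set s := (M.rollout π d).state h.castSucc
      rw [← integral_comp_snd]
      have h1 := (measurePreserving_eval (fun s : Fin S => Measure.pi fun a : Fin A => M.law h s a) s)
      have h2 := (measurePreserving_eval (fun a : Fin A => M.law h s a) (π h s)).comp h1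
      rw [← h2.map_eq, integral_map (f := fun x : ℝ × Fin S => g x.2) h2.measurable.aemeasurable
        ((measurable_of_countable g).comp measurable_snd).aestronglyMeasurable]
      rfl
    simp_rw [this]
    have h4 := ih fun s => ∑ s', M.P h s (π h s) s' * g s'
    refine h4.trans ?_
    rw [Fin.val_succ, occE_succ]
    rfl

end TabularMDP

/-! ### Deterministic regret analysis for accurate data -/

namespace SSR

variable {H S A : ℕ}

theorem clip_mono (c : ℝ) {x y : ℝ} (h : x ≤ y) : clip c x ≤ clip c y :=
  max_le_max le_rfl (min_le_min le_rfl h)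

theorem abs_clip_le {c : ℝ} (hc : 0 ≤ c) (x : ℝ) : |clip c x| ≤ c :=
  abs_le.2 ⟨le_max_left _ _, max_le (by linarith) (min_le_left _ _)⟩

theorem clip_of_mem {c x : ℝ} (h1 : -c ≤ x) (h2 : x ≤ c) : clip c x = x := by
  rw [clip, min_eq_right h2, max_eq_right h1]

/-- Clipping is 1-Lipschitz and fixes `v`; hence it never increases the distance to a true value. -/
theorem abs_clip_sub_le {c x v : ℝ} (h1 : -c ≤ v) (h2 : v ≤ c) : |clip c x - v| ≤ |x - v| := by
  have h : |clip c x - clip c v| ≤ |x - v| :=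
    (abs_max_sub_max_le_max _ _ _ _).trans <| by
      rw [sub_self, abs_zero, max_eq_right (abs_nonneg _)]
      refine (abs_min_sub_min_le_max _ _ _ _).trans ?_
      rw [sub_self, abs_zero, max_eq_right (abs_nonneg _)]
  rwa [clip_of_mem h1 h2] at h

theorem clip_sub_clip_le (c : ℝ) {x y t : ℝ} (ht : 0 ≤ t) (h : x ≤ y + t) :
    clip c x ≤ clip c y + t := by
  simp only [clip]
  refine max_le (by linarith [le_max_left (-c) (min c y)]) ?_
  rcases le_total c y with hc | hc
  · have := le_max_right (-c) (min c y)
    rw [min_eq_left hc] at this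
    rw [min_eq_left hc]
    linarith [min_le_left c x]
  · have := le_max_right (-c) (min c y)
    rw [min_eq_right hc] at this
    rw [min_eq_right hc]
    linarith [min_le_right c x]

variable (D : List (Episode H S A))

theorem vbar_of_lt (z : ℝ) {h : ℕ} (hh : h < H) (s : Fin S) :
    vbar D z h s = clip (2 * ((H : ℝ) - h)) (⨆ a, qbar D z ⟨h, hh⟩ s a) := by
  rw [vbar, dif_pos hh]
  rfl

theorem vbar_of_le (z : ℝ) {h : ℕ} (hh : H ≤ h) (s : Fin S) : vbar D z h s = 0 := by
  rw [vbar, dif_neg (by omega)]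

theorem abs_vbar_le (z : ℝ) {h : ℕ} (hh : h ≤ H) (s : Fin S) :
    |vbar D z h s| ≤ 2 * ((H : ℝ) - h) := by
  have h0 : (h : ℝ) ≤ H := by exact_mod_cast hh
  rcases lt_or_eq_of_le hh with h1 | h1
  · rw [vbar_of_lt D z h1]
    exact abs_clip_le (by linarith) _
  · rw [vbar_of_le D z h1.ge, abs_zero]
    linarith

/-- `π` is greedy for the perturbed action-value function with seed `z`. -/
def Greedy (z : ℝ) (π : Policy H S A) : Prop :=
  ∀ h s a, qbar D z h s a ≤ qbar D z h s (π h s)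

theorem qbar_le_iSup (z : ℝ) (h : Fin H) (s : Fin S) (a : Fin A) :
    qbar D z h s a ≤ ⨆ a, qbar D z h s a :=
  le_ciSup (f := fun a => qbar D z h s a) (Set.finite_range _).bddAbove a

theorem Greedy.vbar_eq {z : ℝ} {π : Policy H S A} (hπ : Greedy D z π) (h : Fin H) (s : Fin S) :
    vbar D z h s = clip (2 * ((H : ℝ) - h)) (qbar D z h s (π h s)) := by
  rw [vbar_of_lt D z h.2]
  have : Nonempty (Fin A) := ⟨π h s⟩
  congr 1
  exact le_antisymm (ciSup_le fun a => hπ h s a) (qbar_le_iSup D z h s _)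

theorem transHat_nonneg (h : Fin H) (s : Fin S) (a : Fin A) (s' : Fin S) :
    0 ≤ transHat D h s a s' := by
  unfold transHat; positivity

theorem sigmaHo_nonneg (h : Fin H) (s : Fin S) (a : Fin A) : 0 ≤ sigmaHo D h s a := by
  unfold sigmaHo; positivity

/-- The empirical reward plus empirical continuation of the optimal value is accurate up to `B`
noise magnitudes. -/
def BackupAccurate (M : TabularMDP H S A) (B : ℝ) : Prop :=
  ∀ h s a, |rewardHat D h s a + ∑ s', transHat D h s a s' * M.optValue (h + 1) s' -
    (M.R h s a + ∑ s', M.P h s a s' * M.optValue (h + 1) s')| ≤ B * sigmaHo D h s a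

/-- The empirical transition weights are accurate up to a relative error `α` and an error `β`
over the number of visits. -/
def TransAccurate (M : TabularMDP H S A) (α β : ℝ) : Prop :=
  ∀ h s a s', |transHat D h s a s' - M.P h s a s'| ≤
    α * M.P h s a s' + β / ((count D h s a : ℝ) + 1)

variable {D} {M : TabularMDP H S A} {B α β : ℝ}

/-- Backward induction: the shared seed adds at least `B` noise magnitudes to every backup at once,
which covers the error in backing up `V*`. Clipping is harmless because `V*` lies inside the
clipping range. -/
theorem optValue_le_vbar [Nonempty (Fin A)] (hB : BackupAccurate D M B) {z : ℝ} (hz : B ≤ z)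
    {h : ℕ} (hh : h ≤ H) (s : Fin S) : M.optValue h s ≤ vbar D z h s := by
  rcases lt_or_eq_of_le hh with h1 | h1
  · rw [vbar_of_lt D z h1]
    obtain ⟨a, ha⟩ := M.exists_optValue_eq ⟨h, h1⟩ s
    have hq := qbar_le_iSup D z ⟨h, h1⟩ s a
    have hb := (abs_le.1 (hB ⟨h, h1⟩ s a)).1
    have hs := sigmaHo_nonneg D ⟨h, h1⟩ s a
    have hv : ∑ s', transHat D ⟨h, h1⟩ s a s' * M.optValue (h + 1) s' ≤
        ∑ s', transHat D ⟨h, h1⟩ s a s' * vbar D z (h + 1) s' :=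
      Finset.sum_le_sum fun s' _ => mul_le_mul_of_nonneg_left
        (optValue_le_vbar hB hz (h := h + 1) h1 s') (transHat_nonneg ..)
    have hsz := mul_le_mul_of_nonneg_right hz hs
    have hle : M.optValue h s ≤ ⨆ a, qbar D z ⟨h, h1⟩ s a := by
      refine le_trans ?_ hq
      simp only [qbar, backup] at ha ⊢
      rw [ha]
      dsimp only at hb
      linarith
    have h3 := M.optValue_nonneg h s
    have h4 := M.optValue_le hh s
    have h5 : (h : ℝ) ≤ H := by exact_mod_cast hh
    rw [← clip_of_mem (c := 2 * ((H : ℝ) - h)) (x := M.optValue h s) (by linarith) (by linarith)]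
    exact clip_mono _ hle
  · rw [vbar_of_le D z h1.ge, M.optValue_of_le h1.ge]
termination_by H - h

/-- The error is controlled entry by entry, so `f` may depend on the data, as `V̄` does. The price
is the factor `S`, which affects only the term in the inverse count. -/
theorem abs_sum_transHat_sub_le (hT : TransAccurate D M α β) (hβ : 0 ≤ β) (h : Fin H)
    (s : Fin S) (a : Fin A) {f : Fin S → ℝ} {c : ℝ} (hf : ∀ s', |f s'| ≤ c) :
    |∑ s', transHat D h s a s' * f s' - ∑ s', M.P h s a s' * f s'| ≤
      α * ∑ s', M.P h s a s' * |f s'| + S * β * c / ((count D h s a : ℝ) + 1) := by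
  rw [← Finset.sum_sub_distrib]
  refine (Finset.abs_sum_le_sum_abs _ _).trans ?_
  have hn : (0 : ℝ) ≤ β / ((count D h s a : ℝ) + 1) := by positivity
  calc ∑ s', |transHat D h s a s' * f s' - M.P h s a s' * f s'|
      ≤ ∑ s', (α * (M.P h s a s' * |f s'|) + β / ((count D h s a : ℝ) + 1) * c) := by
        refine Finset.sum_le_sum fun s' _ => ?_
        rw [← sub_mul, abs_mul]
        have h1 := mul_le_mul_of_nonneg_right (hT h s a s') (abs_nonneg (f s'))
        have h2 := mul_le_mul_of_nonneg_left (hf s') hn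
        linarith
    _ = _ := by
        rw [Finset.sum_add_distrib, ← Finset.mul_sum, Finset.sum_const, Finset.card_univ,
          Fintype.card_fin, nsmul_eq_mul]
        ring

theorem le_of_discounted_recursion {α : ℝ} (hα : 0 ≤ α) {n : ℕ} {x : ℕ → ℝ} {U : Fin n → ℝ}
    (hU : ∀ h, 0 ≤ U h) (hn : x n ≤ 0) (hx : ∀ h : Fin n, x h ≤ U h + (1 + α) * x (h + 1)) :
    x 0 ≤ (1 + α) ^ n * ∑ h, U h := by
  induction n generalizing x with
  | zero => simpa using hn
  | succ n ih =>
    have h1 := ih (x := fun j => x (j + 1)) (U := fun h => U h.succ) (fun h => hU _) hn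
      (fun h => by simpa using hx h.succ)
    have h0 := hx 0
    simp only [Fin.val_zero, zero_add] at h0 h1
    rw [Fin.sum_univ_succ]
    have h2 := mul_le_mul_of_nonneg_left h1 (by linarith : (0 : ℝ) ≤ 1 + α)
    have h3 : U 0 ≤ (1 + α) ^ (n + 1) * U 0 :=
      le_mul_of_one_le_left (hU 0) (one_le_pow₀ (by linarith))
    calc x 0 ≤ U 0 + (1 + α) * x 1 := h0
      _ ≤ (1 + α) ^ (n + 1) * U 0 + (1 + α) * ((1 + α) ^ n * ∑ h : Fin n, U h.succ) := by linarith
      _ = _ := by ring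

/-- This fixes the relative error `1/(8H)`: over `H` steps it compounds to at most `exp(1/8)`. -/
theorem one_add_pow_le_two {n : ℕ} (hn : 1 ≤ n) : (1 + 1 / (8 * (n : ℝ))) ^ n ≤ 2 := by
  have hn' : (0 : ℝ) < n := by exact_mod_cast hn
  have h1 : (1 + 1 / (8 * (n : ℝ))) ^ n ≤ Real.exp (1 / (8 * (n : ℝ))) ^ n :=
    pow_le_pow_left₀ (by positivity) (by linarith [Real.add_one_le_exp (1 / (8 * (n : ℝ)))]) n
  rw [← Real.exp_nat_mul] at h1
  have h2 : (n : ℝ) * (1 / (8 * (n : ℝ))) = 1 / 8 := by field_simp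
  rw [h2] at h1
  have h3 := Real.exp_bound_div_one_sub_of_interval (x := 1 / 8) (by norm_num) (by norm_num)
  norm_num at h3
  linarith

variable (D) in
/-- Total size of the noise and of the transition error at a triple. -/
noncomputable def bonus (β : ℝ) (h : Fin H) (s : Fin S) (a : Fin A) : ℝ :=
  sigmaHo D h s a + H * S * β / ((count D h s a : ℝ) + 1)

theorem bonus_nonneg (hβ : 0 ≤ β) (h : Fin H) (s : Fin S) (a : Fin A) : 0 ≤ bonus D β h s a := by
  have := sigmaHo_nonneg D h s a
  unfold bonus
  positivity

variable (D M) in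
/-- Expected total bonus of an episode under the policy `π`. -/
noncomputable def expBonus (β : ℝ) (π : Policy H S A) : ℝ :=
  ∑ h : Fin H, M.occE π h fun s => bonus D β h s (π h s)

theorem expBonus_nonneg (hβ : 0 ≤ β) (π : Policy H S A) : 0 ≤ expBonus D M β π :=
  Finset.sum_nonneg fun _ _ => M.occE_nonneg π fun _ => bonus_nonneg hβ ..

theorem noise_add_le_bonus (hβ : 0 ≤ β) {x y t : ℝ} (hx : x ≤ t) (hy : y ≤ t)
    (h : Fin H) (s : Fin S) (a : Fin A) :
    x * sigmaHo D h s a + S * β * (y * H) / ((count D h s a : ℝ) + 1) ≤ t * bonus D β h s a := by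
  have h1 := mul_le_mul_of_nonneg_right hx (sigmaHo_nonneg D h s a)
  have h2 := mul_le_mul_of_nonneg_right hy
    (show (0 : ℝ) ≤ H * S * β / ((count D h s a : ℝ) + 1) by positivity)
  have h3 : S * β * (y * H) / ((count D h s a : ℝ) + 1) =
    y * (H * S * β / ((count D h s a : ℝ) + 1)) := by ring
  rw [h3, bonus]
  linarith

/-- The action of `π'` attains the maximum for `z'` and is merely a candidate for `z`. The
difference is therefore propagated along `π'` alone, and no greedy policy for `z` is needed. -/
theorem vbar_sub_vbar_le (hT : TransAccurate D M (1 / (8 * (H : ℝ))) β) (hβ : 0 ≤ β) (hH : 1 ≤ H)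
    {z z' : ℝ} {π' : Policy H S A} (hπ' : Greedy D z' π') :
    vbar D z' 0 M.init - vbar D z 0 M.init ≤ 2 * ((|z' - z| + 4) * expBonus D M β π') := by
  set α : ℝ := 1 / (8 * (H : ℝ)) with hα
  have hα0 : 0 ≤ α := by positivity
  -- The positive part equals its own absolute value, so the relative transition error turns `P Δ`
  -- into `(1 + α) P Δ`. Both clipped values are at most `2H` in size, whence the bound `4H` and the
  -- 4 in the statement.
  set Δ : ℕ → Fin S → ℝ := fun h s => max (vbar D z' h s - vbar D z h s) 0 with hΔ
  have hΔ0 : ∀ h s, 0 ≤ Δ h s := fun h s => le_max_right _ _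
  have hΔH : ∀ h, h ≤ H → ∀ s, |Δ h s| ≤ 4 * H := by
    intro h hh s
    have h1 := abs_le.1 (abs_vbar_le D z hh s)
    have h2 := abs_le.1 (abs_vbar_le D z' hh s)
    rw [abs_of_nonneg (hΔ0 h s)]
    have : (0 : ℝ) ≤ h := by positivity
    exact max_le (by linarith) (by positivity)
  have hstep : ∀ (h : Fin H) s, Δ h s ≤ (|z' - z| + 4) * bonus D β h s (π' h s) +
      (1 + α) * ∑ s', M.P h s (π' h s) s' * Δ (h + 1) s' := by
    intro h s
    set a := π' h s
    have hsum : 0 ≤ ∑ s', M.P h s a s' * Δ (h + 1) s' := M.sum_P_mul_nonneg fun s' => hΔ0 _ s'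
    have hT1 := (abs_le.1 (abs_sum_transHat_sub_le hT hβ h s a (f := Δ (h + 1))
      (hΔH _ h.2))).2
    simp only [abs_of_nonneg (hΔ0 _ _)] at hT1
    have hb := noise_add_le_bonus (D := D) hβ (x := |z' - z|) (y := 4) (t := |z' - z| + 4)
      (by linarith) (by linarith [abs_nonneg (z' - z)]) h s a
    have hb0 : 0 ≤ (|z' - z| + 4) * bonus D β h s a :=
      mul_nonneg (by positivity) (bonus_nonneg hβ ..)
    have hv : ∑ s', transHat D h s a s' * vbar D z' (h + 1) s' -
        ∑ s', transHat D h s a s' * vbar D z (h + 1) s' ≤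
        ∑ s', transHat D h s a s' * Δ (h + 1) s' := by
      rw [← Finset.sum_sub_distrib]
      refine Finset.sum_le_sum fun s' _ => ?_
      rw [← mul_sub]
      exact mul_le_mul_of_nonneg_left (le_max_left _ _) (transHat_nonneg ..)
    have hz : sigmaHo D h s a * z' - sigmaHo D h s a * z ≤ |z' - z| * sigmaHo D h s a := by
      rw [← mul_sub, mul_comm]
      exact mul_le_mul_of_nonneg_right (le_abs_self _) (sigmaHo_nonneg ..)
    have hnn : 0 ≤ (1 + α) * ∑ s', M.P h s a s' * Δ (h + 1) s' := mul_nonneg (by linarith) hsum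
    refine max_le ?_ (by linarith)
    rw [hπ'.vbar_eq, vbar_of_lt D z h.2]
    have hle := clip_sub_clip_le (2 * ((H : ℝ) - h)) (x := qbar D z' h s a)
      (y := ⨆ a, qbar D z h s a)
      (t := (|z' - z| + 4) * bonus D β h s a + (1 + α) * ∑ s', M.P h s a s' * Δ (h + 1) s')
      (by linarith) (by
        have h1 := qbar_le_iSup D z h s a
        simp only [qbar, backup] at h1 ⊢
        linarith)
    simp only [Fin.eta]
    linarith
  have hrec := le_of_discounted_recursion hα0 (n := H) (x := fun h => M.occE π' h (Δ h))
    (U := fun h => M.occE π' h fun s => (|z' - z| + 4) * bonus D β h s (π' h s))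
    (fun h => M.occE_nonneg _ fun s => mul_nonneg (by positivity) (bonus_nonneg hβ ..))
    (by
      have : Δ H = fun _ => 0 := by
        funext s
        simp [hΔ, vbar_of_le]
      simp [this, TabularMDP.occE])
    (fun h => by
      rw [M.occE_succ, ← M.occE_const_mul, ← M.occE_add]
      exact M.occE_mono _ (hstep h))
  simp only [TabularMDP.occE_zero, TabularMDP.occE_const_mul, ← Finset.mul_sum] at hrec
  have hnn : 0 ≤ (|z' - z| + 4) * expBonus D M β π' :=
    mul_nonneg (by positivity) (expBonus_nonneg hβ _)
  refine (le_max_left _ 0).trans (hrec.trans ?_)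
  exact mul_le_mul_of_nonneg_right (one_add_pow_le_two hH) hnn

/-- Along `π` the expected suboptimality cannot grow from step to step, since an action that is not
optimal only loses value by the Bellman inequality. -/
theorem occE_gap_le [Nonempty (Fin A)] (π : Policy H S A) {h : ℕ} (hh : h ≤ H) :
    M.occE π h (fun s => M.optValue h s - M.value π h s) ≤
      M.optValue 0 M.init - M.value π 0 M.init := by
  induction h with
  | zero => rw [M.occE_zero]
  | succ h ih =>
    refine le_trans ?_ (ih (by omega))
    have := M.occE_succ π ⟨h, hh⟩ (fun s => M.optValue (h + 1) s - M.value π (h + 1) s)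
    refine this.le.trans (M.occE_mono _ fun s => ?_)
    have h1 := M.bellman_le_optValue ⟨h, hh⟩ s (π ⟨h, hh⟩ s)
    rw [M.value_of_lt π hh]
    simp only [mul_sub, Finset.sum_sub_distrib]
    dsimp only at h1
    linarith

/-- Accuracy of backups is available for `V*`, not for the random `V^π`. The comparison thus passes
through `V*`, and the resulting `V* - V^π` appears only with the small weight `α`, so that it can be
absorbed later. -/
theorem abs_value_sub_vbar_le [Nonempty (Fin A)] (hB : BackupAccurate D M B) (hB0 : 0 ≤ B)
    (hT : TransAccurate D M (1 / (8 * (H : ℝ))) β) (hβ : 0 ≤ β) (hH : 1 ≤ H)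
    {z : ℝ} {π : Policy H S A} (hπ : Greedy D z π) :
    |vbar D z 0 M.init - M.value π 0 M.init| ≤ 2 * ((B + |z| + 3) * expBonus D M β π) +
      (M.optValue 0 M.init - M.value π 0 M.init) / 4 := by
  have hH' : (0 : ℝ) < H := by exact_mod_cast hH
  set α : ℝ := 1 / (8 * (H : ℝ)) with hα
  have hα0 : 0 ≤ α := by positivity
  set G : ℕ → Fin S → ℝ := fun h s => |vbar D z h s - M.value π h s| with hG
  set F : ℕ → Fin S → ℝ := fun h s => M.optValue h s - M.value π h s with hF
  set reg := M.optValue 0 M.init - M.value π 0 M.init with hreg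
  have hreg0 : 0 ≤ reg := sub_nonneg.2 (M.value_le_optValue ..)
  have hf : ∀ h, h ≤ H → ∀ s, |vbar D z h s - M.optValue h s| ≤ 3 * H := by
    intro h hh s
    have h1 := abs_le.1 (abs_vbar_le D z hh s)
    have h2 := M.optValue_nonneg h s
    have h3 := M.optValue_le hh s
    have : (0 : ℝ) ≤ h := by positivity
    exact abs_le.2 ⟨by linarith, by linarith⟩
  have hstep : ∀ (h : Fin H) s, G h s ≤ (B + |z| + 3) * bonus D β h s (π h s) +
      ((1 + α) * ∑ s', M.P h s (π h s) s' * G (h + 1) s' +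
        α * ∑ s', M.P h s (π h s) s' * F (h + 1) s') := by
    intro h s
    set a := π h s with ha
    have hval0 := M.value_nonneg π h s
    have hval1 := M.value_le π h.2.le s
    have hhH : (h : ℝ) ≤ H := by exact_mod_cast h.2.le
    have h1 : G h s ≤ |qbar D z h s a - M.value π h s| := by
      simp only [hG, hπ.vbar_eq]
      exact abs_clip_sub_le (by linarith) (by linarith)
    refine h1.trans ?_
    have hT1 := abs_sum_transHat_sub_le hT hβ h s a
      (f := fun s' => vbar D z (h + 1) s' - M.optValue (h + 1) s') (hf _ h.2)
    have hsplit : ∑ s', M.P h s a s' * |vbar D z (h + 1) s' - M.optValue (h + 1) s'| ≤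
        ∑ s', M.P h s a s' * G (h + 1) s' + ∑ s', M.P h s a s' * F (h + 1) s' := by
      rw [← Finset.sum_add_distrib]
      refine Finset.sum_le_sum fun s' _ => ?_
      rw [← mul_add]
      refine mul_le_mul_of_nonneg_left ?_ (M.P_nonneg ..)
      have h2 := abs_sub_le (vbar D z (h + 1) s') (M.value π (h + 1) s') (M.optValue (h + 1) s')
      have h3 : |M.value π (h + 1) s' - M.optValue (h + 1) s'| = F (h + 1) s' := by
        rw [abs_sub_comm, abs_of_nonneg (sub_nonneg.2 (M.value_le_optValue ..))]
      rw [h3] at h2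
      exact h2
    have hPG : |∑ s', M.P h s a s' * (vbar D z (h + 1) s' - M.value π (h + 1) s')| ≤
        ∑ s', M.P h s a s' * G (h + 1) s' := by
      refine (Finset.abs_sum_le_sum_abs _ _).trans (Finset.sum_le_sum fun s' _ => ?_)
      rw [abs_mul, abs_of_nonneg (M.P_nonneg ..)]
    have hBs := hB h s a
    have hzs : |sigmaHo D h s a * z| = |z| * sigmaHo D h s a := by
      rw [abs_mul, abs_of_nonneg (sigmaHo_nonneg ..), mul_comm]
    have hb := noise_add_le_bonus (D := D) hβ (x := B + |z|) (y := 3) (t := B + |z| + 3)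
      (by linarith) (by linarith [abs_nonneg z]) h s a
    have hαs := mul_le_mul_of_nonneg_left hsplit hα0
    -- Four sources: error in backing up `V*`, the seed, the transition error acting on `V̄ - V*`,
    -- and propagation of `V̄ - V^π` under the true dynamics.
    have hdec : qbar D z h s a - M.value π h s =
        (rewardHat D h s a + ∑ s', transHat D h s a s' * M.optValue (h + 1) s' -
          (M.R h s a + ∑ s', M.P h s a s' * M.optValue (h + 1) s')) + sigmaHo D h s a * z +
        (∑ s', transHat D h s a s' * (vbar D z (h + 1) s' - M.optValue (h + 1) s') -
          ∑ s', M.P h s a s' * (vbar D z (h + 1) s' - M.optValue (h + 1) s')) +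
        ∑ s', M.P h s a s' * (vbar D z (h + 1) s' - M.value π (h + 1) s') := by
      rw [M.value_of_lt π h.2, qbar, backup]
      simp only [Fin.eta, mul_sub, Finset.sum_sub_distrib, ← ha]
      ring
    rw [hdec]
    refine (abs_add_le _ _).trans ?_
    have e1 := abs_add_le ((rewardHat D h s a + ∑ s', transHat D h s a s' * M.optValue (h + 1) s' -
          (M.R h s a + ∑ s', M.P h s a s' * M.optValue (h + 1) s')) + sigmaHo D h s a * z)
        (∑ s', transHat D h s a s' * (vbar D z (h + 1) s' - M.optValue (h + 1) s') -
          ∑ s', M.P h s a s' * (vbar D z (h + 1) s' - M.optValue (h + 1) s'))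
    have e2 := abs_add_le (rewardHat D h s a + ∑ s', transHat D h s a s' * M.optValue (h + 1) s' -
          (M.R h s a + ∑ s', M.P h s a s' * M.optValue (h + 1) s')) (sigmaHo D h s a * z)
    linarith
  -- Each step is charged `α * reg` for the gap to `V*`. Over `H` steps this is `reg / 8`, and the
  -- compounding factor 2 makes it `reg / 4`.
  have hrec := le_of_discounted_recursion hα0 (n := H) (x := fun h => M.occE π h (G h))
    (U := fun h => (B + |z| + 3) * (M.occE π h fun s => bonus D β h s (π h s)) + α * reg)
    (fun h => add_nonneg (mul_nonneg (by positivity)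
      (M.occE_nonneg _ fun s => bonus_nonneg hβ ..)) (mul_nonneg hα0 hreg0))
    (by
      have : G H = fun _ => 0 := by
        funext s
        simp [hG, vbar_of_le, M.value_of_le]
      simp [this, TabularMDP.occE])
    (fun h => by
      have h1 := M.occE_mono π (hstep h) (h := h)
      have h2 := occE_gap_le (M := M) π (h := h + 1) h.2
      simp only [TabularMDP.occE_add, TabularMDP.occE_const_mul, ← TabularMDP.occE_succ] at h1
      have h3 := mul_le_mul_of_nonneg_left h2 hα0
      linarith)
  simp only [TabularMDP.occE_zero, Finset.sum_add_distrib, ← Finset.mul_sum, Finset.sum_const,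
    Finset.card_univ, Fintype.card_fin, nsmul_eq_mul] at hrec
  have hnn : 0 ≤ (B + |z| + 3) * expBonus D M β π + α * (H * reg) :=
    add_nonneg (mul_nonneg (by positivity) (expBonus_nonneg hβ _)) (by positivity)
  refine hrec.trans ((mul_le_mul_of_nonneg_right (one_add_pow_le_two hH) hnn).trans (le_of_eq ?_))
  have : α * (H * reg) = reg / 8 := by
    rw [hα]; field_simp
  rw [this]
  ring

/-- The regret of the policy played with seed `z`, bounded through any optimistic seed `z'`. -/
theorem gap_le [Nonempty (Fin A)] (hB : BackupAccurate D M B) (hB0 : 0 ≤ B)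
    (hT : TransAccurate D M (1 / (8 * (H : ℝ))) β) (hβ : 0 ≤ β) (hH : 1 ≤ H)
    {z z' : ℝ} {π π' : Policy H S A} (hπ : Greedy D z π) (hπ' : Greedy D z' π')
    (hz' : z' ∈ Set.Icc B (B + 1)) :
    M.optValue 0 M.init - M.value π 0 M.init ≤
      4 * (B + 5 + |z|) * (expBonus D M β π' + expBonus D M β π) := by
  -- Adding `h1`, `h2`, `h3` leaves three quarters of the gap on the left; the constant `2 / (3/4)`
  -- is rounded up to 4.
  have h1 := optValue_le_vbar hB hz'.1 (Nat.zero_le H) M.init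
  have h2 := vbar_sub_vbar_le hT hβ hH (z := z) hπ'
  have h3 := (abs_le.1 (abs_value_sub_vbar_le hB hB0 hT hβ hH hπ)).2
  have h4 := expBonus_nonneg (D := D) (M := M) hβ π
  have h5 := expBonus_nonneg (D := D) (M := M) hβ π'
  have h6 : |z' - z| ≤ B + 1 + |z| := by
    refine (abs_sub _ _).trans ?_
    rw [abs_of_nonneg (hB0.trans hz'.1)]
    linarith [hz'.2]
  have h7 : (|z' - z| + 4) * expBonus D M β π' ≤ (B + 5 + |z|) * expBonus D M β π' :=
    mul_le_mul_of_nonneg_right (by linarith) h5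
  have h8 : (B + |z| + 3) * expBonus D M β π ≤ (B + 5 + |z|) * expBonus D M β π :=
    mul_le_mul_of_nonneg_right (by linarith) h4
  have h9 : 0 ≤ (B + 5 + |z|) * expBonus D M β π := mul_nonneg (by positivity) h4
  have h10 : 0 ≤ (B + 5 + |z|) * expBonus D M β π' := mul_nonneg (by positivity) h5
  rw [mul_add, mul_assoc, mul_assoc]
  linarith

end SSR

/-! ### Visit statistics and their measurability -/

namespace SSR

variable {H S A : ℕ}

/-- Sum of `φ (reward, next state)` over the past visits to a triple. -/
noncomputable def visitSum (D : List (Episode H S A)) (h : Fin H) (s : Fin S) (a : Fin A)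
    (φ : ℝ × Fin S → ℝ) : ℝ :=
  (D.map fun e => if e.state h.castSucc = s ∧ e.action h = a
    then φ (e.reward h, e.state h.succ) else 0).sum

theorem visitSum_append_singleton (D : List (Episode H S A)) (e : Episode H S A) (h : Fin H)
    (s : Fin S) (a : Fin A) (φ : ℝ × Fin S → ℝ) :
    visitSum (D ++ [e]) h s a φ = visitSum D h s a φ +
      if e.state h.castSucc = s ∧ e.action h = a then φ (e.reward h, e.state h.succ) else 0 := by
  simp [visitSum]

theorem count_eq_visitSum (D : List (Episode H S A)) (h : Fin H) (s : Fin S) (a : Fin A) :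
    (count D h s a : ℝ) = visitSum D h s a fun _ => 1 := by
  induction D with
  | nil => simp [count, visitSum]
  | cons e D ih =>
    simp only [count, visitSum, List.countP_cons, List.map_cons, List.sum_cons] at ih ⊢
    rw [← ih]
    by_cases hv : e.state h.castSucc = s ∧ e.action h = a
    · simp [hv, add_comm]
    · simp [hv]

theorem rewardHat_eq_visitSum (D : List (Episode H S A)) (h : Fin H) (s : Fin S) (a : Fin A) :
    rewardHat D h s a = visitSum D h s a Prod.fst / ((count D h s a : ℝ) + 1) := rfl

theorem transHat_eq_visitSum (D : List (Episode H S A)) (h : Fin H) (s : Fin S) (a : Fin A)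
    (s' : Fin S) :
    transHat D h s a s' =
      visitSum D h s a (fun y => if y.2 = s' then 1 else 0) / ((count D h s a : ℝ) + 1) := by
  unfold transHat
  congr 1
  induction D with
  | nil => simp [visitSum]
  | cons e D ih =>
    simp only [visitSum, List.countP_cons, List.map_cons, List.sum_cons] at ih ⊢
    rw [← ih]
    by_cases hv : e.state h.castSucc = s ∧ e.action h = a
    · by_cases hs : e.state h.succ = s'
      · simp [hv, hs, add_comm]
      · simp [hv, hs]
    · simp only [if_neg hv]
      have : ¬ (e.state h.castSucc = s ∧ e.action h = a ∧ e.state h.succ = s') :=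
        fun hc => hv ⟨hc.1, hc.2.1⟩
      simp [this]

theorem visitSum_add (D : List (Episode H S A)) (h : Fin H) (s : Fin S) (a : Fin A)
    (φ ψ : ℝ × Fin S → ℝ) :
    visitSum D h s a (fun y => φ y + ψ y) = visitSum D h s a φ + visitSum D h s a ψ := by
  simp only [visitSum, ← List.sum_map_add]
  congr 2
  funext e
  split_ifs <;> simp

theorem visitSum_const_mul (D : List (Episode H S A)) (h : Fin H) (s : Fin S) (a : Fin A)
    (c : ℝ) (φ : ℝ × Fin S → ℝ) :
    visitSum D h s a (fun y => c * φ y) = c * visitSum D h s a φ := by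
  simp only [visitSum, ← List.sum_map_mul_left]
  congr 2
  funext e
  split_ifs <;> simp

theorem visitSum_sum (D : List (Episode H S A)) (h : Fin H) (s : Fin S) (a : Fin A)
    {ι : Type*} (t : Finset ι) (φ : ι → ℝ × Fin S → ℝ) :
    visitSum D h s a (fun y => ∑ i ∈ t, φ i y) = ∑ i ∈ t, visitSum D h s a (φ i) := by
  classical
  induction t using Finset.induction_on with
  | empty => simp [visitSum]
  | insert i t hi ih => simp only [Finset.sum_insert hi, visitSum_add, ih]

theorem visitSum_sub_const (D : List (Episode H S A)) (h : Fin H) (s : Fin S) (a : Fin A)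
    (φ : ℝ × Fin S → ℝ) (c : ℝ) :
    visitSum D h s a (fun y => φ y - c) = visitSum D h s a φ - count D h s a * c := by
  have := visitSum_add D h s a φ fun _ => -c * 1
  rw [visitSum_const_mul, ← count_eq_visitSum] at this
  simp only [mul_one] at this
  simp only [sub_eq_add_neg, this]
  ring

section Measurability

variable {Ω : Type*} [MeasurableSpace Ω]

/-- A random list of `k` episodes all of whose visit statistics are measurable. -/
structure MeasurableData (D : Ω → List (Episode H S A)) (k : ℕ) : Prop where
  length_eq : ∀ ω, (D ω).length = k
  visitSum : ∀ h s a φ, Measurable φ → Measurable fun ω => SSR.visitSum (D ω) h s a φ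

theorem measurableData_const (D : List (Episode H S A)) :
    MeasurableData (fun _ : Ω => D) D.length :=
  ⟨fun _ => rfl, fun _ _ _ _ _ => measurable_const⟩

variable {D : Ω → List (Episode H S A)} {k : ℕ}

theorem MeasurableData.comp {Ω' : Type*} [MeasurableSpace Ω'] {f : Ω' → Ω}
    (hD : MeasurableData D k) (hf : Measurable f) : MeasurableData (fun ω => D (f ω)) k :=
  ⟨fun _ => hD.length_eq _, fun h s a φ hφ => (hD.visitSum h s a φ hφ).comp hf⟩

theorem MeasurableData.count (hD : MeasurableData D k) (h : Fin H) (s : Fin S) (a : Fin A) :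
    Measurable fun ω => (SSR.count (D ω) h s a : ℝ) := by
  simp only [count_eq_visitSum]
  exact hD.visitSum _ _ _ _ measurable_const

theorem MeasurableData.rewardHat (hD : MeasurableData D k) (h : Fin H) (s : Fin S) (a : Fin A) :
    Measurable fun ω => SSR.rewardHat (D ω) h s a := by
  simp only [rewardHat_eq_visitSum]
  exact (hD.visitSum _ _ _ _ measurable_fst).div ((hD.count h s a).add_const 1)

theorem measurable_ite_snd_eq (s' : Fin S) :
    Measurable fun y : ℝ × Fin S => if y.2 = s' then (1 : ℝ) else 0 :=
  Measurable.ite (TabularMDP.measurableSet_snd_eq s') measurable_const measurable_const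

theorem MeasurableData.transHat (hD : MeasurableData D k) (h : Fin H) (s : Fin S) (a : Fin A)
    (s' : Fin S) : Measurable fun ω => SSR.transHat (D ω) h s a s' := by
  simp only [transHat_eq_visitSum]
  exact (hD.visitSum _ _ _ _ (measurable_ite_snd_eq s')).div ((hD.count h s a).add_const 1)

theorem MeasurableData.sigmaHo (hD : MeasurableData D k) (h : Fin H) (s : Fin S) (a : Fin A) :
    Measurable fun ω => SSR.sigmaHo (D ω) h s a := by
  simp only [SSR.sigmaHo, hD.length_eq]
  have := hD.count h s a
  fun_prop

theorem MeasurableData.backup (hD : MeasurableData D k) {z : Ω → ℝ} (hz : Measurable z)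
    {V : Ω → Fin S → ℝ} (hV : ∀ s, Measurable fun ω => V ω s) (h : Fin H) (s : Fin S)
    (a : Fin A) : Measurable fun ω => SSR.backup (D ω) (z ω) (V ω) h s a :=
  ((hD.rewardHat h s a).add (Finset.measurable_sum _ fun s' _ =>
    (hD.transHat h s a s').mul (hV s'))).add ((hD.sigmaHo h s a).mul hz)

theorem MeasurableData.vbar (hD : MeasurableData D k) {z : Ω → ℝ} (hz : Measurable z)
    (h : ℕ) (s : Fin S) : Measurable fun ω => SSR.vbar (D ω) (z ω) h s := by
  by_cases hh : h < H
  · simp only [vbar_of_lt _ _ hh, qbar, clip]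
    have : Measurable fun ω => ⨆ a, SSR.backup (D ω) (z ω) (SSR.vbar (D ω) (z ω) (h + 1)) ⟨h, hh⟩ s a :=
      Measurable.iSup fun a => hD.backup hz (fun s' => MeasurableData.vbar hD hz (h + 1) s') _ _ _
    exact measurable_const.max (measurable_const.min this)
  · simp only [vbar_of_le _ _ (not_lt.1 hh)]
    exact measurable_const
termination_by H - h

theorem MeasurableData.qbar (hD : MeasurableData D k) {z : Ω → ℝ} (hz : Measurable z)
    (h : Fin H) (s : Fin S) (a : Fin A) : Measurable fun ω => SSR.qbar (D ω) (z ω) h s a :=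
  hD.backup hz (fun s' => hD.vbar hz (h + 1) s') _ _ _

theorem MeasurableData.policy (hD : MeasurableData D k) {z : Ω → ℝ} (hz : Measurable z)
    {sel : ℕ → Fin H → Fin S → (Fin A → ℝ) → Fin A} (hsel : IsArgmaxRule sel)
    (h : Fin H) (s : Fin S) : Measurable fun ω => SSR.policy sel (D ω) (z ω) h s := by
  simp only [SSR.policy, hD.length_eq]
  exact (hsel k h s).1.comp (measurable_pi_lambda _ fun a => hD.qbar hz h s a)

theorem MeasurableData.append_rollout (M : TabularMDP H S A) (hD : MeasurableData D k)
    {π : Ω → Policy H S A} {d : Ω → Draws H S A} (hπ : ∀ h s, Measurable fun ω => π ω h s)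
    (hd : ∀ h s a, Measurable fun ω => d ω h s a) :
    MeasurableData (fun ω => D ω ++ [M.rollout (π ω) (d ω)]) (k + 1) := by
  refine ⟨fun ω => by simp [hD.length_eq], fun h s a φ hφ => ?_⟩
  simp only [visitSum_append_singleton]
  refine (hD.visitSum h s a φ hφ).add (Measurable.ite ?_ (hφ.comp
    ((M.measurable_rollout_reward hπ hd h).prodMk (M.measurable_rollout_state hπ hd _)))
    measurable_const)
  exact ((M.measurable_rollout_state hπ hd _) (measurableSet_singleton s)).inter
    ((M.measurable_rollout_action hπ hd h) (measurableSet_singleton a))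

end Measurability

theorem greedy_policy {sel : ℕ → Fin H → Fin S → (Fin A → ℝ) → Fin A} (hsel : IsArgmaxRule sel)
    (D : List (Episode H S A)) (z : ℝ) : Greedy D z (policy sel D z) :=
  fun h s a => (hsel D.length h s).2 _ a

/-! ### The interaction as a function of independent draws -/

section History

variable (M : TabularMDP H S A) (sel : ℕ → Fin H → Fin S → (Fin A → ℝ) → Fin A)

/-- The policy played in episode `k`. -/
noncomputable def played (ω : Sample H S A) (k : ℕ) : Policy H S A :=
  policy sel (history M sel ω k) (ω k).1

/-- The trajectory of episode `k`. -/
noncomputable def episode (ω : Sample H S A) (k : ℕ) : Episode H S A :=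
  M.rollout (played M sel ω k) (ω k).2

theorem history_succ (ω : Sample H S A) (k : ℕ) :
    history M sel ω (k + 1) = history M sel ω k ++ [episode M sel ω k] := rfl

theorem history_length (ω : Sample H S A) (k : ℕ) : (history M sel ω k).length = k := by
  induction k with
  | zero => rfl
  | succ k ih => rw [history_succ, List.length_append, ih]; rfl

/-- Adaptedness in concrete form: the randomness of episode `k` is invisible to the data collected
before it. -/
theorem history_update (ω : Sample H S A) {j k : ℕ} (hjk : j ≤ k) (x : ℝ × Draws H S A) :
    history M sel (Function.update ω k x) j = history M sel ω j := by
  induction j with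
  | zero => rfl
  | succ j ih =>
    have hne : j ≠ k := by omega
    simp only [history_succ, episode, played, ih (by omega), Function.update_of_ne hne]

theorem episode_update_of_lt (ω : Sample H S A) {j k : ℕ} (hjk : j < k) (x : ℝ × Draws H S A) :
    episode M sel (Function.update ω k x) j = episode M sel ω j := by
  simp only [episode, played, history_update M sel ω hjk.le, Function.update_of_ne hjk.ne]

theorem played_update_of_lt (ω : Sample H S A) {j k : ℕ} (hjk : j < k) (x : ℝ × Draws H S A) :
    played M sel (Function.update ω k x) j = played M sel ω j := by
  simp only [played, history_update M sel ω hjk.le, Function.update_of_ne hjk.ne]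

theorem played_update_self (ω : Sample H S A) (k : ℕ) (x : ℝ × Draws H S A) :
    played M sel (Function.update ω k x) k = policy sel (history M sel ω k) x.1 := by
  simp only [played, history_update M sel ω le_rfl, Function.update_self]

theorem episode_update_self (ω : Sample H S A) (k : ℕ) (x : ℝ × Draws H S A) :
    episode M sel (Function.update ω k x) k =
      M.rollout (policy sel (history M sel ω k) x.1) x.2 := by
  simp only [episode, played_update_self, Function.update_self]

theorem visitSum_history (ω : Sample H S A) (k : ℕ) (h : Fin H) (s : Fin S) (a : Fin A)
    (φ : ℝ × Fin S → ℝ) :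
    visitSum (history M sel ω k) h s a φ = ∑ i ∈ Finset.range k,
      if (episode M sel ω i).state h.castSucc = s ∧ (episode M sel ω i).action h = a
      then φ ((episode M sel ω i).reward h, (episode M sel ω i).state h.succ) else 0 := by
  induction k with
  | zero => simp [history, visitSum]
  | succ k ih => rw [history_succ, visitSum_append_singleton, ih, Finset.sum_range_succ]

theorem measurable_sample_draws (k : ℕ) (h : Fin H) (s : Fin S) (a : Fin A) :
    Measurable fun ω : Sample H S A => (ω k).2 h s a :=
  (TabularMDP.measurable_draws_apply h s a).comp (measurable_snd.comp (measurable_pi_apply k))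

theorem measurable_sample_seed (k : ℕ) : Measurable fun ω : Sample H S A => (ω k).1 :=
  measurable_fst.comp (measurable_pi_apply k)

variable {sel}

theorem measurableData_history (hsel : IsArgmaxRule sel) (k : ℕ) :
    MeasurableData (fun ω => history M sel ω k) k := by
  induction k with
  | zero => exact measurableData_const []
  | succ k ih =>
    exact ih.append_rollout M (fun h s => ih.policy (measurable_sample_seed k) hsel h s)
      (measurable_sample_draws k)

theorem measurable_played (hsel : IsArgmaxRule sel) (k : ℕ) (h : Fin H) (s : Fin S) :
    Measurable fun ω => played M sel ω k h s :=
  (measurableData_history M hsel k).policy (measurable_sample_seed k) hsel h s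

theorem measurable_episode_state (hsel : IsArgmaxRule sel) (k : ℕ) (j : Fin (H + 1)) :
    Measurable fun ω => (episode M sel ω k).state j :=
  M.measurable_rollout_state (measurable_played M hsel k) (measurable_sample_draws k) j

theorem measurable_episode_action (hsel : IsArgmaxRule sel) (k : ℕ) (h : Fin H) :
    Measurable fun ω => (episode M sel ω k).action h :=
  M.measurable_rollout_action (measurable_played M hsel k) (measurable_sample_draws k) h

theorem measurable_episode_reward (hsel : IsArgmaxRule sel) (k : ℕ) (h : Fin H) :
    Measurable fun ω => (episode M sel ω k).reward h :=
  M.measurable_rollout_reward (measurable_played M hsel k) (measurable_sample_draws k) h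

/-- Law of the randomness of one episode. -/
noncomputable def episodeLaw : Measure (ℝ × Draws H S A) := (gaussianReal 0 1).prod M.drawsLaw

instance : IsProbabilityMeasure (episodeLaw M) := by unfold episodeLaw; infer_instance

theorem sampleLaw_eq : sampleLaw M = Measure.infinitePi fun _ : ℕ => episodeLaw M := rfl

instance : IsProbabilityMeasure (sampleLaw M) := by rw [sampleLaw_eq]; infer_instance

/-- Chernoff bound for a sum over the visits to a triple. -/
theorem measure_visitSum_gt_le (hsel : IsArgmaxRule sel) (h : Fin H) (s : Fin S) (a : Fin A)
    {φ : ℝ × Fin S → ℝ} (hφ : Measurable φ)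
    (h1 : ∫⁻ y, ENNReal.ofReal (Real.exp (φ y)) ∂(M.law h s a) ≤ 1) (k : ℕ) (L : ℝ) :
    sampleLaw M {ω | L < visitSum (history M sel ω k) h s a φ} ≤
      ENNReal.ofReal (Real.exp (-L)) := by
  simp only [visitSum_history]
  rw [sampleLaw_eq]
  refine measure_sum_adapted_ge_le (episodeLaw M)
    (ξ := fun i ω => if (episode M sel ω i).state h.castSucc = s ∧ (episode M sel ω i).action h = a
      then φ ((episode M sel ω i).reward h, (episode M sel ω i).state h.succ) else 0)
    (fun i => ?_) (fun i ω k x hik => ?_) (fun i ω => ?_) k L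
  · refine Measurable.ite ?_ (hφ.comp ((measurable_episode_reward M hsel i h).prodMk
      (measurable_episode_state M hsel i _))) measurable_const
    exact ((measurable_episode_state M hsel i _) (measurableSet_singleton s)).inter
      ((measurable_episode_action M hsel i h) (measurableSet_singleton a))
  · simp only [episode_update_of_lt M sel ω hik]
  · simp only [episode_update_self]
    set D := history M sel ω i
    -- Freezing the seed fixes the policy. Then all draws but the entry `(h, s, a)` are frozen,
    -- which decides whether the triple is visited: if so, that entry contributes the exponential
    -- moment in `h1`; if not, the integrand is 1.
    refine (lintegral_prod_le _).trans ?_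
    refine (lintegral_mono fun z => ?_).trans (by simp : ∫⁻ _ : ℝ, 1 ∂(gaussianReal 0 1) ≤ 1)
    set π := policy sel D z
    have hπ : ∀ h s, Measurable fun _ : Draws H S A => π h s := fun _ _ => measurable_const
    have hd := TabularMDP.measurable_draws_apply (H := H) (S := S) (A := A)
    have hF : Measurable fun d : Draws H S A => ENNReal.ofReal (Real.exp
        (if (M.rollout π d).state h.castSucc = s ∧ (M.rollout π d).action h = a
          then φ ((M.rollout π d).reward h, (M.rollout π d).state h.succ) else 0)) := by
      refine (Real.measurable_exp.comp (Measurable.ite ?_ (hφ.comp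
        ((M.measurable_rollout_reward hπ hd h).prodMk (M.measurable_rollout_state hπ hd _)))
        measurable_const)).ennreal_ofReal
      exact ((M.measurable_rollout_state hπ hd _) (measurableSet_singleton s)).inter
        ((M.measurable_rollout_action hπ hd h) (measurableSet_singleton a))
    refine lintegral_pi_le_of_update _ h hF fun d => ?_
    refine lintegral_pi_le_of_update _ s (hF.comp (measurable_update _)) fun y => ?_
    refine lintegral_pi_le_of_update _ a
      ((hF.comp (measurable_update _)).comp (measurable_update _)) fun y' => ?_
    have hst := fun w => M.rollout_state_update π d h w
    by_cases hv : (M.rollout π d).state h.castSucc = s ∧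
        π h ((M.rollout π d).state h.castSucc) = a
    · refine le_trans (le_of_eq (lintegral_congr fun x => ?_)) h1
      set w := Function.update y s (Function.update y' a x) with hw
      have hx : w s a = x := by simp [hw]
      have hact : (M.rollout π (Function.update d h w)).action h = a := by
        rw [TabularMDP.rollout_action, hst, hv.2]
      have hpair : ((M.rollout π (Function.update d h w)).reward h,
          (M.rollout π (Function.update d h w)).state h.succ) = x := by
        rw [TabularMDP.rollout_reward, TabularMDP.rollout_state_succ, hst, hv.2, hv.1,
          Function.update_self, hx]
      simp only [Function.comp_apply, ← hw]
      rw [if_pos ⟨(hst w).trans hv.1, hact⟩, hpair]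
    · refine le_trans (le_of_eq (lintegral_congr fun x => ?_))
        (by simp : ∫⁻ _ : ℝ × Fin S, 1 ∂(M.law h s a) ≤ 1)
      simp only [Function.comp_apply]
      rw [if_neg, Real.exp_zero, ENNReal.ofReal_one]
      rw [TabularMDP.rollout_action, hst]
      exact hv

end History

end SSR

/-! ### Realised sums against sums of conditional means -/

section Multiplicative

variable {X : Type*} [MeasurableSpace X] (μ : Measure X)

/-- Conditional expectation of `Y` given all coordinates but the `i`-th. -/
noncomputable def resampleMean (i : ℕ) (Y : (ℕ → X) → ℝ) (ω : ℕ → X) : ℝ :=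
  ∫ x, Y (Function.update ω i x) ∂μ

theorem measurable_resampleMean [IsProbabilityMeasure μ] (i : ℕ) {Y : (ℕ → X) → ℝ} (hY : Measurable Y) :
    Measurable (resampleMean μ i Y) := by
  have h : StronglyMeasurable fun p : (ℕ → X) × X => Y (Function.update p.1 i p.2) :=
    (hY.comp measurable_update').stronglyMeasurable
  exact h.integral_prod_right'.measurable

theorem resampleMean_update_self (i : ℕ) (Y : (ℕ → X) → ℝ) (ω : ℕ → X) (x : X) :
    resampleMean μ i Y (Function.update ω i x) = resampleMean μ i Y ω := by
  simp only [resampleMean, Function.update_idem]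

theorem resampleMean_update_of_lt {i k : ℕ} (hik : i < k) {Y : (ℕ → X) → ℝ}
    (hadapt : ∀ ω (x : X), Y (Function.update ω k x) = Y ω) (ω : ℕ → X) (x : X) :
    resampleMean μ i Y (Function.update ω k x) = resampleMean μ i Y ω := by
  simp only [resampleMean]
  refine integral_congr_ae (ae_of_all _ fun y => ?_)
  simp only [Function.update_comm hik.ne' x y ω, hadapt]

theorem exp_neg_le_one_sub_half {y : ℝ} (h0 : 0 ≤ y) (h1 : y ≤ 1) : Real.exp (-y) ≤ 1 - y / 2 := by
  have h2 : (1 - y / 2) * Real.exp y ≥ 1 := by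
    have := Real.add_one_le_exp y
    nlinarith
  rw [Real.exp_neg, inv_le_iff_one_le_mul₀ (Real.exp_pos y)]
  linarith

theorem exp_le_one_add_two_mul {y : ℝ} (h0 : 0 ≤ y) (h1 : y ≤ 1) : Real.exp y ≤ 1 + 2 * y := by
  have := (abs_le.1 (Real.abs_exp_sub_one_sub_id_le (x := y) (by rwa [abs_of_nonneg h0]))).2
  nlinarith

/-- Normalises an exponential moment through `1 + u ≤ 1 + c ≤ exp c`. -/
theorem lintegral_exp_le_one_of_integral_le {Z : X → ℝ} {c u : ℝ}
    (hint : Integrable (fun x => Real.exp (Z x)) μ) (hle : ∫ x, Real.exp (Z x) ∂μ ≤ 1 + u)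
    (huc : u ≤ c) : ∫⁻ x, ENNReal.ofReal (Real.exp (Z x - c)) ∂μ ≤ 1 := by
  simp only [Real.exp_sub]
  rw [← ofReal_integral_eq_lintegral_ofReal (hint.div_const _)
    (ae_of_all _ fun x => by positivity), integral_div]
  rw [← ENNReal.ofReal_one]
  refine ENNReal.ofReal_le_ofReal ((div_le_one (Real.exp_pos _)).2 ?_)
  linarith [Real.add_one_le_exp c]

/-- Since `exp (-y) ≤ 1 - y/2` on `[0, 1]`, half the conditional mean minus the realised value has
exponential moment at most 1. Giving up a factor 2 avoids a deviation of order `√k`. -/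
theorem measure_resampleMean_gt_le [IsProbabilityMeasure μ] {Y : ℕ → (ℕ → X) → ℝ}
    (hY : ∀ i, Measurable (Y i))
    (hadapt : ∀ i (ω : ℕ → X) k (x : X), i < k → Y i (Function.update ω k x) = Y i ω)
    (h01 : ∀ i ω, Y i ω ∈ Set.Icc (0 : ℝ) 1) (k : ℕ) (L : ℝ) :
    (Measure.infinitePi fun _ : ℕ => μ)
      {ω | 2 * ∑ i ∈ Finset.range k, Y i ω + 2 * L < ∑ i ∈ Finset.range k, resampleMean μ i (Y i) ω} ≤
      ENNReal.ofReal (Real.exp (-L)) := by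
  refine le_trans (measure_mono fun ω hω => ?_)
    (measure_sum_adapted_ge_le μ (ξ := fun i ω => -Y i ω - -(resampleMean μ i (Y i) ω / 2))
      (fun i => (hY i).neg.sub ((measurable_resampleMean μ i (hY i)).div_const 2).neg)
      (fun i ω j x hij => ?_) (fun i ω => ?_) k L)
  · simp only [Set.mem_ofPred_eq, Finset.sum_sub_distrib, Finset.sum_neg_distrib,
      ← Finset.sum_div] at hω ⊢
    linarith
  · simp only [hadapt i ω j x hij,
      resampleMean_update_of_lt μ hij (fun ω x => hadapt i ω j x hij) ω x]
  · simp only [resampleMean_update_self]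
    have hm : Measurable fun x => Y i (Function.update ω i x) := (hY i).comp (measurable_update _)
    have hi : Integrable (fun x => Y i (Function.update ω i x)) μ :=
      Integrable.of_mem_Icc 0 1 hm.aemeasurable (ae_of_all _ fun x => h01 i _)
    have hie : Integrable (fun x => Real.exp (-Y i (Function.update ω i x))) μ :=
      Integrable.of_mem_Icc 0 1 (Real.measurable_exp.comp hm.neg).aemeasurable
        (ae_of_all _ fun x => ⟨(Real.exp_pos _).le, Real.exp_le_one_iff.2 (by
          linarith [(h01 i (Function.update ω i x)).1])⟩)
    refine lintegral_exp_le_one_of_integral_le μ hie (u := -(resampleMean μ i (Y i) ω / 2)) ?_ le_rfl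
    have := integral_mono hie ((integrable_const (1 : ℝ)).sub (hi.div_const 2)) fun x =>
      exp_neg_le_one_sub_half (h01 i (Function.update ω i x)).1 (h01 i _).2
    simp only [Pi.sub_apply] at this
    rw [integral_sub (integrable_const _) (hi.div_const 2), integral_div] at this
    simp only [integral_const, probReal_univ, smul_eq_mul, one_mul] at this
    exact this

/-- The opposite direction, from `exp y ≤ 1 + 2y` on `[0, 1]`. -/
theorem measure_sum_gt_resampleMean_le [IsProbabilityMeasure μ] {Y : ℕ → (ℕ → X) → ℝ}
    (hY : ∀ i, Measurable (Y i))
    (hadapt : ∀ i (ω : ℕ → X) k (x : X), i < k → Y i (Function.update ω k x) = Y i ω)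
    (h01 : ∀ i ω, Y i ω ∈ Set.Icc (0 : ℝ) 1) (k : ℕ) (L : ℝ) :
    (Measure.infinitePi fun _ : ℕ => μ)
      {ω | 2 * ∑ i ∈ Finset.range k, resampleMean μ i (Y i) ω + L < ∑ i ∈ Finset.range k, Y i ω} ≤
      ENNReal.ofReal (Real.exp (-L)) := by
  refine le_trans (measure_mono fun ω hω => ?_)
    (measure_sum_adapted_ge_le μ (ξ := fun i ω => Y i ω - 2 * resampleMean μ i (Y i) ω)
      (fun i => (hY i).sub ((measurable_resampleMean μ i (hY i)).const_mul 2))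
      (fun i ω j x hij => ?_) (fun i ω => ?_) k L)
  · simp only [Set.mem_ofPred_eq, Finset.sum_sub_distrib, ← Finset.mul_sum] at hω ⊢
    linarith
  · simp only [hadapt i ω j x hij,
      resampleMean_update_of_lt μ hij (fun ω x => hadapt i ω j x hij) ω x]
  · simp only [resampleMean_update_self]
    have hm : Measurable fun x => Y i (Function.update ω i x) := (hY i).comp (measurable_update _)
    have hi : Integrable (fun x => Y i (Function.update ω i x)) μ :=
      Integrable.of_mem_Icc 0 1 hm.aemeasurable (ae_of_all _ fun x => h01 i _)
    have hie : Integrable (fun x => Real.exp (Y i (Function.update ω i x))) μ :=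
      Integrable.of_mem_Icc 0 (Real.exp 1) (Real.measurable_exp.comp hm).aemeasurable
        (ae_of_all _ fun x => ⟨(Real.exp_pos _).le, Real.exp_le_exp.2 (h01 i _).2⟩)
    refine lintegral_exp_le_one_of_integral_le μ hie (u := 2 * resampleMean μ i (Y i) ω) ?_ le_rfl
    have := integral_mono hie ((integrable_const (1 : ℝ)).add (hi.const_mul 2)) fun x =>
      exp_le_one_add_two_mul (h01 i (Function.update ω i x)).1 (h01 i _).2
    simp only [Pi.add_apply] at this
    rw [integral_add (integrable_const _) (hi.const_mul 2), integral_const_mul] at this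
    simp only [integral_const, probReal_univ, smul_eq_mul, one_mul] at this
    exact this

end Multiplicative

/-! ### Concentration of the empirical model -/

namespace SSR

variable {H S A : ℕ} (M : TabularMDP H S A)
  {sel : ℕ → Fin H → Fin S → (Fin A → ℝ) → Fin A}

/-- Hoeffding's lemma: reward plus optimal continuation lies in `[0, H]`. As `V*` is not random, no
union over value functions is needed. -/
theorem lintegral_exp_backup_le_one [Nonempty (Fin A)] (h : Fin H) (s : Fin S) (a : Fin A)
    (t : ℝ) :
    ∫⁻ y, ENNReal.ofReal (Real.exp (t * (y.1 + M.optValue (h + 1) y.2 -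
      (M.R h s a + ∑ s', M.P h s a s' * M.optValue (h + 1) s')) - t ^ 2 * (H : ℝ) ^ 2 / 8))
      ∂(M.law h s a) ≤ 1 := by
  set ψ : ℝ × Fin S → ℝ := fun y => y.1 + M.optValue (h + 1) y.2 with hψ
  have hm : Measurable ψ :=
    measurable_fst.add ((measurable_of_countable (M.optValue (h + 1))).comp measurable_snd)
  have hmean : ∫ y, ψ y ∂(M.law h s a) =
      M.R h s a + ∑ s', M.P h s a s' * M.optValue (h + 1) s' := by
    rw [hψ, integral_add (M.integrable_reward h s a)
      (TabularMDP.integrable_of_finite_range measurable_snd _), M.integral_comp_snd]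
    rfl
  have hrange : ∀ᵐ y ∂(M.law h s a), ψ y ∈ Set.Icc (0 : ℝ) H := by
    filter_upwards [M.reward_mem h s a] with y hy
    have h1 := M.optValue_nonneg (h + 1) y.2
    have h2 := M.optValue_le (h := h + 1) h.2 y.2
    push_cast at h2
    have h3 : (0 : ℝ) ≤ (h : ℕ) := by positivity
    exact ⟨add_nonneg hy.1 h1, by simp only [hψ]; linarith [hy.2]⟩
  have hsub := hasSubgaussianMGF_of_mem_Icc hm.aemeasurable hrange
  rw [hmean] at hsub
  set m := M.R h s a + ∑ s', M.P h s a s' * M.optValue (h + 1) s'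
  have hint := hsub.integrable_exp_mul t
  have hle := hsub.mgf_le t
  have hc : (((‖(H : ℝ) - 0‖₊ / 2) ^ 2 : NNReal) : ℝ) * t ^ 2 / 2 = t ^ 2 * (H : ℝ) ^ 2 / 8 := by
    push_cast
    rw [sub_zero, Real.norm_natCast]
    ring
  rw [hc, mgf] at hle
  simp only [Real.exp_sub _ (t ^ 2 * (H : ℝ) ^ 2 / 8)]
  rw [← ofReal_integral_eq_lintegral_ofReal (hint.div_const _)
    (ae_of_all _ fun x => by positivity), integral_div, ← ENNReal.ofReal_one]
  exact ENNReal.ofReal_le_ofReal ((div_le_one (Real.exp_pos _)).2 hle)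

/-- From `exp t - 1 ≤ t + t²`. The quadratic term carries the factor `P`, which is why the
transition error can be made relative. -/
theorem lintegral_exp_trans_le_one (h : Fin H) (s : Fin S) (a : Fin A) (s' : Fin S)
    {t : ℝ} (ht : |t| ≤ 1) :
    ∫⁻ y, ENNReal.ofReal (Real.exp (t * (if y.2 = s' then 1 else 0) -
      (t + t ^ 2) * M.P h s a s')) ∂(M.law h s a) ≤ 1 := by
  have he : ∀ y : ℝ × Fin S, Real.exp (t * (if y.2 = s' then 1 else 0)) =
      (fun s'' => 1 + (Real.exp t - 1) * if s'' = s' then 1 else 0) y.2 := by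
    intro y
    by_cases hy : y.2 = s' <;> simp [hy]
  refine lintegral_exp_le_one_of_integral_le (M.law h s a)
    (u := (Real.exp t - 1) * M.P h s a s') ?_ ?_ ?_
  · simp only [he]
    exact TabularMDP.integrable_of_finite_range (f := Prod.snd) measurable_snd
      fun s'' => 1 + (Real.exp t - 1) * if s'' = s' then 1 else 0
  · simp only [he]
    rw [M.integral_comp_snd h s a fun s'' => 1 + (Real.exp t - 1) * if s'' = s' then 1 else 0]
    simp only [mul_add, mul_one, Finset.sum_add_distrib, M.sum_P, mul_ite, mul_zero,
      Finset.sum_ite_eq', Finset.mem_univ, if_true]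
    linarith [mul_comm (M.P h s a s') (Real.exp t - 1)]
  · have := (abs_le.1 (Real.abs_exp_sub_one_sub_id_le ht)).2
    exact mul_le_mul_of_nonneg_right (by linarith) (M.P_nonneg ..)

theorem visitSum_centered (D : List (Episode H S A)) (h : Fin H) (s : Fin S) (a : Fin A)
    (ψ : ℝ × Fin S → ℝ) (t m c : ℝ) :
    visitSum D h s a (fun y => t * (ψ y - m) - c) =
      t * (visitSum D h s a ψ - count D h s a * m) - count D h s a * c := by
  rw [visitSum_sub_const, visitSum_const_mul, visitSum_sub_const]

theorem count_le_length (D : List (Episode H S A)) (h : Fin H) (s : Fin S) (a : Fin A) :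
    count D h s a ≤ D.length := List.countP_le_length

/-- Reward and continuation form one average of a function of the pair, so a possible dependence
between them does no harm. -/
theorem rewardHat_add_sum_transHat (D : List (Episode H S A)) (h : Fin H) (s : Fin S) (a : Fin A)
    (V : Fin S → ℝ) :
    rewardHat D h s a + ∑ s', transHat D h s a s' * V s' =
      visitSum D h s a (fun y => y.1 + V y.2) / ((count D h s a : ℝ) + 1) := by
  rw [visitSum_add, rewardHat_eq_visitSum, add_div]
  congr 1
  have : (fun y : ℝ × Fin S => V y.2) = fun y => ∑ s', V s' * if y.2 = s' then 1 else 0 := by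
    funext y
    simp
  rw [this, visitSum_sum, Finset.sum_div]
  refine Finset.sum_congr rfl fun s' _ => ?_
  rw [transHat_eq_visitSum, visitSum_const_mul]
  ring

/-- Hoeffding-type accuracy at confidence level `L`. -/
def BackupConcentrated (D : List (Episode H S A)) (L : ℝ) : Prop :=
  ∀ h s a, |rewardHat D h s a + ∑ s', transHat D h s a s' * M.optValue (h + 1) s' -
    (M.R h s a + ∑ s', M.P h s a s' * M.optValue (h + 1) s')| ≤
      2 * H * √(L / ((count D h s a : ℝ) + 1)) + H / ((count D h s a : ℝ) + 1)

theorem measure_not_backupConcentrated_le [Nonempty (Fin A)] (hsel : IsArgmaxRule sel) (K : ℕ)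
    {L : ℝ} (hL : 0 < L) :
    sampleLaw M {ω | ¬ ∀ k < K, BackupConcentrated M (history M sel ω k) L} ≤
      ENNReal.ofReal (2 * K ^ 2 * H * S * A * Real.exp (-L)) := by
  set ψ : Fin H → ℝ × Fin S → ℝ := fun h y => y.1 + M.optValue (h + 1) y.2 with hψ
  set m : Fin H → Fin S → Fin A → ℝ := fun h s a =>
    M.R h s a + ∑ s', M.P h s a s' * M.optValue (h + 1) s' with hm
  -- The exponent that balances `L / lam` against `n * lam * H²` depends on the count `n`, which is
  -- random. The events are therefore indexed also by the possible values of `n` below `K`, which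
  -- explains the factor `K²`.
  set lam : ℕ → ℝ := fun n => √L / (H * √((n : ℝ) + 1)) with hlam
  set sg : Bool → ℝ := fun b => if b then 1 else -1 with hsg
  set E : Fin K × Fin K × Fin H × Fin S × Fin A × Bool → Set (Sample H S A) :=
    fun p => {ω | L < visitSum (history M sel ω p.1) p.2.2.1 p.2.2.2.1 p.2.2.2.2.1
      (fun y => (sg p.2.2.2.2.2 * lam p.2.1) * (ψ p.2.2.1 y - m p.2.2.1 p.2.2.2.1 p.2.2.2.2.1) -
        (sg p.2.2.2.2.2 * lam p.2.1) ^ 2 * (H : ℝ) ^ 2 / 8)} with hE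
  have hψm : ∀ h, Measurable (ψ h) := fun h =>
    measurable_fst.add ((measurable_of_countable (M.optValue (h + 1))).comp measurable_snd)
  have hEle : ∀ p, sampleLaw M (E p) ≤ ENNReal.ofReal (Real.exp (-L)) := fun p =>
    measure_visitSum_gt_le M hsel _ _ _
      ((((hψm _).sub_const _).const_mul _).sub_const _) (lintegral_exp_backup_le_one M _ _ _ _) _ L
  have hsub : {ω | ¬ ∀ k < K, BackupConcentrated M (history M sel ω k) L} ⊆ ⋃ p, E p := by
    intro ω hω
    by_contra hno
    refine hω fun k hk h s a => ?_
    have hH : (0 : ℝ) < H := by exact_mod_cast (Fin.pos h)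
    set D := history M sel ω k with hD
    set n := count D h s a with hn
    have hnK : n < K := by
      have := count_le_length D h s a
      rw [hD, history_length] at this
      exact this.trans_lt hk
    have hb : ∀ b, ω ∉ E (⟨k, hk⟩, ⟨n, hnK⟩, h, s, a, b) := fun b hb =>
      hno (Set.mem_iUnion.2 ⟨_, hb⟩)
    simp only [hE, Set.mem_ofPred_eq, not_lt, visitSum_centered, ← hD, ← hn] at hb
    set N := visitSum D h s a (ψ h) with hN
    have hr : 0 < √((n : ℝ) + 1) := Real.sqrt_pos.2 (by positivity)
    have hr2 : √((n : ℝ) + 1) ^ 2 = n + 1 := Real.sq_sqrt (by positivity)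
    have hL2 : √L ^ 2 = L := Real.sq_sqrt hL.le
    have hLp : 0 < √L := Real.sqrt_pos.2 hL
    have hl0 : 0 < lam n := by simp only [hlam]; positivity
    have h1 := hb true
    have h2 := hb false
    simp only [hsg, if_true, if_false, one_mul, neg_mul, neg_sq, Bool.false_eq_true] at h1 h2
    have habs : lam n * |N - n * m h s a| ≤ L + n * (lam n ^ 2 * (H : ℝ) ^ 2 / 8) := by
      rw [← abs_of_pos hl0, ← abs_mul, abs_of_pos hl0]
      exact abs_le.2 ⟨by linarith, by linarith⟩
    have hlsq : lam n ^ 2 * (H : ℝ) ^ 2 * (n + 1) = L := by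
      simp only [hlam, div_pow, mul_pow, hr2, hL2]
      field_simp
    have hle : lam n * |N - n * m h s a| ≤ 2 * L := by
      have h0 : 0 ≤ lam n ^ 2 * (H : ℝ) ^ 2 := by positivity
      have hn0 : (0 : ℝ) ≤ n := by positivity
      nlinarith
    have hX : |N - n * m h s a| ≤ 2 * (H * √L * √((n : ℝ) + 1)) := by
      refine le_of_mul_le_mul_left (hle.trans (le_of_eq ?_)) hl0
      simp only [hlam]
      field_simp
      rw [hL2]
    have hm0 : 0 ≤ m h s a := add_nonneg (M.R_mem h s a).1
      (M.sum_P_mul_nonneg fun s' => M.optValue_nonneg _ s')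
    have hmH : m h s a ≤ H := by
      have e1 := M.bellman_le_optValue h s a
      have e2 := M.optValue_le h.2.le s
      have : (0 : ℝ) ≤ (h : ℕ) := by positivity
      linarith
    rw [rewardHat_add_sum_transHat]
    change |N / ((n : ℝ) + 1) - m h s a| ≤ _
    have hn1 : (0 : ℝ) < (n : ℝ) + 1 := by positivity
    -- The denominator `n + 1` in place of `n` leaves the bias `m / (n + 1)` with `0 ≤ m ≤ H`; this
    -- is the second term of the claim.
    have heq : N / ((n : ℝ) + 1) - m h s a = (N - n * m h s a - m h s a) / ((n : ℝ) + 1) := by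
      field_simp; ring
    rw [heq, abs_div, abs_of_pos hn1, Real.sqrt_div hL.le]
    have hfin : |N - n * m h s a - m h s a| ≤ 2 * (H * √L * √((n : ℝ) + 1)) + H := by
      refine (abs_sub _ _).trans (add_le_add hX ?_)
      rwa [abs_of_nonneg hm0]
    calc |N - n * m h s a - m h s a| / ((n : ℝ) + 1)
        ≤ (2 * (H * √L * √((n : ℝ) + 1)) + H) / ((n : ℝ) + 1) := by gcongr
      _ = _ := by
        rw [add_div]
        congr 1
        rw [mul_div_assoc', div_eq_div_iff hn1.ne' hr.ne']
        linear_combination (2 * H * √L) * hr2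
  calc sampleLaw M {ω | ¬ ∀ k < K, BackupConcentrated M (history M sel ω k) L}
      ≤ ∑ p, sampleLaw M (E p) := (measure_mono hsub).trans (measure_iUnion_fintype_le _ _)
    _ ≤ ∑ _p : Fin K × Fin K × Fin H × Fin S × Fin A × Bool, ENNReal.ofReal (Real.exp (-L)) :=
        Finset.sum_le_sum fun p _ => hEle p
    _ = ENNReal.ofReal (2 * K ^ 2 * H * S * A * Real.exp (-L)) := by
        simp only [Finset.sum_const, Finset.card_univ, Fintype.card_prod, Fintype.card_fin,
          Fintype.card_bool]
        rw [← ENNReal.ofReal_nsmul, nsmul_eq_mul]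
        push_cast
        ring_nf

/-- The exponents are fixed at `±α`, so no union over counts is needed. Dividing by `α = 1/(8H)`
turns `L` into `8HL` and the quadratic term into the relative error `α P`; the `+ 1` pays for the
denominator `n + 1`. -/
theorem measure_not_transAccurate_le (hsel : IsArgmaxRule sel) (K : ℕ) {L : ℝ} :
    sampleLaw M {ω | ¬ ∀ k < K,
      TransAccurate (history M sel ω k) M (1 / (8 * (H : ℝ))) (8 * H * L + 1)} ≤
      ENNReal.ofReal (2 * K * H * S ^ 2 * A * Real.exp (-L)) := by
  set α : ℝ := 1 / (8 * (H : ℝ)) with hα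
  set sg : Bool → ℝ := fun b => if b then 1 else -1 with hsg
  set E : Fin K × Fin H × Fin S × Fin A × Fin S × Bool → Set (Sample H S A) :=
    fun p => {ω | L < visitSum (history M sel ω p.1) p.2.1 p.2.2.1 p.2.2.2.1
      (fun y => (sg p.2.2.2.2.2 * α) * (if y.2 = p.2.2.2.2.1 then 1 else 0) -
        ((sg p.2.2.2.2.2 * α) + (sg p.2.2.2.2.2 * α) ^ 2) *
          M.P p.2.1 p.2.2.1 p.2.2.2.1 p.2.2.2.2.1)} with hE
  have hEle : ∀ p, sampleLaw M (E p) ≤ ENNReal.ofReal (Real.exp (-L)) := fun p => by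
    refine measure_visitSum_gt_le M hsel _ _ _
      (((measurable_ite_snd_eq _).const_mul _).sub_const _)
      (lintegral_exp_trans_le_one M _ _ _ _ ?_) _ L
    have hH : (1 : ℝ) ≤ H := by exact_mod_cast (Fin.pos p.2.1)
    have h1 : |sg p.2.2.2.2.2| = 1 := by
      simp only [hsg]; split_ifs <;> simp
    rw [abs_mul, h1, one_mul, hα, abs_of_nonneg (by positivity)]
    rw [div_le_one (by positivity)]
    linarith
  have hsub : {ω | ¬ ∀ k < K,
      TransAccurate (history M sel ω k) M α (8 * H * L + 1)} ⊆ ⋃ p, E p := by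
    intro ω hω
    by_contra hno
    refine hω fun k hk h s a s' => ?_
    have hH : (0 : ℝ) < H := by exact_mod_cast (Fin.pos h)
    have hα0 : 0 < α := by positivity
    set D := history M sel ω k with hD
    set n := count D h s a with hn
    have hb : ∀ b, ω ∉ E (⟨k, hk⟩, h, s, a, s', b) := fun b hb =>
      hno (Set.mem_iUnion.2 ⟨_, hb⟩)
    simp only [hE, Set.mem_ofPred_eq, not_lt, visitSum_sub_const, visitSum_const_mul, ← hD,
      ← hn] at hb
    rw [transHat_eq_visitSum]
    set N := visitSum D h s a (fun y => if y.2 = s' then 1 else 0) with hN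
    set p := M.P h s a s' with hp
    have hp0 : 0 ≤ p := M.P_nonneg ..
    have hp1 : p ≤ 1 := by
      rw [← M.sum_P h s a]
      exact Finset.single_le_sum (f := fun s' => M.P h s a s') (fun _ _ => M.P_nonneg ..)
        (Finset.mem_univ s')
    have h1 := hb true
    have h2 := hb false
    simp only [hsg, if_true, if_false, one_mul, neg_mul, neg_sq, Bool.false_eq_true] at h1 h2
    have habs : α * |N - n * p| ≤ α * (8 * H * L + n * (α * p)) := by
      rw [← abs_of_pos hα0, ← abs_mul, abs_of_pos hα0]
      have : α * (8 * H * L + n * (α * p)) = L + n * (α ^ 2 * p) := by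
        have : α * (8 * H * L) = L := by rw [hα]; field_simp
        rw [mul_add, this]; ring
      rw [this]
      exact abs_le.2 ⟨by linarith, by linarith⟩
    have hX := le_of_mul_le_mul_left habs hα0
    have hn1 : (0 : ℝ) < (n : ℝ) + 1 := by positivity
    have heq : N / ((n : ℝ) + 1) - p = (N - n * p - p) / ((n : ℝ) + 1) := by
      field_simp; ring
    change |N / ((n : ℝ) + 1) - p| ≤ _
    rw [heq, abs_div, abs_of_pos hn1, div_le_iff₀ hn1]
    have h3 := abs_sub (N - n * p) p
    rw [abs_of_nonneg hp0] at h3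
    have h4 : (α * p + (8 * H * L + 1) / ((n : ℝ) + 1)) * ((n : ℝ) + 1) =
        α * p * (n + 1) + (8 * H * L + 1) := by field_simp
    rw [h4]
    have : 0 ≤ α * p := by positivity
    linarith
  calc _ ≤ ∑ p, sampleLaw M (E p) := (measure_mono hsub).trans (measure_iUnion_fintype_le _ _)
    _ ≤ ∑ _p : Fin K × Fin H × Fin S × Fin A × Fin S × Bool, ENNReal.ofReal (Real.exp (-L)) :=
        Finset.sum_le_sum fun p _ => hEle p
    _ = ENNReal.ofReal (2 * K * H * S ^ 2 * A * Real.exp (-L)) := by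
        simp only [Finset.sum_const, Finset.card_univ, Fintype.card_prod, Fintype.card_fin,
          Fintype.card_bool]
        rw [← ENNReal.ofReal_nsmul, nsmul_eq_mul]
        push_cast
        ring_nf

end SSR

/-! ### Averaging over the seed -/

namespace SSR

variable {H S A : ℕ} (M : TabularMDP H S A)
  {sel : ℕ → Fin H → Fin S → (Fin A → ℝ) → Fin A}

theorem gaussianReal_Icc_pos (B : ℝ) : 0 < (gaussianReal 0 1).real (Set.Icc B (B + 1)) := by
  rw [measureReal_def, ENNReal.toReal_pos_iff]
  refine ⟨pos_iff_ne_zero.2 fun h0 => ?_, measure_lt_top _ _⟩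
  have := gaussianReal_absolutelyContinuous' 0 (one_ne_zero : (1 : NNReal) ≠ 0) h0
  simp [Real.volume_Icc] at this

theorem gaussianReal_abs_gt_le (Z : ℝ) :
    (gaussianReal 0 1).real {z | Z < |z|} ≤ 4 * Real.exp (-Z) := by
  have he : Real.exp (1 / 2) ≤ 2 := by
    have h3 := Real.exp_bound_div_one_sub_of_interval (x := 1 / 2) (by norm_num) (by norm_num)
    norm_num at h3
    exact h3
  have hsub : {z : ℝ | Z < |z|} ⊆ {z | Z ≤ id z} ∪ {z | id z ≤ -Z} := by
    intro z hz
    rcases lt_abs.1 (show Z < |z| from hz) with h | h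
    · exact Or.inl h.le
    · exact Or.inr (by simp only [id, Set.mem_ofPred_eq]; linarith)
  have hmgf : ∀ t : ℝ, t ^ 2 = 1 → mgf id (gaussianReal 0 1) t = Real.exp (1 / 2) := by
    intro t ht
    rw [mgf_id_gaussianReal]
    simp [ht]
  have h1 := measure_ge_le_exp_mul_mgf (μ := gaussianReal 0 1) (X := id) Z (t := 1) (by norm_num)
    (integrable_exp_mul_gaussianReal 1)
  have h2 := measure_le_le_exp_mul_mgf (μ := gaussianReal 0 1) (X := id) (-Z) (t := -1)
    (by norm_num) (integrable_exp_mul_gaussianReal (-1))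
  rw [hmgf _ (by norm_num)] at h1 h2
  have h3 := (measureReal_mono hsub (μ := gaussianReal 0 1)).trans (measureReal_union_le _ _)
  have h4 : -(-1) * -Z = -Z := by ring
  have h5 : -1 * Z = -Z := by ring
  rw [h4] at h2
  rw [h5] at h1
  nlinarith [Real.exp_pos (-Z)]

/-- Total bonus collected along a trajectory. -/
noncomputable def pathSum (b : Fin H → Fin S → Fin A → ℝ) (e : Episode H S A) : ℝ :=
  ∑ h, b h (e.state h.castSucc) (e.action h)

/-- Replaces the bonus under the occupancy measure by the bonus at visited triples, to which
pigeonhole applies. -/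
theorem integral_pathSum_rollout (b : Fin H → Fin S → Fin A → ℝ) (π : Policy H S A) :
    ∫ d, pathSum b (M.rollout π d) ∂M.drawsLaw =
      ∑ h : Fin H, M.occE π h fun s => b h s (π h s) := by
  have hm : ∀ j, Measurable fun d => (M.rollout π d).state j := fun j =>
    M.measurable_rollout_state (π := fun _ => π) (d := id) (fun _ _ => measurable_const)
      TabularMDP.measurable_draws_apply j
  simp only [pathSum, TabularMDP.rollout_action]
  rw [integral_finsetSum _ fun h _ => TabularMDP.integrable_of_finite_range (hm h.castSucc)
    fun s => b h s (π h s)]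
  refine Finset.sum_congr rfl fun h _ => ?_
  exact M.integral_rollout_state π h.castSucc fun s => b h s (π h s)

theorem measurable_pathSum_rollout {Ω : Type*} [MeasurableSpace Ω] {π : Ω → Policy H S A}
    {d : Ω → Draws H S A} (hπ : ∀ h s, Measurable fun ω => π ω h s)
    (hd : ∀ h s a, Measurable fun ω => d ω h s a)
    {b : Ω → Fin H → Fin S → Fin A → ℝ} (hb : ∀ h s a, Measurable fun ω => b ω h s a) :
    Measurable fun ω => pathSum (b ω) (M.rollout (π ω) (d ω)) :=
  Finset.measurable_sum _ fun h _ => Measurable.eval_finite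
    (F := fun (p : Fin S × Fin A) ω => b ω h p.1 p.2)
    (f := fun ω => ((M.rollout (π ω) (d ω)).state h.castSucc, (M.rollout (π ω) (d ω)).action h))
    (fun p => hb h p.1 p.2)
    ((M.measurable_rollout_state hπ hd _).prodMk (M.measurable_rollout_action hπ hd h))

theorem abs_pathSum_le (b : Fin H → Fin S → Fin A → ℝ) (e : Episode H S A) :
    |pathSum b e| ≤ ∑ h, ∑ s, ∑ a, |b h s a| := by
  refine (Finset.abs_sum_le_sum_abs _ _).trans (Finset.sum_le_sum fun h _ => ?_)
  exact (Finset.single_le_sum (f := fun a => |b h (e.state h.castSucc) a|)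
    (fun _ _ => abs_nonneg _) (Finset.mem_univ (e.action h))).trans
    (Finset.single_le_sum (f := fun s => ∑ a, |b h s a|)
      (fun _ _ => Finset.sum_nonneg fun _ _ => abs_nonneg _)
      (Finset.mem_univ (e.state h.castSucc)))

variable {M} {D : List (Episode H S A)} {B β : ℝ}

theorem integrable_pathSum (hsel : IsArgmaxRule sel) (b : Fin H → Fin S → Fin A → ℝ) :
    Integrable (fun x : ℝ × Draws H S A => pathSum b (M.rollout (policy sel D x.1) x.2))
      (episodeLaw M) := by
  have hm : Measurable fun x : ℝ × Draws H S A => pathSum b (M.rollout (policy sel D x.1) x.2) :=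
    measurable_pathSum_rollout M
      (fun h s => (measurableData_const D).policy measurable_fst hsel h s)
      (fun h s a => (TabularMDP.measurable_draws_apply h s a).comp measurable_snd)
      (fun _ _ _ => measurable_const)
  exact Integrable.of_bound hm.aestronglyMeasurable _ (ae_of_all _ fun x => abs_pathSum_le b _)

theorem integral_episodeLaw_pathSum (hsel : IsArgmaxRule sel) (b : Fin H → Fin S → Fin A → ℝ) :
    ∫ x, pathSum b (M.rollout (policy sel D x.1) x.2) ∂(episodeLaw M) =
      ∫ z, ∑ h : Fin H, M.occE (policy sel D z) h (fun s => b h s (policy sel D z h s))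
        ∂(gaussianReal 0 1) := by
  have hi := integrable_pathSum (M := M) (D := D) hsel b
  rw [episodeLaw] at hi ⊢
  rw [integral_prod _ hi]
  simp only [integral_pathSum_rollout]

theorem measurable_policy (hsel : IsArgmaxRule sel) : Measurable (policy sel D) :=
  measurable_pi_lambda _ fun h => measurable_pi_lambda _ fun s =>
    (measurableData_const D).policy measurable_id hsel h s

/-- There are finitely many policies, so every function of the policy is bounded and measurable. -/
theorem integrable_comp_policy (hsel : IsArgmaxRule sel) (g : Policy H S A → ℝ)
    {Ω : Type*} [MeasurableSpace Ω] (μ : Measure Ω) [IsFiniteMeasure μ] {z : Ω → ℝ}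
    (hz : Measurable z) : Integrable (fun ω => g (policy sel D (z ω))) μ := by
  refine Integrable.of_bound (C := ∑ π, |g π|) (((measurable_of_countable g).comp
    ((measurable_policy hsel).comp hz)).aestronglyMeasurable) (ae_of_all _ fun ω => ?_)
  rw [Real.norm_eq_abs]
  exact Finset.single_le_sum (f := fun π => |g π|) (fun π _ => abs_nonneg _) (Finset.mem_univ _)

/-- Conditional expectation of the regret of one episode given accurate data `D`. -/
theorem integral_gap_le [Nonempty (Fin A)] (hsel : IsArgmaxRule sel)
    (hB : BackupAccurate D M B) (hB0 : 0 ≤ B)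
    (hT : TransAccurate D M (1 / (8 * (H : ℝ))) β) (hβ : 0 ≤ β) (hH : 1 ≤ H)
    {Z : ℝ} (hZ : 0 ≤ Z) :
    ∫ x, (M.optValue 0 M.init - M.value (policy sel D x.1) 0 M.init) ∂(episodeLaw M) ≤
      H * (4 * Real.exp (-Z)) + 8 * (B + 5 + Z) / (gaussianReal 0 1).real (Set.Icc B (B + 1)) *
        ∫ x, pathSum (bonus D β) (M.rollout (policy sel D x.1) x.2) ∂(episodeLaw M) := by
  set γ := gaussianReal 0 1
  set pB := γ.real (Set.Icc B (B + 1)) with hpB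
  have hpB0 : 0 < pB := gaussianReal_Icc_pos B
  set gap : ℝ → ℝ := fun z => M.optValue 0 M.init - M.value (policy sel D z) 0 M.init with hgap
  set W : ℝ → ℝ := fun z => expBonus D M β (policy sel D z) with hW
  have hgi : Integrable gap γ := integrable_comp_policy hsel
    (fun π => M.optValue 0 M.init - M.value π 0 M.init) γ measurable_id
  have hWi : Integrable W γ := integrable_comp_policy hsel (fun π => expBonus D M β π) γ measurable_id
  have hW0 : ∀ z, 0 ≤ W z := fun z => expBonus_nonneg hβ _
  set EW := ∫ z, W z ∂γ with hEW
  have hEW0 : 0 ≤ EW := integral_nonneg hW0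
  have hgapH : ∀ z, gap z ≤ H := by
    intro z
    have h1 := M.optValue_le (Nat.zero_le H) M.init
    have h2 := M.value_nonneg (policy sel D z) 0 M.init
    simp only [hgap]
    simp at h1
    linarith
  have hpoint : ∀ z, pB * gap z ≤ 4 * (B + 5 + |z|) * (EW + W z) := by
    intro z
    set c := 4 * (B + 5 + |z|) with hc
    have hc0 : 0 ≤ c := by positivity
    have h1 : ∫ _ in Set.Icc B (B + 1), gap z ∂γ ≤ ∫ z' in Set.Icc B (B + 1), c * (W z' + W z) ∂γ :=
      setIntegral_mono_on (integrable_const _).integrableOn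
        ((hWi.add (integrable_const _)).const_mul c).integrableOn measurableSet_Icc
        fun z' hz' => gap_le hB hB0 hT hβ hH (greedy_policy hsel D z) (greedy_policy hsel D z') hz'
    rw [setIntegral_const, smul_eq_mul, integral_const_mul,
      integral_add hWi.integrableOn (integrable_const _).integrableOn, setIntegral_const,
      smul_eq_mul] at h1
    refine h1.trans (mul_le_mul_of_nonneg_left (add_le_add ?_ ?_) hc0)
    · exact setIntegral_le_integral hWi (ae_of_all _ hW0)
    · exact mul_le_of_le_one_left (hW0 z) measureReal_le_one
  -- The factor `|z|` is unbounded, so seeds beyond `Z` are charged the trivial gap `H` instead.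
  have hdom : ∀ z, gap z ≤ Set.indicator {z : ℝ | Z < |z|} (fun _ => (H : ℝ)) z +
      4 * (B + 5 + Z) / pB * (EW + W z) := by
    intro z
    have hnn : 0 ≤ 4 * (B + 5 + Z) / pB * (EW + W z) :=
      mul_nonneg (by positivity) (add_nonneg hEW0 (hW0 z))
    by_cases hz : Z < |z|
    · rw [Set.indicator_of_mem (show z ∈ {z : ℝ | Z < |z|} from hz)]
      linarith [hgapH z]
    · rw [Set.indicator_of_notMem (show z ∉ {z : ℝ | Z < |z|} from hz), zero_add,
        div_mul_eq_mul_div, le_div_iff₀ hpB0, mul_comm]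
      refine (hpoint z).trans (mul_le_mul_of_nonneg_right ?_ (add_nonneg hEW0 (hW0 z)))
      linarith [not_lt.1 hz]
  have hset : MeasurableSet {z : ℝ | Z < |z|} := measurableSet_lt measurable_const (by fun_prop)
  have hind : Integrable (Set.indicator {z : ℝ | Z < |z|} (fun _ => (H : ℝ))) γ :=
    (integrable_const _).indicator hset
  have hEWi : Integrable (fun z => 4 * (B + 5 + Z) / pB * (EW + W z)) γ :=
    ((integrable_const EW).add hWi).const_mul _
  have hfin := integral_mono hgi (hind.add hEWi) hdom
  simp only [Pi.add_apply] at hfin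
  rw [integral_add hind hEWi, integral_const_mul,
    integral_add (integrable_const EW) hWi, integral_indicator_const _ hset] at hfin
  simp only [integral_const, probReal_univ, smul_eq_mul, one_mul, ← hEW] at hfin
  have hL : ∫ x, (M.optValue 0 M.init - M.value (policy sel D x.1) 0 M.init) ∂(episodeLaw M) =
      ∫ z, gap z ∂γ := by
    have := integral_fun_fst (μ := γ) (ν := M.drawsLaw) gap
    simpa [episodeLaw] using this
  have hR := integral_episodeLaw_pathSum (M := M) (D := D) hsel (bonus D β)
  have htail := mul_le_mul_of_nonneg_left (gaussianReal_abs_gt_le Z) (Nat.cast_nonneg (α := ℝ) H)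
  rw [hL, hR]
  change _ ≤ _ + _ * EW
  have : 4 * (B + 5 + Z) / pB * (EW + EW) = 8 * (B + 5 + Z) / pB * EW := by ring
  rw [this, mul_comm (γ.real _)] at hfin
  linarith

/-! ### Pigeonhole sums over visited triples -/

section Pigeonhole

variable (M) (sel)

theorem count_history_succ (ω : Sample H S A) (k : ℕ) (h : Fin H) (s : Fin S) (a : Fin A) :
    count (history M sel ω (k + 1)) h s a = count (history M sel ω k) h s a +
      if (episode M sel ω k).state h.castSucc = s ∧ (episode M sel ω k).action h = a
      then 1 else 0 := by
  simp only [history_succ, count, List.countP_append, List.countP_singleton, decide_eq_true_eq]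

/-- Each visit raises the count of its pair by one, so the counts seen at the visits to a pair are
exactly `0, 1, 2, …`. -/
theorem sum_visited_eq (ω : Sample H S A) (K : ℕ) (h : Fin H) (f : ℕ → ℝ) :
    ∑ k ∈ Finset.range K, f (count (history M sel ω k) h ((episode M sel ω k).state h.castSucc)
      ((episode M sel ω k).action h)) =
    ∑ p : Fin S × Fin A, ∑ j ∈ Finset.range (count (history M sel ω K) h p.1 p.2), f j := by
  induction K with
  | zero => simp [history, count]
  | succ K ih =>
    rw [Finset.sum_range_succ, ih]
    set p₀ : Fin S × Fin A := ((episode M sel ω K).state h.castSucc, (episode M sel ω K).action h)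
      with hp₀
    have hstep : ∀ p : Fin S × Fin A,
        ∑ j ∈ Finset.range (count (history M sel ω (K + 1)) h p.1 p.2), f j =
        ∑ j ∈ Finset.range (count (history M sel ω K) h p.1 p.2), f j +
          if p₀ = p then f (count (history M sel ω K) h p.1 p.2) else 0 := by
      intro p
      rw [count_history_succ]
      by_cases hp : p₀ = p
      · rw [if_pos hp, if_pos ⟨congrArg Prod.fst hp, congrArg Prod.snd hp⟩, Finset.sum_range_succ]
      · rw [if_neg hp, if_neg fun hc => hp (Prod.ext hc.1 hc.2), add_zero, add_zero]
    simp only [hstep, Finset.sum_add_distrib, Finset.sum_ite_eq, Finset.mem_univ, if_true, hp₀]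

theorem sum_count_history (ω : Sample H S A) (K : ℕ) (h : Fin H) :
    ∑ p : Fin S × Fin A, (count (history M sel ω K) h p.1 p.2 : ℝ) = K := by
  have := sum_visited_eq M sel ω K h fun _ => 1
  simpa using this.symm

theorem sum_inv_sqrt_le (n : ℕ) : ∑ j ∈ Finset.range n, 1 / √((j : ℝ) + 1) ≤ 2 * √n := by
  induction n with
  | zero => simp
  | succ n ih =>
    rw [Finset.sum_range_succ]
    push_cast
    set r := √((n : ℝ) + 1) with hr
    set q := √(n : ℝ) with hq
    have hr0 : 0 < r := Real.sqrt_pos.2 (by positivity)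
    have hr2 : r ^ 2 = n + 1 := Real.sq_sqrt (by positivity)
    have hq2 : q ^ 2 = n := Real.sq_sqrt (by positivity)
    have : 1 / r ≤ 2 * r - 2 * q := by
      rw [div_le_iff₀ hr0]
      nlinarith [sq_nonneg (r - q)]
    linarith

/-- Cauchy–Schwarz over the `S * A` pairs, whose final counts add up to `K`. -/
theorem sum_visited_inv_sqrt_le (ω : Sample H S A) (K : ℕ) (h : Fin H) :
    ∑ k ∈ Finset.range K, 1 / √((count (history M sel ω k) h
      ((episode M sel ω k).state h.castSucc) ((episode M sel ω k).action h) : ℝ) + 1) ≤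
    2 * √(S * A * K) := by
  rw [sum_visited_eq M sel ω K h fun n => 1 / √((n : ℝ) + 1)]
  refine (Finset.sum_le_sum fun p _ => sum_inv_sqrt_le _).trans ?_
  rw [← Finset.mul_sum]
  refine mul_le_mul_of_nonneg_left (Real.le_sqrt_of_sq_le ?_) (by norm_num)
  refine sq_sum_le_card_mul_sum_sq.trans (le_of_eq ?_)
  simp only [Real.sq_sqrt (Nat.cast_nonneg _), sum_count_history, Finset.card_univ,
    Fintype.card_prod, Fintype.card_fin]
  push_cast
  ring

theorem sum_visited_inv_le (ω : Sample H S A) {K : ℕ} (hK : 1 ≤ K) (h : Fin H) :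
    ∑ k ∈ Finset.range K, 1 / ((count (history M sel ω k) h
      ((episode M sel ω k).state h.castSucc) ((episode M sel ω k).action h) : ℝ) + 1) ≤
    S * A * (1 + Real.log K) := by
  rw [sum_visited_eq M sel ω K h fun n => 1 / ((n : ℝ) + 1)]
  have hlog : 0 ≤ Real.log K := Real.log_nonneg (by exact_mod_cast hK)
  have hb : ∀ p ∈ (Finset.univ : Finset (Fin S × Fin A)),
      ∑ j ∈ Finset.range (count (history M sel ω K) h p.1 p.2), 1 / ((j : ℝ) + 1) ≤
        1 + Real.log K := by
    intro p _
    set n := count (history M sel ω K) h p.1 p.2 with hn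
    have hnK : n ≤ K := by
      have := count_le_length (history M sel ω K) h p.1 p.2
      rwa [history_length] at this
    have h1 := harmonic_le_one_add_log n
    rw [harmonic] at h1
    push_cast at h1
    simp only [one_div]
    refine h1.trans ?_
    rcases Nat.eq_zero_or_pos n with h0 | h0
    · rw [h0]; simpa using hlog
    · have : Real.log n ≤ Real.log K :=
        Real.log_le_log (by exact_mod_cast h0) (by exact_mod_cast hnK)
      linarith
  refine (Finset.sum_le_sum hb).trans (le_of_eq ?_)
  simp only [Finset.sum_const, Finset.card_univ, Fintype.card_prod, Fintype.card_fin, nsmul_eq_mul]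
  push_cast
  ring

end Pigeonhole

end SSR

/-! ### Rescaled gaps and bonuses -/

namespace SSR

variable {H S A : ℕ} (M : TabularMDP H S A)
  (sel : ℕ → Fin H → Fin S → (Fin A → ℝ) → Fin A)

/-- One over the square root of the number of visits plus one. -/
noncomputable def invSqrtCount (D : List (Episode H S A)) (h : Fin H) (s : Fin S) (a : Fin A) : ℝ :=
  1 / √((count D h s a : ℝ) + 1)

/-- One over the number of visits plus one. -/
noncomputable def invCount (D : List (Episode H S A)) (h : Fin H) (s : Fin S) (a : Fin A) : ℝ :=
  1 / ((count D h s a : ℝ) + 1)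

theorem invSqrtCount_mem (D : List (Episode H S A)) (h : Fin H) (s : Fin S) (a : Fin A) :
    invSqrtCount D h s a ∈ Set.Icc (0 : ℝ) 1 := by
  have : (1 : ℝ) ≤ √((count D h s a : ℝ) + 1) :=
    Real.one_le_sqrt.2 (by linarith [Nat.cast_nonneg (α := ℝ) (count D h s a)])
  exact ⟨by unfold invSqrtCount; positivity, (div_le_one (by linarith)).2 this⟩

theorem invCount_mem (D : List (Episode H S A)) (h : Fin H) (s : Fin S) (a : Fin A) :
    invCount D h s a ∈ Set.Icc (0 : ℝ) 1 := by
  have : (1 : ℝ) ≤ (count D h s a : ℝ) + 1 := by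
    linarith [Nat.cast_nonneg (α := ℝ) (count D h s a)]
  exact ⟨by unfold invCount; positivity, (div_le_one (by linarith)).2 this⟩

theorem bonus_le {D : List (Episode H S A)} {L : ℝ} (β : ℝ)
    (hD : Real.log (2 * H * S * A * ((D.length : ℝ) + 1) ^ 2) ≤ 2 * L)
    (h : Fin H) (s : Fin S) (a : Fin A) :
    bonus D β h s a ≤ H * √(2 * L) * invSqrtCount D h s a + (H + H * S * β) * invCount D h s a := by
  set n : ℝ := (count D h s a : ℝ) + 1 with hn
  have hn0 : 0 < n := by positivity
  have h1 : √(Real.log (2 * H * S * A * ((D.length : ℝ) + 1) ^ 2) / n) ≤ √(2 * L) * (1 / √n) := by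
    rw [mul_one_div, ← Real.sqrt_div' _ hn0.le]
    exact Real.sqrt_le_sqrt (by gcongr)
  have h2 := mul_le_mul_of_nonneg_left h1 (Nat.cast_nonneg (α := ℝ) H)
  simp only [bonus, sigmaHo, invSqrtCount, invCount, ← hn]
  have h3 : (H + H * S * β) * (1 / n) = H / n + H * S * β / n := by ring
  rw [h3]
  linarith

/-- Per-episode regret divided by the horizon. -/
noncomputable def scaledGap (k : ℕ) (ω : Sample H S A) : ℝ :=
  (M.optValue 0 M.init - M.value (played M sel ω k) 0 M.init) / H

/-- Average of a data-dependent weight along the trajectory of episode `k`. -/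
noncomputable def pathMean (b : List (Episode H S A) → Fin H → Fin S → Fin A → ℝ) (k : ℕ)
    (ω : Sample H S A) : ℝ :=
  pathSum (b (history M sel ω k)) (episode M sel ω k) / H

theorem regret_eq (K : ℕ) (hH : 1 ≤ H) (ω : Sample H S A) :
    regret M sel K ω = H * ∑ k ∈ Finset.range K, scaledGap M sel k ω := by
  have : (H : ℝ) ≠ 0 := by positivity
  rw [regret, Finset.mul_sum]
  refine Finset.sum_congr rfl fun k _ => ?_
  simp only [scaledGap, played]
  field_simp

variable {sel}

theorem measurable_scaledGap (hsel : IsArgmaxRule sel) (k : ℕ) : Measurable (scaledGap M sel k) :=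
  ((measurable_of_countable fun π : Policy H S A =>
    (M.optValue 0 M.init - M.value π 0 M.init) / H).comp
    (measurable_pi_lambda _ fun h => measurable_pi_lambda _ fun s => measurable_played M hsel k h s))

theorem gap_mem [Nonempty (Fin A)] (π : Policy H S A) :
    M.optValue 0 M.init - M.value π 0 M.init ∈ Set.Icc (0 : ℝ) H := by
  have h1 := M.optValue_le (Nat.zero_le H) M.init
  have h2 := M.value_nonneg π 0 M.init
  have h3 := M.value_le_optValue π 0 M.init
  simp only [Nat.cast_zero, sub_zero] at h1
  exact ⟨by linarith, by linarith⟩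

theorem scaledGap_mem [Nonempty (Fin A)] (hH : 1 ≤ H) (k : ℕ) (ω : Sample H S A) :
    scaledGap M sel k ω ∈ Set.Icc (0 : ℝ) 1 := by
  have hH' : (0 : ℝ) < H := by exact_mod_cast hH
  have h := gap_mem M (played M sel ω k)
  exact ⟨div_nonneg h.1 hH'.le, (div_le_one hH').2 h.2⟩

theorem scaledGap_update_of_lt {i k : ℕ} (hik : i < k) (ω : Sample H S A) (x : ℝ × Draws H S A) :
    scaledGap M sel i (Function.update ω k x) = scaledGap M sel i ω := by
  simp only [scaledGap, played_update_of_lt M sel ω hik]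

theorem measurable_pathMean (hsel : IsArgmaxRule sel)
    {b : List (Episode H S A) → Fin H → Fin S → Fin A → ℝ} (k : ℕ)
    (hb : ∀ h s a, Measurable fun ω => b (history M sel ω k) h s a) :
    Measurable (pathMean M sel b k) :=
  (measurable_pathSum_rollout M (measurable_played M hsel k) (measurable_sample_draws k)
    hb).div_const _

theorem pathMean_mem (hH : 1 ≤ H) {b : List (Episode H S A) → Fin H → Fin S → Fin A → ℝ}
    (hb : ∀ D h s a, b D h s a ∈ Set.Icc (0 : ℝ) 1) (k : ℕ) (ω : Sample H S A) :
    pathMean M sel b k ω ∈ Set.Icc (0 : ℝ) 1 := by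
  have hH' : (0 : ℝ) < H := by exact_mod_cast hH
  refine ⟨div_nonneg (Finset.sum_nonneg fun h _ => (hb _ _ _ _).1) hH'.le, (div_le_one hH').2 ?_⟩
  refine (Finset.sum_le_sum fun h _ => (hb _ _ _ _).2).trans ?_
  simp

theorem pathMean_update_of_lt (b : List (Episode H S A) → Fin H → Fin S → Fin A → ℝ) {i k : ℕ}
    (hik : i < k) (ω : Sample H S A) (x : ℝ × Draws H S A) :
    pathMean M sel b i (Function.update ω k x) = pathMean M sel b i ω := by
  simp only [pathMean, history_update M sel ω hik.le, episode_update_of_lt M sel ω hik]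

theorem resampleMean_scaledGap (k : ℕ) (ω : Sample H S A) :
    resampleMean (episodeLaw M) k (scaledGap M sel k) ω =
      (∫ x, (M.optValue 0 M.init - M.value (policy sel (history M sel ω k) x.1) 0 M.init)
        ∂(episodeLaw M)) / H := by
  simp only [resampleMean, scaledGap, played_update_self, integral_div]

theorem resampleMean_pathMean (b : List (Episode H S A) → Fin H → Fin S → Fin A → ℝ) (k : ℕ)
    (ω : Sample H S A) :
    resampleMean (episodeLaw M) k (pathMean M sel b k) ω =
      (∫ x, pathSum (b (history M sel ω k))
        (M.rollout (policy sel (history M sel ω k) x.1) x.2) ∂(episodeLaw M)) / H := by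
  simp only [resampleMean, pathMean, history_update M sel ω le_rfl, episode_update_self,
    integral_div]

theorem integral_bonus_le (hsel : IsArgmaxRule sel) (hH : 1 ≤ H) {L : ℝ} (β : ℝ) (k : ℕ)
    (hk : Real.log (2 * H * S * A * ((k : ℝ) + 1) ^ 2) ≤ 2 * L) (ω : Sample H S A) :
    ∫ x, pathSum (bonus (history M sel ω k) β)
      (M.rollout (policy sel (history M sel ω k) x.1) x.2) ∂(episodeLaw M) ≤
      H * √(2 * L) * (H * resampleMean (episodeLaw M) k (pathMean M sel invSqrtCount k) ω) +
      (H + H * S * β) * (H * resampleMean (episodeLaw M) k (pathMean M sel invCount k) ω) := by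
  have hH' : (H : ℝ) ≠ 0 := by positivity
  rw [resampleMean_pathMean, resampleMean_pathMean, mul_div_cancel₀ _ hH', mul_div_cancel₀ _ hH']
  set D := history M sel ω k
  have i0 := integrable_pathSum (M := M) (D := D) hsel (bonus D β)
  have i1 := (integrable_pathSum (M := M) (D := D) hsel (invSqrtCount D)).const_mul (H * √(2 * L))
  have i2 := (integrable_pathSum (M := M) (D := D) hsel (invCount D)).const_mul (H + H * S * β)
  rw [← integral_const_mul, ← integral_const_mul, ← integral_add i1 i2]
  refine integral_mono i0 (i1.add i2) fun x => ?_
  simp only [pathSum, Finset.mul_sum, ← Finset.sum_add_distrib]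
  refine Finset.sum_le_sum fun h _ => bonus_le β ?_ _ _ _
  rwa [history_length]

theorem sum_pathMean_invSqrtCount_le (hH : 1 ≤ H) (K : ℕ) (ω : Sample H S A) :
    ∑ k ∈ Finset.range K, pathMean M sel invSqrtCount k ω ≤ 2 * √(S * A * K) := by
  have hH' : (0 : ℝ) < H := by exact_mod_cast hH
  simp only [pathMean, pathSum]
  rw [← Finset.sum_div, div_le_iff₀ hH', Finset.sum_comm]
  refine (Finset.sum_le_sum fun h _ => sum_visited_inv_sqrt_le M sel ω K h).trans ?_
  simp [mul_comm]

theorem sum_pathMean_invCount_le (hH : 1 ≤ H) {K : ℕ} (hK : 1 ≤ K) (ω : Sample H S A) :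
    ∑ k ∈ Finset.range K, pathMean M sel invCount k ω ≤ S * A * (1 + Real.log K) := by
  have hH' : (0 : ℝ) < H := by exact_mod_cast hH
  simp only [pathMean, pathSum]
  rw [← Finset.sum_div, div_le_iff₀ hH', Finset.sum_comm]
  refine (Finset.sum_le_sum fun h _ => sum_visited_inv_le M sel ω hK h).trans ?_
  simp [mul_comm]

/-- Counts the burn-in episodes, whose number is at most the threshold. -/
theorem sum_indicator_lt_le (K : ℕ) {y : ℝ} (hy : 0 ≤ y) :
    ∑ k ∈ Finset.range K, (if (k : ℝ) + 1 < y then (1 : ℝ) else 0) ≤ y := by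
  rw [Finset.sum_boole]
  have hsub : (Finset.range K).filter (fun k : ℕ => (k : ℝ) + 1 < y) ⊆ Finset.range ⌊y⌋₊ := by
    intro k hk
    have := (Finset.mem_filter.1 hk).2
    refine Finset.mem_range.2 (Nat.lt_of_succ_le (Nat.le_floor ?_))
    push_cast
    exact this.le
  have h1 : (((Finset.range K).filter (fun k : ℕ => (k : ℝ) + 1 < y)).card : ℝ) ≤ (⌊y⌋₊ : ℝ) := by
    have := Finset.card_le_card hsub
    rw [Finset.card_range] at this
    exact_mod_cast this
  exact h1.trans (Nat.floor_le hy)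

/-- Turns confidence `L` into the logarithm present in the noise: `2H√(4L/n)` becomes `4√c` times
the main part of `sigmaHo`, and the bias `H/n` costs one more multiple. -/
theorem backupAccurate_of_concentrated {D : List (Episode H S A)} {L c : ℝ} (hc : 0 ≤ c)
    (hD : BackupConcentrated M D (4 * L))
    (hL : L ≤ c * Real.log (2 * H * S * A * ((D.length : ℝ) + 1) ^ 2)) :
    BackupAccurate D M (4 * √c + 1) := by
  intro h s a
  refine (hD h s a).trans ?_
  set n : ℝ := (count D h s a : ℝ) + 1 with hn
  have hn0 : 0 < n := by positivity
  set l := Real.log (2 * H * S * A * ((D.length : ℝ) + 1) ^ 2) with hl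
  have h1 : √(4 * L / n) ≤ 2 * √c * √(l / n) := by
    have h4 : (2 : ℝ) = √4 := by
      rw [show (4 : ℝ) = 2 ^ 2 by norm_num, Real.sqrt_sq (by norm_num)]
    rw [h4, ← Real.sqrt_mul (by norm_num), ← Real.sqrt_mul (by positivity)]
    refine Real.sqrt_le_sqrt ?_
    rw [mul_div_assoc', mul_assoc]
    gcongr
  have hH0 : (0 : ℝ) ≤ H := Nat.cast_nonneg _
  have h2 := mul_le_mul_of_nonneg_left h1 hH0
  have h3 : 0 ≤ H * √(l / n) := by positivity
  have h5 : 0 ≤ 4 * √c * (H / n) := by positivity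
  simp only [sigmaHo, ← hn, ← hl]
  nlinarith

end SSR

/-! ### Comparison of logarithms -/

namespace SSR

section Logarithms

variable {h s a k δ : ℝ}

theorem log_confidence_ge_half (hh : 1 ≤ h) (hs : 1 ≤ s) (ha : 1 ≤ a) (hk : 1 ≤ k) (hδ : 0 < δ)
    (hδ1 : δ ≤ 1) : 1 / 2 ≤ Real.log (2 * h * s * a * (h * k) / δ) := by
  have h1 : 1 ≤ h * s * a * (h * k) / δ := by
    rw [le_div_iff₀ hδ, one_mul]
    refine hδ1.trans ?_
    have := mul_le_mul (one_le_mul_of_one_le_of_one_le (one_le_mul_of_one_le_of_one_le hh hs) ha)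
      (one_le_mul_of_one_le_of_one_le hh hk) zero_le_one (by positivity)
    linarith
  have h2 : 2 * h * s * a * (h * k) / δ = 2 * (h * s * a * (h * k) / δ) := by ring
  rw [h2]
  have := Real.log_le_log (by norm_num : (0 : ℝ) < 2)
    (show 2 ≤ 2 * (h * s * a * (h * k) / δ) by linarith)
  linarith [Real.log_two_gt_d9]

theorem exp_neg_log_confidence (hh : 1 ≤ h) (hs : 1 ≤ s) (ha : 1 ≤ a) (hk : 1 ≤ k) (hδ : 0 < δ) :
    Real.exp (-Real.log (2 * h * s * a * (h * k) / δ)) = δ / (2 * h * s * a * (h * k)) := by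
  rw [Real.exp_neg, Real.exp_log (by positivity), inv_div]

theorem exp_neg_log_confidence_le (hh : 1 ≤ h) (hs : 1 ≤ s) (ha : 1 ≤ a) (hk : 1 ≤ k) (hδ : 0 < δ) :
    Real.exp (-Real.log (2 * h * s * a * (h * k) / δ)) ≤ δ / (2 * (h * s * a * k)) := by
  rw [exp_neg_log_confidence hh hs ha hk hδ]
  refine div_le_div_of_nonneg_left hδ.le (by positivity) ?_
  have : 2 * (h * s * a * k) * 1 ≤ 2 * (h * s * a * k) * h :=
    mul_le_mul_of_nonneg_left hh (by positivity)
  linarith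

/-- Level `4L` yields the fourth power of `δ / (2n)`, with `n = HSAK`, which outweighs the prefactor
of order `n²` from the two union bounds; the 3 counts the remaining tail events. -/
theorem failure_probability_le (hh : 1 ≤ h) (hs : 1 ≤ s) (ha : 1 ≤ a) (hk : 1 ≤ k) (hδ : 0 < δ)
    (hδ1 : δ ≤ 1) :
    (2 * k ^ 2 * h * s * a + 2 * k * h * s ^ 2 * a + 3) *
      Real.exp (-(4 * Real.log (2 * h * s * a * (h * k) / δ))) ≤ δ := by
  set n := h * s * a * k with hn
  have hn1 : 1 ≤ n := one_le_mul_of_one_le_of_one_le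
    (one_le_mul_of_one_le_of_one_le (one_le_mul_of_one_le_of_one_le hh hs) ha) hk
  have he : Real.exp (-(4 * Real.log (2 * h * s * a * (h * k) / δ))) ≤ δ / (16 * n ^ 4) := by
    have h1 : -(4 * Real.log (2 * h * s * a * (h * k) / δ)) =
        ((4 : ℕ) : ℝ) * (-Real.log (2 * h * s * a * (h * k) / δ)) := by push_cast; ring
    rw [h1, Real.exp_nat_mul]
    refine (pow_le_pow_left₀ (Real.exp_pos _).le
      (exp_neg_log_confidence_le hh hs ha hk hδ) 4).trans ?_
    rw [← hn, div_pow, mul_pow]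
    have : δ ^ 4 ≤ δ := pow_le_of_le_one hδ.le hδ1 (by norm_num)
    norm_num
    gcongr
  have hhsa : 1 ≤ h * s * a :=
    one_le_mul_of_one_le_of_one_le (one_le_mul_of_one_le_of_one_le hh hs) ha
  have hhak : 1 ≤ h * a * k :=
    one_le_mul_of_one_le_of_one_le (one_le_mul_of_one_le_of_one_le hh ha) hk
  have e1 : k ^ 2 * h * s * a ≤ n ^ 2 := by
    have : n ^ 2 = (k ^ 2 * h * s * a) * (h * s * a) := by rw [hn]; ring
    rw [this]
    exact le_mul_of_one_le_right (by positivity) hhsa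
  have e2 : k * h * s ^ 2 * a ≤ n ^ 2 := by
    have : n ^ 2 = (k * h * s ^ 2 * a) * (h * a * k) := by rw [hn]; ring
    rw [this]
    exact le_mul_of_one_le_right (by positivity) hhak
  have e3 : n ^ 2 ≤ n ^ 4 := pow_le_pow_right₀ hn1 (by norm_num)
  have e4 : 1 ≤ n ^ 4 := one_le_pow₀ hn1
  calc _ ≤ (16 * n ^ 4) * (δ / (16 * n ^ 4)) := by
        refine mul_le_mul (by linarith) he (Real.exp_pos _).le (by positivity)
    _ = δ := by field_simp

theorem log_noise_le (hh : 1 ≤ h) (hs : 1 ≤ s) (ha : 1 ≤ a) (hδ : 0 < δ)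
    (hδ1 : δ ≤ 1) {i : ℝ} (hi : 1 ≤ i) (hik : i ≤ k) :
    Real.log (2 * h * s * a * i ^ 2) ≤ 2 * Real.log (2 * h * s * a * (h * k) / δ) := by
  have hk : 1 ≤ k := hi.trans hik
  have h2 : (2 : ℝ) * Real.log (2 * h * s * a * (h * k) / δ) =
      Real.log ((2 * h * s * a * (h * k) / δ) ^ 2) := by
    rw [Real.log_pow]; norm_num
  rw [h2]
  refine Real.log_le_log (by positivity) ?_
  have h3 : 2 * h * s * a * (h * k) ≤ 2 * h * s * a * (h * k) / δ :=
    le_div_self (by positivity) hδ hδ1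
  refine le_trans ?_ (pow_le_pow_left₀ (by positivity) h3 2)
  have h4 : i ^ 2 ≤ k ^ 2 := pow_le_pow_left₀ (by linarith) hik 2
  have h5 : 1 ≤ 2 * (h * s * a) * h ^ 2 := by
    have e1 : 1 ≤ h * s * a :=
      one_le_mul_of_one_le_of_one_le (one_le_mul_of_one_le_of_one_le hh hs) ha
    have e2 : 1 ≤ h ^ 2 := one_le_pow₀ hh
    have := one_le_mul_of_one_le_of_one_le e1 e2
    linarith
  calc 2 * h * s * a * i ^ 2 ≤ 2 * h * s * a * k ^ 2 * 1 := by rw [mul_one]; gcongr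
    _ ≤ 2 * h * s * a * k ^ 2 * (2 * (h * s * a) * h ^ 2) := by gcongr
    _ = _ := by ring

/-- Here `i` is an episode number and `k` the total. The bound `√k ≤ i` puts `k` below `i²`, and
`δ^(-ε) ≤ i` gives `log (1/δ) ≤ log i / ε`; these are the two parts of `2 + 1/ε`. -/
theorem log_confidence_le (hh : 1 ≤ h) (hs : 1 ≤ s) (ha : 1 ≤ a) (hk : 1 ≤ k) (hδ : 0 < δ)
    {ε : ℝ} (hε : 0 < ε) {i : ℝ} (hi : 1 ≤ i) (hik : √k ≤ i) (hiδ : δ ^ (-ε) ≤ i) :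
    Real.log (2 * h * s * a * (h * k) / δ) ≤
      (2 + 1 / ε) * Real.log (2 * h * s * a * i ^ 2) := by
  set x := 2 * h * s * a * i ^ 2 with hx
  have hki : k ≤ i ^ 2 := by
    rw [← Real.sq_sqrt (by linarith : 0 ≤ k)]
    exact pow_le_pow_left₀ (Real.sqrt_nonneg _) hik 2
  have hsa : 1 ≤ s * a := one_le_mul_of_one_le_of_one_le hs ha
  have hi2 : 1 ≤ i ^ 2 := one_le_pow₀ hi
  have hx0 : 0 < x := by positivity
  have hhx : h ≤ x := by
    have : x = h * (2 * ((s * a) * i ^ 2)) := by rw [hx]; ring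
    rw [this]
    refine le_mul_of_one_le_right (by linarith) ?_
    linarith [one_le_mul_of_one_le_of_one_le hsa hi2]
  have hix : i ≤ x := by
    have : x = i * (2 * ((h * (s * a)) * i)) := by rw [hx]; ring
    rw [this]
    refine le_mul_of_one_le_right (by linarith) ?_
    linarith [one_le_mul_of_one_le_of_one_le (one_le_mul_of_one_le_of_one_le hh hsa) hi]
  have h1 : Real.log (2 * h * s * a * (h * k)) ≤ 2 * Real.log x := by
    have : (2 : ℝ) * Real.log x = Real.log (x ^ 2) := by rw [Real.log_pow]; norm_num
    rw [this]
    refine Real.log_le_log (by positivity) ?_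
    calc 2 * h * s * a * (h * k) = (2 * h * s * a * k) * h := by ring
      _ ≤ x * x := by
        refine mul_le_mul ?_ hhx (by linarith) hx0.le
        rw [hx]; gcongr
      _ = x ^ 2 := by ring
  have h2 : ε * -Real.log δ ≤ Real.log x := by
    have h3 := Real.log_le_log (Real.rpow_pos_of_pos hδ _) hiδ
    rw [Real.log_rpow hδ] at h3
    have h4 := Real.log_le_log (by linarith) hix
    linarith
  rw [Real.log_div (by positivity) hδ.ne', add_mul]
  have h5 : -Real.log δ ≤ 1 / ε * Real.log x := by
    rw [one_div, ← div_eq_inv_mul, le_div_iff₀ hε]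
    linarith
  linarith

end Logarithms

/-! ### The concentration event and the regret on it -/

variable {H S A : ℕ} (M : TabularMDP H S A)
  (sel : ℕ → Fin H → Fin S → (Fin A → ℝ) → Fin A)

/-- All the concentration statements that the regret bound uses hold at confidence level `L`. -/
structure Concentrated (K : ℕ) (L : ℝ) (ω : Sample H S A) : Prop where
  backup : ∀ k < K, BackupConcentrated M (history M sel ω k) (4 * L)
  trans : ∀ k < K,
    TransAccurate (history M sel ω k) M (1 / (8 * (H : ℝ))) (8 * H * (4 * L) + 1)
  gap : ∑ k ∈ Finset.range K, scaledGap M sel k ω ≤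
    2 * ∑ k ∈ Finset.range K, resampleMean (episodeLaw M) k (scaledGap M sel k) ω + 4 * L
  invSqrt : ∑ k ∈ Finset.range K, resampleMean (episodeLaw M) k (pathMean M sel invSqrtCount k) ω ≤
    2 * ∑ k ∈ Finset.range K, pathMean M sel invSqrtCount k ω + 2 * (4 * L)
  inv : ∑ k ∈ Finset.range K, resampleMean (episodeLaw M) k (pathMean M sel invCount k) ω ≤
    2 * ∑ k ∈ Finset.range K, pathMean M sel invCount k ω + 2 * (4 * L)

variable {sel}

theorem measurable_invSqrtCount (hsel : IsArgmaxRule sel) (k : ℕ) (h : Fin H) (s : Fin S)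
    (a : Fin A) : Measurable fun ω => invSqrtCount (history M sel ω k) h s a := by
  have := (measurableData_history M hsel k).count h s a
  unfold invSqrtCount
  fun_prop

theorem measurable_invCount (hsel : IsArgmaxRule sel) (k : ℕ) (h : Fin H) (s : Fin S)
    (a : Fin A) : Measurable fun ω => invCount (history M sel ω k) h s a := by
  have := (measurableData_history M hsel k).count h s a
  unfold invCount
  fun_prop

theorem measure_not_concentrated_le [Nonempty (Fin A)] (hsel : IsArgmaxRule sel) (hH : 1 ≤ H)
    (K : ℕ) {L : ℝ} (hL : 0 < L) :
    sampleLaw M {ω | ¬ Concentrated M sel K L ω} ≤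
      ENNReal.ofReal ((2 * K ^ 2 * H * S * A + 2 * K * H * S ^ 2 * A + 3) *
        Real.exp (-(4 * L))) := by
  have hsub : {ω | ¬ Concentrated M sel K L ω} ⊆
      {ω | ¬ ∀ k < K, BackupConcentrated M (history M sel ω k) (4 * L)} ∪
      ({ω | ¬ ∀ k < K,
        TransAccurate (history M sel ω k) M (1 / (8 * (H : ℝ))) (8 * H * (4 * L) + 1)} ∪
      ({ω | 2 * ∑ k ∈ Finset.range K, resampleMean (episodeLaw M) k (scaledGap M sel k) ω + 4 * L <
          ∑ k ∈ Finset.range K, scaledGap M sel k ω} ∪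
      ({ω | 2 * ∑ k ∈ Finset.range K, pathMean M sel invSqrtCount k ω + 2 * (4 * L) <
          ∑ k ∈ Finset.range K, resampleMean (episodeLaw M) k (pathMean M sel invSqrtCount k) ω} ∪
      {ω | 2 * ∑ k ∈ Finset.range K, pathMean M sel invCount k ω + 2 * (4 * L) <
          ∑ k ∈ Finset.range K, resampleMean (episodeLaw M) k (pathMean M sel invCount k) ω}))) := by
    intro ω hω
    by_contra hno
    simp only [Set.mem_union, Set.mem_ofPred_eq, not_or, not_not, not_lt] at hno
    exact hω ⟨hno.1, hno.2.1, hno.2.2.1, hno.2.2.2.1, hno.2.2.2.2⟩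
  have e1 := measure_not_backupConcentrated_le M hsel K (L := 4 * L) (by linarith)
  have e2 := measure_not_transAccurate_le M hsel K (L := 4 * L)
  have e3 := measure_sum_gt_resampleMean_le (episodeLaw M) (measurable_scaledGap M hsel)
    (fun i ω k x hik => scaledGap_update_of_lt M hik ω x) (scaledGap_mem M hH) K (4 * L)
  have e4 := measure_resampleMean_gt_le (episodeLaw M)
    (fun k => measurable_pathMean M hsel k (measurable_invSqrtCount M hsel k))
    (fun i ω k x hik => pathMean_update_of_lt M invSqrtCount hik ω x)
    (pathMean_mem M hH invSqrtCount_mem) K (4 * L)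
  have e5 := measure_resampleMean_gt_le (episodeLaw M)
    (fun k => measurable_pathMean M hsel k (measurable_invCount M hsel k))
    (fun i ω k x hik => pathMean_update_of_lt M invCount hik ω x)
    (pathMean_mem M hH invCount_mem) K (4 * L)
  rw [← sampleLaw_eq] at e3 e4 e5
  refine (measure_mono hsub).trans ?_
  refine (measure_union_le _ _).trans ((add_le_add e1 <| (measure_union_le _ _).trans <|
    add_le_add e2 <| (measure_union_le _ _).trans <| add_le_add e3 <|
    (measure_union_le _ _).trans <| add_le_add e4 e5).trans (le_of_eq ?_))
  rw [← ENNReal.ofReal_add (by positivity) (by positivity),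
    ← ENNReal.ofReal_add (by positivity) (by positivity),
    ← ENNReal.ofReal_add (by positivity) (by positivity),
    ← ENNReal.ofReal_add (by positivity) (by positivity)]
  congr 1
  ring

/-- The multiplicative constant of the regret bound. -/
noncomputable def regretConst (ε : ℝ) : ℝ :=
  8 * (2 * (4 * √(2 + 1 / ε) + 1) + 11) /
    (gaussianReal 0 1).real (Set.Icc (4 * √(2 + 1 / ε) + 1) (4 * √(2 + 1 / ε) + 1 + 1))

theorem regretConst_pos (ε : ℝ) : 0 < regretConst ε :=
  div_pos (by positivity) (gaussianReal_Icc_pos _)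

/-- On the concentration event, the conditional regret of an episode whose index is large enough
is bounded by the conditional bonuses. -/
theorem resampleMean_scaledGap_le [Nonempty (Fin A)] (hsel : IsArgmaxRule sel) (hH : 1 ≤ H)
    (hS : 1 ≤ S) (hA : 1 ≤ A) {K : ℕ} {δ ε L : ℝ} (hδ : 0 < δ) (hδ1 : δ ≤ 1) (hε : 0 < ε)
    (hL : L = Real.log (2 * H * S * A * (H * K) / δ)) {ω : Sample H S A}
    (hω : Concentrated M sel K L ω) {k : ℕ} (hk : k < K) (hkK : √K ≤ (k : ℝ) + 1)
    (hkδ : δ ^ (-ε) ≤ (k : ℝ) + 1) :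
    H * resampleMean (episodeLaw M) k (scaledGap M sel k) ω ≤ 4 * H / K +
      regretConst ε * L *
        (2 * H ^ 2 * L * resampleMean (episodeLaw M) k (pathMean M sel invSqrtCount k) ω +
          36 * H ^ 3 * S * L * resampleMean (episodeLaw M) k (pathMean M sel invCount k) ω) := by
  have hH' : (1 : ℝ) ≤ H := by exact_mod_cast hH
  have hS' : (1 : ℝ) ≤ S := by exact_mod_cast hS
  have hA' : (1 : ℝ) ≤ A := by exact_mod_cast hA
  have hkK' : (k : ℝ) + 1 ≤ K := by exact_mod_cast hk
  have hk1 : (1 : ℝ) ≤ (k : ℝ) + 1 := by linarith [Nat.cast_nonneg (α := ℝ) k]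
  have hK' : (1 : ℝ) ≤ K := hk1.trans hkK'
  have hLhalf : 1 / 2 ≤ L := hL ▸ log_confidence_ge_half hH' hS' hA' hK' hδ hδ1
  have hnoise : Real.log (2 * H * S * A * ((k : ℝ) + 1) ^ 2) ≤ 2 * L :=
    hL ▸ log_noise_le hH' hS' hA' hδ hδ1 hk1 hkK'
  set c := 2 + 1 / ε with hc
  have hc0 : 0 ≤ c := by positivity
  set B := 4 * √c + 1 with hB
  have hacc : BackupAccurate (history M sel ω k) M B := by
    refine backupAccurate_of_concentrated M hc0 (hω.backup k hk) ?_
    rw [history_length, hL]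
    exact log_confidence_le hH' hS' hA' hK' hδ hε hk1 hkK hkδ
  have hβ : 0 ≤ 8 * (H : ℝ) * (4 * L) + 1 := by positivity
  have hmain := integral_gap_le hsel hacc (by positivity) (hω.trans k hk) hβ hH
    (Z := L) (by linarith)
  have hbon := integral_bonus_le M hsel hH (8 * (H : ℝ) * (4 * L) + 1) k hnoise ω
  rw [resampleMean_scaledGap, mul_div_cancel₀ _ (by positivity : (H : ℝ) ≠ 0)]
  set pB := (gaussianReal 0 1).real (Set.Icc B (B + 1)) with hpB
  have hpB0 : 0 < pB := gaussianReal_Icc_pos B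
  set e1 := resampleMean (episodeLaw M) k (pathMean M sel invSqrtCount k) ω with he1
  set e2 := resampleMean (episodeLaw M) k (pathMean M sel invCount k) ω with he2
  have he10 : 0 ≤ e1 := integral_nonneg fun x => (pathMean_mem M hH invSqrtCount_mem _ _).1
  have he20 : 0 ≤ e2 := integral_nonneg fun x => (pathMean_mem M hH invCount_mem _ _).1
  have hsq : √(2 * L) ≤ 2 * L := by
    refine Real.sqrt_le_iff.2 ⟨by linarith, ?_⟩
    nlinarith
  -- Because `L ≥ 1/2`, one has `B + 5 + L ≤ (2B + 11) L`.
  have hconst : 8 * (B + 5 + L) / pB ≤ regretConst ε * L := by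
    have : regretConst ε = 8 * (2 * B + 11) / pB := rfl
    rw [this, div_mul_eq_mul_div]
    have : 0 ≤ B := by positivity
    refine div_le_div_of_nonneg_right ?_ hpB0.le
    nlinarith
  have hβle : (H : ℝ) + H * S * (8 * H * (4 * L) + 1) ≤ 36 * H ^ 2 * S * L := by
    have q1 : (H : ℝ) ≤ H ^ 2 * S * (2 * L) := by
      have : (1 : ℝ) ≤ H * S * (2 * L) :=
        one_le_mul_of_one_le_of_one_le (one_le_mul_of_one_le_of_one_le hH' hS') (by linarith)
      calc (H : ℝ) = H * 1 := by ring
        _ ≤ H * (H * S * (2 * L)) := by gcongr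
        _ = _ := by ring
    have q2 : (H : ℝ) * S ≤ H ^ 2 * S * (2 * L) := by
      have : (1 : ℝ) ≤ H * (2 * L) := one_le_mul_of_one_le_of_one_le hH' (by linarith)
      calc (H : ℝ) * S = H * S * 1 := by ring
        _ ≤ H * S * (H * (2 * L)) := by gcongr
        _ = _ := by ring
    nlinarith
  -- Truncating the seed at `L` thus costs `4H/K` per episode, hence `4H` in total.
  have htail : Real.exp (-L) ≤ 1 / K := by
    rw [hL]
    refine (exp_neg_log_confidence_le hH' hS' hA' hK' hδ).trans ?_
    refine div_le_div₀ zero_le_one hδ1 (by linarith) ?_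
    have : (1 : ℝ) ≤ H * S * A :=
      one_le_mul_of_one_le_of_one_le (one_le_mul_of_one_le_of_one_le hH' hS') hA'
    nlinarith
  have hbon2 : H * √(2 * L) * (H * e1) + (H + H * S * (8 * H * (4 * L) + 1)) * (H * e2) ≤
      2 * H ^ 2 * L * e1 + 36 * H ^ 3 * S * L * e2 := by
    have r1 : H * √(2 * L) * (H * e1) ≤ H * (2 * L) * (H * e1) := by gcongr
    have r2 : (H + H * S * (8 * H * (4 * L) + 1)) * (H * e2) ≤ 36 * H ^ 2 * S * L * (H * e2) := by
      gcongr
    linarith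
  refine hmain.trans (add_le_add ?_ ?_)
  · have := mul_le_mul_of_nonneg_left htail (by positivity : (0 : ℝ) ≤ H * 4)
    calc (H : ℝ) * (4 * Real.exp (-L)) = H * 4 * Real.exp (-L) := by ring
      _ ≤ H * 4 * (1 / K) := this
      _ = _ := by ring
  · refine mul_le_mul hconst (hbon.trans hbon2) ?_ ?_
    · exact integral_nonneg fun x => Finset.sum_nonneg fun h _ => bonus_nonneg hβ _ _ _
    · exact mul_nonneg (regretConst_pos ε).le (by linarith)

theorem regret_le_of_concentrated [Nonempty (Fin A)] (hsel : IsArgmaxRule sel) (hH : 1 ≤ H)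
    (hS : 1 ≤ S) (hA : 1 ≤ A) {K : ℕ} (hK : 1 ≤ K) {δ ε L : ℝ} (hδ : 0 < δ) (hδ1 : δ ≤ 1)
    (hε : 0 < ε) (hL : L = Real.log (2 * H * S * A * (H * K) / δ)) {ω : Sample H S A}
    (hω : Concentrated M sel K L ω) :
    regret M sel K ω ≤ (1040 * regretConst ε + 96) * L ^ 3 *
      (H ^ 2 * √(S * A * K) + H ^ 4 * S ^ 2 * A) + 2 * H * δ ^ (-ε) := by
  have hH' : (1 : ℝ) ≤ H := by exact_mod_cast hH
  have hS' : (1 : ℝ) ≤ S := by exact_mod_cast hS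
  have hA' : (1 : ℝ) ≤ A := by exact_mod_cast hA
  have hK' : (1 : ℝ) ≤ K := by exact_mod_cast hK
  have hLhalf : 1 / 2 ≤ L := hL ▸ log_confidence_ge_half hH' hS' hA' hK' hδ hδ1
  have hδε : 0 ≤ δ ^ (-ε) := Real.rpow_nonneg hδ.le _
  set C := regretConst ε with hC
  have hC0 : 0 < C := regretConst_pos ε
  set E1 := ∑ k ∈ Finset.range K, resampleMean (episodeLaw M) k (pathMean M sel invSqrtCount k) ω
  set E2 := ∑ k ∈ Finset.range K, resampleMean (episodeLaw M) k (pathMean M sel invCount k) ω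
  set X := √((S : ℝ) * A * K) with hX
  have hX0 : 0 ≤ X := Real.sqrt_nonneg _
  have hlogK : Real.log K ≤ L := by
    rw [hL]
    refine Real.log_le_log (by linarith) ?_
    have h1 : (1 : ℝ) ≤ 2 * H * S * A * H := by
      have := one_le_mul_of_one_le_of_one_le (one_le_mul_of_one_le_of_one_le
        (one_le_mul_of_one_le_of_one_le hH' hS') hA') hH'
      linarith
    calc (K : ℝ) = 1 * K := by ring
      _ ≤ 2 * H * S * A * H * K := by gcongr
      _ = 2 * H * S * A * (H * K) := by ring
      _ ≤ _ := le_div_self (by positivity) hδ hδ1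
  have hE1 : E1 ≤ 4 * X + 8 * L := by
    have := sum_pathMean_invSqrtCount_le M hH K ω (sel := sel)
    linarith [hω.invSqrt]
  have hE2 : E2 ≤ 6 * (S * A * L) + 8 * L := by
    have h1 := sum_pathMean_invCount_le M hH hK ω (sel := sel)
    have h2 : (S : ℝ) * A * (1 + Real.log K) ≤ S * A * (3 * L) := by
      gcongr; linarith
    linarith [hω.inv]
  have hsum : ∑ k ∈ Finset.range K, H * resampleMean (episodeLaw M) k (scaledGap M sel k) ω ≤
      H * (√K + δ ^ (-ε)) + 4 * H +
        C * L * (2 * H ^ 2 * L * E1 + 36 * H ^ 3 * S * L * E2) := by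
    -- The indicators mark the burn-in episodes, each charged `H`. In total they cost `H√K`, which
    -- is below the leading term, and `H δ^(-ε)`, which stays in the bound.
    have hterm : ∀ k ∈ Finset.range K,
        H * resampleMean (episodeLaw M) k (scaledGap M sel k) ω ≤
        H * ((if (k : ℝ) + 1 < √K then (1 : ℝ) else 0) +
          if (k : ℝ) + 1 < δ ^ (-ε) then (1 : ℝ) else 0) + (4 * H / K + C * L *
        (2 * H ^ 2 * L * resampleMean (episodeLaw M) k (pathMean M sel invSqrtCount k) ω +
          36 * H ^ 3 * S * L * resampleMean (episodeLaw M) k (pathMean M sel invCount k) ω)) := by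
      intro k hk
      have he10 : 0 ≤ resampleMean (episodeLaw M) k (pathMean M sel invSqrtCount k) ω :=
        integral_nonneg fun x => (pathMean_mem M hH invSqrtCount_mem _ _).1
      have he20 : 0 ≤ resampleMean (episodeLaw M) k (pathMean M sel invCount k) ω :=
        integral_nonneg fun x => (pathMean_mem M hH invCount_mem _ _).1
      have hr1 : resampleMean (episodeLaw M) k (scaledGap M sel k) ω ≤ 1 := by
        have := integral_mono_of_nonneg (μ := episodeLaw M)
          (ae_of_all _ fun x => (scaledGap_mem M hH k (Function.update ω k x)).1)
          (integrable_const (1 : ℝ))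
          (ae_of_all _ fun x => (scaledGap_mem M (sel := sel) hH k (Function.update ω k x)).2)
        simpa [resampleMean] using this
      have hnn : 0 ≤ 4 * H / K + C * L *
        (2 * H ^ 2 * L * resampleMean (episodeLaw M) k (pathMean M sel invSqrtCount k) ω +
          36 * H ^ 3 * S * L * resampleMean (episodeLaw M) k (pathMean M sel invCount k) ω) := by
        positivity
      by_cases h1 : (k : ℝ) + 1 < √K
      · rw [if_pos h1]
        have : (1 : ℝ) ≤ 1 + if (k : ℝ) + 1 < δ ^ (-ε) then (1 : ℝ) else 0 := by
          split_ifs <;> norm_num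
        nlinarith
      · by_cases h2 : (k : ℝ) + 1 < δ ^ (-ε)
        · rw [if_neg h1, if_pos h2]
          nlinarith
        · rw [if_neg h1, if_neg h2, add_zero, mul_zero, zero_add]
          exact resampleMean_scaledGap_le M hsel hH hS hA hδ hδ1 hε hL hω (Finset.mem_range.1 hk)
            (not_lt.1 h1) (not_lt.1 h2)
    refine (Finset.sum_le_sum hterm).trans ?_
    rw [Finset.sum_add_distrib, Finset.sum_add_distrib, ← Finset.mul_sum, ← Finset.mul_sum,
      Finset.sum_add_distrib, Finset.sum_add_distrib, ← Finset.mul_sum, ← Finset.mul_sum]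
    have s1 := sum_indicator_lt_le K (Real.sqrt_nonneg (K : ℝ))
    have s2 := sum_indicator_lt_le K hδε
    have s3 : ∑ _k ∈ Finset.range K, 4 * (H : ℝ) / K = 4 * H := by
      rw [Finset.sum_const, Finset.card_range, nsmul_eq_mul]
      field_simp
    rw [s3]
    have := mul_le_mul_of_nonneg_left (add_le_add s1 s2) (by linarith : (0 : ℝ) ≤ H)
    linarith
  have hreg : regret M sel K ω ≤ 2 * (H * (√K + δ ^ (-ε)) + 4 * H +
      C * L * (2 * H ^ 2 * L * E1 + 36 * H ^ 3 * S * L * E2)) + 4 * H * L := by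
    rw [regret_eq M sel K hH]
    rw [← Finset.mul_sum] at hsum
    have := mul_le_mul_of_nonneg_left hω.gap (by linarith : (0 : ℝ) ≤ H)
    linarith
  set W := (H : ℝ) ^ 4 * S ^ 2 * A with hW
  set Y := (H : ℝ) ^ 2 * X with hY
  have hY0 : 0 ≤ Y := by positivity
  have hW0 : 0 ≤ W := by positivity
  have hL3 : 1 ≤ 8 * L ^ 3 := by
    have := one_le_pow₀ (n := 3) (by linarith : (1 : ℝ) ≤ 2 * L)
    linarith [mul_pow 2 L 3]
  have hL13 : L ≤ 4 * L ^ 3 := by nlinarith [mul_self_nonneg L]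
  have hL23 : L ^ 2 ≤ 2 * L ^ 3 := by nlinarith [mul_self_nonneg L]
  have hHW : (H : ℝ) ≤ W := by
    have h1 : (1 : ℝ) ≤ H ^ 3 * S ^ 2 * A := one_le_mul_of_one_le_of_one_le
      (one_le_mul_of_one_le_of_one_le (one_le_pow₀ hH') (one_le_pow₀ hS')) hA'
    calc (H : ℝ) = H * 1 := by ring
      _ ≤ H * (H ^ 3 * S ^ 2 * A) := by gcongr
      _ = W := by rw [hW]; ring
  have hH2W : (H : ℝ) ^ 2 ≤ W := by
    have h1 : (1 : ℝ) ≤ H ^ 2 * S ^ 2 * A := one_le_mul_of_one_le_of_one_le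
      (one_le_mul_of_one_le_of_one_le (one_le_pow₀ hH') (one_le_pow₀ hS')) hA'
    calc (H : ℝ) ^ 2 = (H : ℝ) ^ 2 * 1 := by ring
      _ ≤ (H : ℝ) ^ 2 * ((H : ℝ) ^ 2 * S ^ 2 * A) := by gcongr
      _ = W := by rw [hW]; ring
  -- The argument produces `H³S²A` here; the further factor `H` in `W` is slack.
  have hH3W : (H : ℝ) ^ 3 * S * (S * A) ≤ W := by
    calc (H : ℝ) ^ 3 * S * (S * A) = (H : ℝ) ^ 3 * S ^ 2 * A * 1 := by ring
      _ ≤ (H : ℝ) ^ 3 * S ^ 2 * A * H := by gcongr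
      _ = W := by rw [hW]; ring
  have hH3W' : (H : ℝ) ^ 3 * S ≤ W := by
    refine le_trans (le_mul_of_one_le_right (by positivity) ?_) hH3W
    exact one_le_mul_of_one_le_of_one_le hS' hA'
  have hKY : H * √K ≤ Y := by
    have h1 : √(K : ℝ) ≤ X := by
      refine Real.sqrt_le_sqrt ?_
      exact le_mul_of_one_le_left (by linarith) (one_le_mul_of_one_le_of_one_le hS' hA')
    calc H * √K ≤ H ^ 2 * X := by
          refine mul_le_mul (le_self_pow₀ hH' (by norm_num)) h1 (Real.sqrt_nonneg _) (by positivity)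
      _ = Y := rfl
  have hT1 : L * (2 * H ^ 2 * L * E1) ≤ L ^ 3 * (16 * Y + 16 * W) := by
    calc L * (2 * H ^ 2 * L * E1) ≤ L * (2 * H ^ 2 * L * (4 * X + 8 * L)) := by gcongr
      _ = 8 * (L ^ 2 * Y) + 16 * (L ^ 3 * H ^ 2) := by rw [hY]; ring
      _ ≤ 8 * (2 * L ^ 3 * Y) + 16 * (L ^ 3 * W) := by gcongr
      _ = _ := by ring
  have hT2 : L * (36 * H ^ 3 * S * L * E2) ≤ L ^ 3 * (504 * W) := by
    calc L * (36 * H ^ 3 * S * L * E2)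
        ≤ L * (36 * H ^ 3 * S * L * (6 * (S * A * L) + 8 * L)) := by gcongr
      _ = L ^ 3 * (216 * (H ^ 3 * S * (S * A)) + 288 * (H ^ 3 * S)) := by ring
      _ ≤ L ^ 3 * (216 * W + 288 * W) := by gcongr
      _ = _ := by ring
  have hT : C * L * (2 * H ^ 2 * L * E1 + 36 * H ^ 3 * S * L * E2) ≤
      C * (L ^ 3 * (520 * (Y + W))) := by
    rw [mul_assoc, mul_add]
    refine mul_le_mul_of_nonneg_left ?_ hC0.le
    have : 0 ≤ L ^ 3 * Y := by positivity
    linarith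
  have hR1 : H * √K ≤ 8 * L ^ 3 * Y := hKY.trans (le_mul_of_one_le_left hY0 hL3)
  have hR2 : (H : ℝ) ≤ 8 * L ^ 3 * W := hHW.trans (le_mul_of_one_le_left hW0 hL3)
  have hR3 : H * L ≤ 4 * L ^ 3 * W := by
    calc H * L ≤ W * (4 * L ^ 3) := by gcongr
      _ = _ := by ring
  have hLY : 0 ≤ L ^ 3 * Y := by positivity
  have hLW : 0 ≤ L ^ 3 * W := by positivity
  linarith

end SSR

/-! ### From the concentration event to the theorem -/

namespace SSR

theorem rpow_mul_sqrt_eq {h x k : ℝ} (hh : 0 < h) :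
    h ^ (3 / 2 : ℝ) * √(x * (h * k)) = h ^ 2 * √(x * k) := by
  have h1 : x * (h * k) = h * (x * k) := by ring
  rw [h1, Real.sqrt_mul hh.le, ← mul_assoc, Real.sqrt_eq_rpow, ← Real.rpow_add hh]
  norm_num

/-- If the sample size dominates `H⁵S³A` up to logarithms, the lower-order term is absorbed. -/
theorem lower_order_le {h s a t l c : ℝ} {q : ℕ} (hh : 0 < h) (hs : 0 < s) (ha : 0 < a)
    (ht : 0 ≤ t) (hl : 1 / 2 ≤ l) (hc : 0 < c) (hcond : c * (h ^ 5 * s ^ 3 * a) ≤ t * l ^ q) :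
    h ^ 4 * s ^ 2 * a ≤ (1 + 2 ^ q) / √c * l ^ q * (h ^ (3 / 2 : ℝ) * √(s * a * t)) := by
  have hlq : 0 < l ^ q := by positivity
  -- Only `l ≥ 1/2` is known, so `l ^ q` may be below 1; the factor `2 ^ q` compensates for this.
  have h2l : 1 ≤ 2 ^ q * l ^ q := by
    rw [← mul_pow]
    exact one_le_pow₀ (by linarith)
  have hh3 : (h ^ (3 / 2 : ℝ)) ^ 2 = h ^ 3 := by
    rw [← Real.rpow_natCast, ← Real.rpow_mul hh.le, ← Real.rpow_natCast]
    norm_num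
  have hr : 0 ≤ (1 + 2 ^ q) / √c * l ^ q * (h ^ (3 / 2 : ℝ) * √(s * a * t)) := by positivity
  refine le_of_sq_le_sq ?_ hr
  have hsq : ((1 + 2 ^ q) / √c * l ^ q * (h ^ (3 / 2 : ℝ) * √(s * a * t))) ^ 2 =
      ((1 + 2 ^ q) * l ^ q) ^ 2 * (h ^ 3 * (s * a * t)) / c := by
    rw [mul_pow, mul_pow, mul_pow, div_pow, Real.sq_sqrt hc.le, hh3, Real.sq_sqrt (by positivity)]
    ring
  rw [hsq, le_div_iff₀ hc]
  have h1 : l ^ q ≤ ((1 + 2 ^ q) * l ^ q) ^ 2 := by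
    have : l ^ q * 1 ≤ ((1 + 2 ^ q) * l ^ q) * ((1 + 2 ^ q) * l ^ q) := by
      refine mul_le_mul ?_ ?_ zero_le_one (by positivity)
      · have : 0 ≤ (2 : ℝ) ^ q * l ^ q := by positivity
        linarith
      · linarith
    linarith
  calc (h ^ 4 * s ^ 2 * a) ^ 2 * c = c * (h ^ 5 * s ^ 3 * a) * (h ^ 3 * (s * a)) := by ring
    _ ≤ t * l ^ q * (h ^ 3 * (s * a)) := by gcongr
    _ = l ^ q * (h ^ 3 * (s * a * t)) := by ring
    _ ≤ _ := by gcongr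

variable {H S A : ℕ} (M : TabularMDP H S A) {sel : ℕ → Fin H → Fin S → (Fin A → ℝ) → Fin A}

/-- High-probability regret bound with its lower-order term. -/
theorem one_sub_le_measure_regret_le (hsel : IsArgmaxRule sel) (hH : 1 ≤ H) {K : ℕ} (hK : 1 ≤ K)
    {δ ε : ℝ} (hδ : 0 < δ) (hε : 0 < ε) :
    1 - δ ≤ (sampleLaw M).real {ω | regret M sel K ω ≤
      (1040 * regretConst ε + 96) * Real.log (2 * H * S * A * (H * K) / δ) ^ 3 *
        ((H : ℝ) ^ (3 / 2 : ℝ) * √(S * A * (H * K)) + (H : ℝ) ^ 4 * (S : ℝ) ^ 2 * A) +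
      (1040 * regretConst ε + 96) * H * δ ^ (-ε)} := by
  rcases le_total 1 δ with hδ1 | hδ1
  · exact (sub_nonpos.2 hδ1).trans measureReal_nonneg
  -- The state and action sets are nonempty because an initial state and a value of the selection
  -- rule exist.
  have hS : 1 ≤ S := Fin.pos M.init
  have hA : 1 ≤ A := Fin.pos (sel 0 ⟨0, hH⟩ M.init fun _ => 0)
  have : Nonempty (Fin A) := ⟨⟨0, hA⟩⟩
  have hH' : (1 : ℝ) ≤ H := by exact_mod_cast hH
  have hS' : (1 : ℝ) ≤ S := by exact_mod_cast hS
  have hA' : (1 : ℝ) ≤ A := by exact_mod_cast hA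
  have hK' : (1 : ℝ) ≤ K := by exact_mod_cast hK
  rw [rpow_mul_sqrt_eq (by linarith)]
  set L := Real.log (2 * H * S * A * (H * K) / δ) with hL
  have hLhalf : 1 / 2 ≤ L := log_confidence_ge_half hH' hS' hA' hK' hδ hδ1
  have hbad := (measure_not_concentrated_le M hsel hH K (by linarith : 0 < L)).trans
    (ENNReal.ofReal_le_ofReal (failure_probability_le hH' hS' hA' hK' hδ hδ1))
  have hbad' : (sampleLaw M).real {ω | ¬ Concentrated M sel K L ω} ≤ δ :=
    ENNReal.toReal_le_of_le_ofReal hδ.le hbad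
  have hcover : Set.univ ⊆ {ω | regret M sel K ω ≤
      (1040 * regretConst ε + 96) * L ^ 3 *
        ((H : ℝ) ^ 2 * √(S * A * K) + (H : ℝ) ^ 4 * (S : ℝ) ^ 2 * A) +
      (1040 * regretConst ε + 96) * H * δ ^ (-ε)} ∪ {ω | ¬ Concentrated M sel K L ω} := by
    intro ω _
    by_cases hω : Concentrated M sel K L ω
    · left
      have h1 := regret_le_of_concentrated M hsel hH hS hA hK hδ hδ1 hε hL hω
      have h2 : 2 * H * δ ^ (-ε) ≤ (1040 * regretConst ε + 96) * H * δ ^ (-ε) := by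
        have := regretConst_pos ε
        gcongr
        linarith
      exact h1.trans (add_le_add le_rfl h2)
    · exact Or.inr hω
  have h1 := (measureReal_mono hcover (μ := sampleLaw M)).trans (measureReal_union_le _ _)
  rw [probReal_univ] at h1
  linarith

end SSR

theorem theorem1 :
    (∃ p : ℕ, ∀ ε : ℝ, 0 < ε → ∃ C : ℝ, 0 < C ∧
      ∀ (H S A K : ℕ) (_hH : 1 ≤ H) (_hK : 1 ≤ K) (M : TabularMDP H S A)
        (sel : ℕ → Fin H → Fin S → (Fin A → ℝ) → Fin A) (_hsel : SSR.IsArgmaxRule sel)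
        (T : ℝ) (_hT : T = H * K) (δ : ℝ) (_hδ : 0 < δ),
        1 - δ ≤ (SSR.sampleLaw M).real {ω | SSR.regret M sel K ω ≤
          C * Real.log (2 * H * S * A * T / δ) ^ p *
            ((H : ℝ) ^ (3 / 2 : ℝ) * √(S * A * T) + (H : ℝ) ^ 4 * (S : ℝ) ^ 2 * A)
          + C * H * δ ^ (-ε)}) ∧
    (∀ c : ℝ, 0 < c → ∀ q : ℕ, ∃ p : ℕ, ∀ ε : ℝ, 0 < ε → ∃ C : ℝ, 0 < C ∧
      ∀ (H S A K : ℕ) (_hH : 1 ≤ H) (_hK : 1 ≤ K) (M : TabularMDP H S A)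
        (sel : ℕ → Fin H → Fin S → (Fin A → ℝ) → Fin A) (_hsel : SSR.IsArgmaxRule sel)
        (T : ℝ) (_hT : T = H * K) (δ : ℝ) (_hδ : 0 < δ),
        c * ((H : ℝ) ^ 5 * (S : ℝ) ^ 3 * A) ≤ T * Real.log (2 * H * S * A * T / δ) ^ q →
        1 - δ ≤ (SSR.sampleLaw M).real {ω | SSR.regret M sel K ω ≤
          C * Real.log (2 * H * S * A * T / δ) ^ p *
            ((H : ℝ) ^ (3 / 2 : ℝ) * √(S * A * T))
          + C * H * δ ^ (-ε)}) := by
  -- The three logarithms come from the truncated seed, from the bonus coefficients, and from the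
  -- sums of inverse counts with their deviations. In (ii) a further `L ^ q` absorbs the lower-order
  -- term, and `2 ^ q` lets the leading term carry the same power.
  refine ⟨⟨3, fun ε hε => ⟨1040 * SSR.regretConst ε + 96, ?_, ?_⟩⟩,
    fun c hc q => ⟨3 + q, fun ε hε =>
      ⟨(1040 * SSR.regretConst ε + 96) * (2 ^ q + (1 + 2 ^ q) / √c), ?_, ?_⟩⟩⟩
  · linarith [SSR.regretConst_pos ε]
  · rintro H S A K hH hK M sel hsel T rfl δ hδ
    exact SSR.one_sub_le_measure_regret_le M hsel hH hK hδ hε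
  · have := SSR.regretConst_pos ε
    positivity
  · rintro H S A K hH hK M sel hsel T rfl δ hδ hcond
    rcases le_total 1 δ with hδ1 | hδ1
    · exact (sub_nonpos.2 hδ1).trans measureReal_nonneg
    have hH' : (1 : ℝ) ≤ H := by exact_mod_cast hH
    have hS' : (1 : ℝ) ≤ S := by exact_mod_cast Fin.pos M.init
    have hA' : (1 : ℝ) ≤ A := by exact_mod_cast Fin.pos (sel 0 ⟨0, hH⟩ M.init fun _ => 0)
    have hK' : (1 : ℝ) ≤ K := by exact_mod_cast hK
    refine (SSR.one_sub_le_measure_regret_le M hsel hH hK hδ hε).trans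
      (measureReal_mono fun ω (hω : SSR.regret M sel K ω ≤ _) =>
        show SSR.regret M sel K ω ≤ _ from hω.trans ?_)
    set C₀ := 1040 * SSR.regretConst ε + 96 with hC₀
    have hC₀0 : 0 < C₀ := by linarith [SSR.regretConst_pos ε]
    have hL := SSR.log_confidence_ge_half hH' hS' hA' hK' hδ hδ1
    set L := Real.log (2 * H * S * A * (H * K) / δ)
    have hlow := SSR.lower_order_le (by linarith) (by linarith) (by linarith) (by positivity) hL hc
      hcond
    set X := (H : ℝ) ^ (3 / 2 : ℝ) * √(S * A * (H * K))
    have hX : 0 ≤ X := by positivity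
    have h2q : (1 : ℝ) ≤ 2 ^ q := one_le_pow₀ (by norm_num)
    have hXL : X ≤ 2 ^ q * L ^ q * X := by
      refine le_mul_of_one_le_left hX ?_
      rw [← mul_pow]
      exact one_le_pow₀ (by linarith)
    have hmain : C₀ * L ^ 3 * (X + (H : ℝ) ^ 4 * (S : ℝ) ^ 2 * A) ≤
        C₀ * (2 ^ q + (1 + 2 ^ q) / √c) * L ^ (3 + q) * X := by
      calc C₀ * L ^ 3 * (X + (H : ℝ) ^ 4 * (S : ℝ) ^ 2 * A)
          ≤ C₀ * L ^ 3 * (2 ^ q * L ^ q * X + (1 + 2 ^ q) / √c * L ^ q * X) := by gcongr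
        _ = _ := by rw [pow_add]; ring
    have hrest : C₀ * H * δ ^ (-ε) ≤ C₀ * (2 ^ q + (1 + 2 ^ q) / √c) * H * δ ^ (-ε) := by
      have h1 : (1 : ℝ) ≤ 2 ^ q + (1 + 2 ^ q) / √c := by
        have : 0 ≤ (1 + (2 : ℝ) ^ q) / √c := by positivity
        linarith
      have h2 : C₀ ≤ C₀ * (2 ^ q + (1 + 2 ^ q) / √c) := le_mul_of_one_le_right hC₀0.le h1
      gcongr
    exact add_le_add hmain hrest
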